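/- Let $X$ be a non-empty Stone space (a totally disconnected compact Hausdorff space) and $\varphi\colon X\to X$ a homeomorphism. Let $Y^\varphi=(X\times\mathbb R)/\mathbb Z$ be the suspension, where $n\cdot(x,t)=(\varphi^n(x),t-n)$, write $[x,t]$ for the class of $(x,t)$, and let $\mathsf H_0(\varphi)$ be the group of homeomorphisms of $Y^\varphi$ that are isotopic to the identity. A \emph{dyadic chart} is a pair $(C,J)$ with $C\subset X$ clopen and $J$ a non-empty bounded open interval with dyadic rational endpoints whose length is smaller than the first return time $\min\{n\ge 1:\exists x\in C,\ \varphi^n(x)\in C\}\in\mathbb N\cup\{\infty\}$; its \emph{domain} is $U_{C\times J}=\{[x,t]:x\in C,\ t\in J\}$. A homeomorphism between intervals is \emph{dyadic PL} if it is piecewise affine with finitely many breakpoints, all dyadic rationals, and is of the form $t\mapsto 2^mt+c$, with $m\in\mathbb Z$ and $c$ a dyadic rational, on each piece. Let $\mathsf T(\varphi)\le\mathsf H_0(\varphi)$ be the group of all $g\in\mathsf H_0(\varphi)$ such that every point of $Y^\varphi$ lies in the domain of a dyadic chart $(C,J)$ for which there is a dyadic PL homeomorphism $f\colon J\to f(J)$,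 with $f(J)$ an open interval with dyadic endpoints such that $(C,f(J))$ is again a dyadic chart, satisfying $g([x,t])=[x,f(t)]$ for all $x\in C$, $t\in J$. For an open dyadic interval $J$ let $F_J$ be the group of dyadic PL homeomorphisms of $\mathbb R$ that are the identity outside $J$; $F=F_{(0,1)}$ is Thompson's group. For a dyadic chart $(C,J)$ let $F_{C,J}\le\mathsf T(\varphi)$ be the subgroup of those elements that, for some $f\in F_J$, act by $[x,t]\mapsto[x,f(t)]$ on $U_{C\times J}$ ($x\in C$, $t\in J$) and are the identity outside $U_{C\times J}$. Let $I_0=(-1/4,1/2)$ and $I_1=(1/4,1+1/8)$. \textbf{Theorem.} (a) If $(X,\varphi)$ is topologically conjugate to a subshift (the shift restricted to a non-empty closed shift-invariant subset of $A^{\mathbb Z}$, with $A$ a finite alphabet), then $\mathsf T(\varphi)$ is finitely generated. (b) Let $X=C_1\sqcup\dots\sqcup C_d$ be a generating clopen partition, that is, a partition into clopen sets such that the sets $\varphi^n(C_i)$, $n\in\mathbb Z$, $1\le i\le d$, separate the points of $X$. Then $\mathsf T(\varphi)$ is generated by the subgroups $F_{X,I_0}$ and $F_{C_1,I_1},\dots,F_{C_d,I_1}$.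 Moreover $F_{X,I_0}$, and $F_{C_i,I_1}$ for every $i$ with $C_i\ne\emptyset$, are copies of Thompson's group $F$: every $f\in F_{I_0}$ (resp. $f\in F_{I_1}$) acts in the above way on $Y^\varphi$, this defines an isomorphism $F_{I_0}\to F_{X,I_0}$ (resp. $F_{I_1}\to F_{C_i,I_1}$), and these groups are isomorphic to $F$. -/

import Mathlib

open Set Filter Topology

namespace StoneSystem

/-! ### Subshifts and generating partitions -/

/-- The shift on bi-infinite sequences. -/
def shift {A : Type*} (a : ℤ → A) : ℤ → A := fun n => a (n + 1)

/-- `(X, φ)` is topologically conjugate to a subshift: a non-empty closed shift-invariant set of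
bi-infinite sequences over a finite (discrete) alphabet, with the restriction of the shift. -/
def IsConjugateToSubshift {X : Type*} [TopologicalSpace X] (φ : X ≃ₜ X) : Prop :=
  ∃ (A : Type) (_ : Finite A) (_ : TopologicalSpace A) (_ : DiscreteTopology A)
    (S : Set (ℤ → A)), S.Nonempty ∧ IsClosed S ∧ shift '' S = S ∧
      ∃ e : X ≃ₜ S, ∀ x : X, (e (φ x) : ℤ → A) = shift (e x : ℤ → A)

/-- A generating clopen partition `X = C 0 ⊔ ⋯ ⊔ C (d - 1)`: the sets `φ ^ n (C i)`, for `n : ℤ`,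
separate the points of `X`. (Empty pieces are allowed.) -/
structure IsGeneratingPartition {X : Type*} [TopologicalSpace X] (φ : X ≃ₜ X) {d : ℕ}
    (C : Fin d → Set X) : Prop where
  isClopen : ∀ i, IsClopen (C i)
  disjoint : ∀ i j, i ≠ j → Disjoint (C i) (C j)
  cover : ⋃ i, C i = univ
  separates : ∀ x y : X, x ≠ y →
    ∃ (n : ℤ) (i : Fin d), x ∈ (φ ^ n : X ≃ₜ X) '' C i ∧ y ∉ (φ ^ n : X ≃ₜ X) '' C i

/-! ### The suspension -/

theorem iter_add {X : Type*} [TopologicalSpace X] (φ : X ≃ₜ X) (m n : ℤ) (x : X) :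
    (φ ^ (m + n) : X ≃ₜ X) x = (φ ^ m : X ≃ₜ X) ((φ ^ n : X ≃ₜ X) x) := by
  rw [zpow_add]; rfl

/-- The orbit relation of the action `n • (x, t) = (φ ^ n x, t - n)` of `ℤ` on `X × ℝ`. -/
def suspensionSetoid {X : Type*} [TopologicalSpace X] (φ : X ≃ₜ X) : Setoid (X × ℝ) where
  r p q := ∃ n : ℤ, q = ((φ ^ n : X ≃ₜ X) p.1, p.2 - n)
  iseqv :=
    { refl := fun p => ⟨0, by simp⟩
      symm := by
        rintro ⟨x, t⟩ _ ⟨n, rfl⟩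
        refine ⟨-n, ?_⟩
        simp only [← iter_add]
        simp
      trans := by
        rintro ⟨x, t⟩ _ _ ⟨n, rfl⟩ ⟨m, rfl⟩
        refine ⟨m + n, ?_⟩
        simp only [iter_add, Prod.mk.injEq, true_and]
        push_cast
        ring }

/-- The suspension (mapping torus) `(X × ℝ) / ℤ`, with the quotient topology. -/
def Suspension {X : Type*} [TopologicalSpace X] (φ : X ≃ₜ X) : Type _ :=
  Quotient (suspensionSetoid φ)

instance {X : Type*} [TopologicalSpace X] (φ : X ≃ₜ X) : TopologicalSpace (Suspension φ) :=
  inferInstanceAs (TopologicalSpace (Quotient (suspensionSetoid φ)))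

/-- The point `[x, t]` of the suspension. -/
def Suspension.mk {X : Type*} [TopologicalSpace X] (φ : X ≃ₜ X) (x : X) (t : ℝ) : Suspension φ :=
  Quotient.mk (suspensionSetoid φ) (x, t)

theorem Suspension.mk_eq {X : Type*} [TopologicalSpace X] (φ : X ≃ₜ X) {x x' : X} {t t' : ℝ} :
    Suspension.mk φ x t = Suspension.mk φ x' t' ↔
      ∃ n : ℤ, x' = (φ ^ n : X ≃ₜ X) x ∧ t' = t - n := by
  refine Quotient.eq.trans ?_
  change (∃ n : ℤ, (x', t') = _) ↔ _
  simp [Prod.ext_iff]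

theorem Suspension.mk_shift {X : Type*} [TopologicalSpace X] (φ : X ≃ₜ X) (n : ℤ) (x : X) (t : ℝ) :
    Suspension.mk φ ((φ ^ n : X ≃ₜ X) x) (t - n) = Suspension.mk φ x t :=
  ((Suspension.mk_eq φ).2 ⟨n, rfl, rfl⟩).symm

theorem Suspension.exists_rep {X : Type*} [TopologicalSpace X] (φ : X ≃ₜ X) (y : Suspension φ) :
    ∃ x t, y = Suspension.mk φ x t := by
  induction y using Quotient.inductionOn with
  | h p => exact ⟨p.1, p.2, rfl⟩

/-- The group of homeomorphisms of `Y` that are isotopic to the identity. -/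
def isotopicToId (Y : Type*) [TopologicalSpace Y] : Subgroup (Y ≃ₜ Y) where
  carrier := {g | ∃ H : unitInterval × Y → Y, Continuous H ∧
    (∀ t, IsHomeomorph fun y => H (t, y)) ∧ (∀ y, H (0, y) = y) ∧ ∀ y, H (1, y) = g y}
  one_mem' := ⟨fun p => p.2, continuous_snd, fun _ => IsHomeomorph.id, fun _ => rfl, fun _ => rfl⟩
  mul_mem' := by
    rintro g h ⟨G, hG, hG', hG0, hG1⟩ ⟨H, hH, hH', hH0, hH1⟩
    refine ⟨fun p => G (p.1, H p), by fun_prop, fun t => (hG' t).comp (hH' t), ?_, ?_⟩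
    · intro y; simp [hG0, hH0]
    · intro y; simp [hG1, hH1]
  inv_mem' := by
    rintro g ⟨G, hG, hG', hG0, hG1⟩
    have hc : Continuous (g⁻¹ : Y ≃ₜ Y) := (g⁻¹ : Y ≃ₜ Y).continuous
    refine ⟨fun p => G (unitInterval.symm p.1, (g⁻¹ : Y ≃ₜ Y) p.2), by fun_prop,
      fun t => (hG' (unitInterval.symm t)).comp (g⁻¹ : Y ≃ₜ Y).isHomeomorph, ?_, ?_⟩
    · intro y
      simp only [unitInterval.symm_zero, hG1]
      exact g.apply_symm_apply y
    · intro y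
      simp only [unitInterval.symm_one, hG0]

/-! ### Dyadic piecewise linear maps -/

/-- Dyadic rationals. -/
def IsDyadic (r : ℝ) : Prop := ∃ (p : ℤ) (q : ℕ), r = p / 2 ^ q

/-- `f` is, on the interval `I`, piecewise affine with finitely many breakpoints, all of them dyadic
(they lie in the finite set `B`), and on every interval `S ⊆ I` without breakpoints it has the form
`t ↦ 2 ^ m * t + c` with `m : ℤ` and `c` dyadic. -/
def IsDyadicPLOn (f : ℝ → ℝ) (I : Set ℝ) : Prop :=
  ∃ B : Set ℝ, B.Finite ∧ (∀ r ∈ B, IsDyadic r) ∧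
    ∀ S : Set ℝ, S.OrdConnected → S ⊆ I → Disjoint S B →
      ∃ (m : ℤ) (c : ℝ), IsDyadic c ∧ ∀ t ∈ S, f t = 2 ^ m * t + c

theorem IsDyadic.int (n : ℤ) : IsDyadic n := ⟨n, 0, by simp⟩

theorem IsDyadic.neg {r : ℝ} (hr : IsDyadic r) : IsDyadic (-r) := by
  obtain ⟨p, q, rfl⟩ := hr
  exact ⟨-p, q, by push_cast; ring⟩

theorem IsDyadic.add {r s : ℝ} (hr : IsDyadic r) (hs : IsDyadic s) : IsDyadic (r + s) := by
  obtain ⟨p, q, rfl⟩ := hr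
  obtain ⟨p', q', rfl⟩ := hs
  exact ⟨p * 2 ^ q' + p' * 2 ^ q, q + q', by push_cast; rw [pow_add]; field_simp⟩

theorem IsDyadic.sub {r s : ℝ} (hr : IsDyadic r) (hs : IsDyadic s) : IsDyadic (r - s) := by
  rw [sub_eq_add_neg]; exact hr.add hs.neg

theorem IsDyadic.zpow_mul {r : ℝ} (hr : IsDyadic r) (m : ℤ) : IsDyadic (2 ^ m * r) := by
  obtain ⟨p, q, rfl⟩ := hr
  obtain ⟨k, rfl | rfl⟩ := m.eq_nat_or_neg
  · exact ⟨p * 2 ^ k, q, by push_cast; rw [zpow_natCast]; ring⟩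
  · exact ⟨p, q + k, by rw [zpow_neg, zpow_natCast]; field_simp; ring⟩

theorem exists_dyadic_between {u v : ℝ} (h : u < v) : ∃ r, IsDyadic r ∧ u < r ∧ r < v := by
  obtain ⟨n, hn⟩ := exists_pow_lt_of_lt_one (sub_pos.2 h) (by norm_num : (1 / 2 : ℝ) < 1)
  have h2 : (0 : ℝ) < 2 ^ n := by positivity
  rw [div_pow, one_pow, div_lt_iff₀ h2] at hn
  refine ⟨(⌊u * 2 ^ n⌋ + 1 : ℤ) / 2 ^ n, ⟨_, n, rfl⟩, ?_, ?_⟩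
  · rw [lt_div_iff₀ h2]; push_cast; exact Int.lt_floor_add_one _
  · rw [div_lt_iff₀ h2]; push_cast
    have := Int.floor_le (u * 2 ^ n)
    nlinarith

theorem IsDyadicPLOn.mono {f : ℝ → ℝ} {I J : Set ℝ} (hf : IsDyadicPLOn f I) (h : J ⊆ I) :
    IsDyadicPLOn f J := by
  obtain ⟨B, hB, hd, hp⟩ := hf
  exact ⟨B, hB, hd, fun S hS hSJ => hp S hS (hSJ.trans h)⟩

theorem IsDyadicPLOn.congr {f g : ℝ → ℝ} {I : Set ℝ} (hf : IsDyadicPLOn f I) (h : EqOn f g I) :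
    IsDyadicPLOn g I := by
  obtain ⟨B, hB, hd, hp⟩ := hf
  refine ⟨B, hB, hd, fun S hS hSI hSB => ?_⟩
  obtain ⟨m, c, hc, hm⟩ := hp S hS hSI hSB
  exact ⟨m, c, hc, fun t ht => by rw [← h (hSI ht), hm t ht]⟩

theorem isDyadicPLOn_add_const {c : ℝ} (hc : IsDyadic c) (I : Set ℝ) :
    IsDyadicPLOn (fun t => t + c) I :=
  ⟨∅, finite_empty, by simp, fun _ _ _ _ => ⟨0, c, hc, by simp⟩⟩

theorem IsDyadicPLOn.exists_affine_at {f : ℝ → ℝ} {I : Set ℝ} (hf : IsDyadicPLOn f I)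
    (hI : IsOpen I) (hc : ContinuousOn f I) {r : ℝ} (hr : r ∈ I) :
    ∃ (m : ℤ) (c : ℝ), IsDyadic c ∧ f r = 2 ^ m * r + c := by
  obtain ⟨B, hB, -, hp⟩ := hf
  have hU : I ∩ (B \ {r})ᶜ ∈ 𝓝 r :=
    inter_mem (hI.mem_nhds hr) ((hB.subset sdiff_subset).isClosed.isOpen_compl.mem_nhds (by simp))
  obtain ⟨l, u, ⟨hl, hu⟩, hlu⟩ := mem_nhds_iff_exists_Ioo_subset.1 hU
  have hsub : Ioo r u ⊆ I ∩ (B \ {r})ᶜ := (Ioo_subset_Ioo_left hl.le).trans hlu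
  obtain ⟨m, c, hcd, hm⟩ := hp (Ioo r u) ordConnected_Ioo (fun t ht => (hsub ht).1) (by
    rw [disjoint_left]
    intro t ht htB
    exact (hsub ht).2 ⟨htB, ht.1.ne'⟩)
  refine ⟨m, c, hcd, ?_⟩
  have h1 : Tendsto f (𝓝[>] r) (𝓝 (f r)) :=
    (hc.continuousAt (hI.mem_nhds hr)).tendsto.mono_left nhdsWithin_le_nhds
  have h2 : Tendsto (fun t : ℝ => (2 : ℝ) ^ m * t + c) (𝓝[>] r) (𝓝 (2 ^ m * r + c)) :=
    (by fun_prop : Continuous fun t : ℝ => (2 : ℝ) ^ m * t + c).continuousAt.tendsto.mono_left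
      nhdsWithin_le_nhds
  refine tendsto_nhds_unique (h1.congr' ?_) h2
  filter_upwards [Ioo_mem_nhdsGT hu] with t ht using hm t ht

theorem IsDyadicPLOn.isDyadic_iff {f : ℝ → ℝ} {I : Set ℝ} (hf : IsDyadicPLOn f I)
    (hI : IsOpen I) (hc : ContinuousOn f I) {r : ℝ} (hr : r ∈ I) :
    IsDyadic (f r) ↔ IsDyadic r := by
  obtain ⟨m, c, hcd, h⟩ := hf.exists_affine_at hI hc hr
  constructor
  · intro hd
    have : r = 2 ^ (-m) * (f r - c) := by
      rw [h, zpow_neg]; field_simp; ring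
    rw [this]; exact (hd.sub hcd).zpow_mul _
  · intro hd
    rw [h]; exact (hd.zpow_mul m).add hcd

theorem IsDyadicPLOn.comp {f g : ℝ → ℝ} {I J : Set ℝ} (hg : IsDyadicPLOn g J)
    (hf : IsDyadicPLOn f I) (hI : IsOpen I) (hc : ContinuousOn f I) (hinj : InjOn f I)
    (hmaps : MapsTo f I J) : IsDyadicPLOn (g ∘ f) I := by
  have hfd := fun {r} => hf.isDyadic_iff hI hc (r := r)
  obtain ⟨B, hB, hBd, hp⟩ := hf
  obtain ⟨B', hB', hBd', hp'⟩ := hg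
  refine ⟨B ∪ (I ∩ f ⁻¹' B'), hB.union ?_, ?_, ?_⟩
  · exact Finite.of_finite_image (hB'.subset (by rintro _ ⟨t, ht, rfl⟩; exact ht.2))
      (hinj.mono inter_subset_left)
  · rintro r (hr | hr)
    · exact hBd r hr
    · exact (hfd hr.1).1 (hBd' _ hr.2)
  · intro S hS hSI hSB
    rw [disjoint_union_right] at hSB
    obtain ⟨m, c, hcd, hm⟩ := hp S hS hSI hSB.1
    obtain ⟨m', c', hcd', hm'⟩ := hp' (f '' S)
      ((isPreconnected_iff_ordConnected.2 hS).image f (hc.mono hSI)).ordConnected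
      (by rintro _ ⟨t, ht, rfl⟩; exact hmaps (hSI ht))
      (by
        rw [disjoint_left]
        rintro _ ⟨t, ht, rfl⟩ htB
        exact disjoint_left.1 hSB.2 ht ⟨hSI ht, htB⟩)
    refine ⟨m' + m, 2 ^ m' * c + c', (hcd.zpow_mul m').add hcd', fun t ht => ?_⟩
    rw [Function.comp, hm' _ (mem_image_of_mem f ht), hm t ht, zpow_add₀ two_ne_zero]
    ring

theorem IsDyadicPLOn.symm {f : OpenPartialHomeomorph ℝ ℝ} (hf : IsDyadicPLOn f f.source) :
    IsDyadicPLOn f.symm f.target := by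
  have hfd := fun {r} => hf.isDyadic_iff f.open_source f.continuousOn (r := r)
  obtain ⟨B, hB, hBd, hp⟩ := hf
  refine ⟨f '' (f.source ∩ B), (hB.subset inter_subset_right).image f, ?_, ?_⟩
  · rintro _ ⟨r, ⟨hr, hrB⟩, rfl⟩
    exact (hfd hr).2 (hBd r hrB)
  · intro S hS hSJ hSB
    obtain ⟨m, c, hcd, hm⟩ := hp (f.symm '' S)
      ((isPreconnected_iff_ordConnected.2 hS).image f.symm
        (f.symm.continuousOn.mono hSJ)).ordConnected
      (by rintro _ ⟨t, ht, rfl⟩; exact f.map_target (hSJ ht))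
      (by
        rw [disjoint_left]
        rintro _ ⟨t, ht, rfl⟩ htB
        exact disjoint_left.1 hSB ht
          ⟨f.symm t, ⟨f.map_target (hSJ ht), htB⟩, f.right_inv (hSJ ht)⟩)
    refine ⟨-m, -(2 ^ (-m) * c), (hcd.zpow_mul _).neg, fun t ht => ?_⟩
    have := hm _ (mem_image_of_mem f.symm ht)
    rw [f.right_inv (hSJ ht)] at this
    have h2 : (2 : ℝ) ^ (-m) * 2 ^ m = 1 := by
      rw [← zpow_add₀ two_ne_zero]; simp
    linear_combination (-(2 : ℝ) ^ (-m)) * this - f.symm t * h2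

/-- The group `F_J` of dyadic piecewise linear self-homeomorphisms of `ℝ` that are the identity
on the complement of `J`. -/
def dyadicPLGroup (J : Set ℝ) : Subgroup (ℝ ≃ₜ ℝ) where
  carrier := {f | IsDyadicPLOn f univ ∧ ∀ t, t ∉ J → f t = t}
  one_mem' := ⟨(isDyadicPLOn_add_const (IsDyadic.int 0) univ).congr (fun t _ => by simp),
    fun _ _ => rfl⟩
  mul_mem' := by
    rintro f g ⟨hf, hf'⟩ ⟨hg, hg'⟩
    refine ⟨hf.comp hg isOpen_univ g.continuous.continuousOn g.injective.injOn (mapsTo_univ _ _),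
      fun t ht => ?_⟩
    change f (g t) = t
    rw [hg' t ht, hf' t ht]
  inv_mem' := by
    rintro f ⟨hf, hf'⟩
    refine ⟨IsDyadicPLOn.symm (f := f.toOpenPartialHomeomorph) hf, fun t ht => ?_⟩
    change f.symm t = t
    rw [Homeomorph.symm_apply_eq, hf' t ht]

/-- Thompson's group `F`, as the group of dyadic piecewise linear homeomorphisms of `[0, 1]`,
extended to `ℝ` by the identity. -/
abbrev thompsonF : Subgroup (ℝ ≃ₜ ℝ) := dyadicPLGroup (Ioo 0 1)

theorem mem_iff_of_mem_dyadicPLGroup {J : Set ℝ} {f : ℝ ≃ₜ ℝ} (hf : f ∈ dyadicPLGroup J) (t : ℝ) :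
    f t ∈ J ↔ t ∈ J := by
  constructor
  · intro h
    by_contra ht
    exact ht (hf.2 t ht ▸ h)
  · intro h
    by_contra ht
    exact ht (by rwa [f.injective (hf.2 _ ht)])

/-! ### Charts and the group `T(φ)` -/

/-- `C` is clopen, `a < b` are dyadic, and the length of `(a, b)` is smaller than the first return
time `min {n ≥ 1 | ∃ x ∈ C, φ ^ n x ∈ C}` of `C`; that is, `C × (a, b)` is a dyadic chart. -/
structure IsDyadicChart {X : Type*} [TopologicalSpace X] (φ : X ≃ₜ X) (C : Set X) (a b : ℝ) :
    Prop where
  isClopen : IsClopen C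
  left : IsDyadic a
  right : IsDyadic b
  lt : a < b
  length_lt : ∀ n : ℕ, 1 ≤ n → (∃ x ∈ C, (φ ^ n : X ≃ₜ X) x ∈ C) → b - a < n

/-- The domain `U_{C × J}`, the image of `C × J` in the suspension. -/
def domain {X : Type*} [TopologicalSpace X] (φ : X ≃ₜ X) (C : Set X) (J : Set ℝ) :
    Set (Suspension φ) :=
  {y | ∃ x ∈ C, ∃ t ∈ J, y = Suspension.mk φ x t}

/-- In the dyadic charts `C × (a, b)` and `C × (c, d)`, the homeomorphism `g` of the suspension is
`(x, t) ↦ (x, f t)` for a dyadic piecewise linear homeomorphism `f : (a, b) → (c, d)`. -/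
structure IsDyadicPLInChart {X : Type*} [TopologicalSpace X] (φ : X ≃ₜ X)
    (g : Suspension φ ≃ₜ Suspension φ) (C : Set X) (a b c d : ℝ)
    (f : OpenPartialHomeomorph ℝ ℝ) : Prop where
  chart_source : IsDyadicChart φ C a b
  chart_target : IsDyadicChart φ C c d
  source_eq : f.source = Ioo a b
  target_eq : f.target = Ioo c d
  dyadicPL : IsDyadicPLOn f (Ioo a b)
  map_eq : ∀ x ∈ C, ∀ t ∈ Ioo a b, g (Suspension.mk φ x t) = Suspension.mk φ x (f t)

section Closure

variable {X : Type*} [TopologicalSpace X] {φ : X ≃ₜ X}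

theorem IsDyadicChart.shrink {C C' : Set X} {a b a' b' : ℝ} (h : IsDyadicChart φ C a b)
    (hC' : IsClopen C') (hC : C' ⊆ C) (ha : IsDyadic a') (hb : IsDyadic b') (hab : a' < b')
    (hl : b' - a' ≤ b - a) : IsDyadicChart φ C' a' b' :=
  ⟨hC', ha, hb, hab, fun n hn ⟨x, hx, hx'⟩ =>
    hl.trans_lt (h.length_lt n hn ⟨x, hC hx, hC hx'⟩)⟩

theorem iter_comm (φ : X ≃ₜ X) (n : ℤ) (k : ℕ) (x : X) :
    (φ ^ n : X ≃ₜ X) ((φ ^ k : X ≃ₜ X) x) = (φ ^ k : X ≃ₜ X) ((φ ^ n : X ≃ₜ X) x) := by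
  rw [← zpow_natCast φ k, ← iter_add, ← iter_add, add_comm]

theorem IsDyadicChart.translate {C : Set X} {a b : ℝ} (h : IsDyadicChart φ C a b) (n : ℤ) :
    IsDyadicChart φ ((φ ^ n : X ≃ₜ X) ⁻¹' C) (a + n) (b + n) :=
  ⟨h.isClopen.preimage (φ ^ n : X ≃ₜ X).continuous, h.left.add (.int n), h.right.add (.int n),
    by linarith [h.lt], fun k hk ⟨x, hx, hx'⟩ => by
      have := h.length_lt k hk ⟨_, hx, by rw [← iter_comm]; exact hx'⟩
      linarith⟩

/-- A chart expression of `g` at `[x, s]` can be read in the translated chart. -/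
theorem IsDyadicPLInChart.translate {g : Suspension φ ≃ₜ Suspension φ} {C : Set X} {a b c d : ℝ}
    {f : OpenPartialHomeomorph ℝ ℝ} (h : IsDyadicPLInChart φ g C a b c d f) (n : ℤ) :
    ∃ f', IsDyadicPLInChart φ g ((φ ^ n : X ≃ₜ X) ⁻¹' C) (a + n) (b + n) (c + n) (d + n) f' := by
  let e : ℝ ≃ₜ ℝ := Homeomorph.addRight (n : ℝ)
  have he : ∀ t, e t = t + n := fun _ => rfl
  have he' : ∀ t, e.symm t = t - n := fun _ => (sub_eq_add_neg _ _).symm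
  have hsrc : ((e.symm.transOpenPartialHomeomorph f).transHomeomorph e).source
      = Ioo (a + n) (b + n) := by
    ext t
    simp [he', h.source_eq, lt_sub_iff_add_lt, sub_lt_iff_lt_add]
  refine ⟨(e.symm.transOpenPartialHomeomorph f).transHomeomorph e, h.chart_source.translate n,
    h.chart_target.translate n, hsrc, ?_, ?_, ?_⟩
  · ext t
    simp [he', h.target_eq, lt_sub_iff_add_lt, sub_lt_iff_lt_add]
  · have h1 : IsDyadicPLOn (fun t : ℝ => t + -(n : ℝ)) (Ioo (a + n) (b + n)) :=
      isDyadicPLOn_add_const (IsDyadic.int n).neg _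
    have hm : MapsTo (fun t : ℝ => t + -(n : ℝ)) (Ioo (a + n) (b + n)) (Ioo a b) := by
      intro t ht
      constructor <;> [linarith [ht.1]; linarith [ht.2]]
    have h2 := h.dyadicPL.comp h1 isOpen_Ioo (by fun_prop)
      (fun x _ y _ hxy => by simpa using hxy) hm
    have h3 : IsDyadicPLOn (fun t : ℝ => t + (n : ℝ)) univ :=
      isDyadicPLOn_add_const (IsDyadic.int n) _
    refine (h3.comp h2 isOpen_Ioo ?_ ?_ (mapsTo_univ _ _)).congr fun t _ => by
      simp [he, he', sub_eq_add_neg]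
    · exact (h.source_eq ▸ f.continuousOn).comp (by fun_prop) hm
    · exact (h.source_eq ▸ f.injOn).comp (fun x _ y _ hxy => by simpa using hxy) hm
  · intro x hx t ht
    have ht' : t - n ∈ Ioo a b := ⟨by linarith [ht.1], by linarith [ht.2]⟩
    rw [← Suspension.mk_shift φ n x t, h.map_eq _ hx _ ht', ← Suspension.mk_shift φ n x]
    simp [he, he']

/-- A chart expression can be restricted to a smaller chart. -/
theorem exists_isDyadicPLInChart {g : Suspension φ ≃ₜ Suspension φ} {C C' : Set X} {a b c d s : ℝ}
    {f : OpenPartialHomeomorph ℝ ℝ} (h : IsDyadicChart φ C a b)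
    (h' : IsDyadicChart φ C c d) (hsource : f.source = Ioo a b) (htarget : f.target ⊆ Ioo c d)
    (hPL : IsDyadicPLOn f (Ioo a b))
    (hg : ∀ x ∈ C, ∀ t ∈ Ioo a b, g (Suspension.mk φ x t) = Suspension.mk φ x (f t))
    (hs : s ∈ Ioo a b) (hC' : IsClopen C') (hC : C' ⊆ C) {V : Set ℝ} (hV : V ∈ 𝓝 (f s)) :
    ∃ a' b' c' d' f', IsDyadicPLInChart φ g C' a' b' c' d' f' ∧ s ∈ Ioo a' b' ∧
      f' s = f s ∧ Ioo c' d' ⊆ V := by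
  have hcont : ContinuousOn f (Ioo a b) := hsource ▸ f.continuousOn
  have hinj : InjOn f (Ioo a b) := hsource ▸ f.injOn
  have hU : Ioo a b ∩ f ⁻¹' V ∈ 𝓝 s :=
    inter_mem (isOpen_Ioo.mem_nhds hs) (hcont.continuousAt (isOpen_Ioo.mem_nhds hs) hV)
  obtain ⟨l, u, ⟨hl, hu⟩, hlu⟩ := mem_nhds_iff_exists_Ioo_subset.1 hU
  obtain ⟨a', ha'd, hla', ha's⟩ := exists_dyadic_between hl
  obtain ⟨b', hb'd, hsb', hb'u⟩ := exists_dyadic_between hu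
  have hab : a' < b' := ha's.trans hsb'
  have hI : Icc a' b' ⊆ Ioo a b ∩ f ⁻¹' V := (Icc_subset_Ioo hla' hb'u).trans hlu
  have hIo : Ioo a' b' ⊆ Ioo a b := fun t ht => (hI (Ioo_subset_Icc_self ht)).1
  have hA : a' ∈ Ioo a b := (hI (left_mem_Icc.2 hab.le)).1
  have hB : b' ∈ Ioo a b := (hI (right_mem_Icc.2 hab.le)).1
  have hcI : ContinuousOn f (Icc a' b') := hcont.mono fun t ht => (hI ht).1
  have hmap : ∀ t ∈ Ioo a b, f t ∈ Ioo c d := fun t ht => 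
    htarget (f.map_source (hsource ▸ ht))
  have hfd := fun {r} => hPL.isDyadic_iff isOpen_Ioo hcont (r := r)
  have key : ∃ c' d', IsDyadic c' ∧ IsDyadic d' ∧ c' < d' ∧ c' ∈ Ioo c d ∧ d' ∈ Ioo c d ∧
      f '' Ioo a' b' = Ioo c' d' := by
    rcases hcI.strictMonoOn_of_injOn_Icc' hab.le (hinj.mono fun t ht => (hI ht).1) with hm | hm
    · refine ⟨f a', f b', (hfd hA).2 ha'd, (hfd hB).2 hb'd,
        hm (left_mem_Icc.2 hab.le) (right_mem_Icc.2 hab.le) hab, hmap _ hA, hmap _ hB,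
        Subset.antisymm ?_ (intermediate_value_Ioo hab.le hcI)⟩
      rintro _ ⟨t, ht, rfl⟩
      exact ⟨hm (left_mem_Icc.2 hab.le) (Ioo_subset_Icc_self ht) ht.1,
        hm (Ioo_subset_Icc_self ht) (right_mem_Icc.2 hab.le) ht.2⟩
    · refine ⟨f b', f a', (hfd hB).2 hb'd, (hfd hA).2 ha'd,
        hm (left_mem_Icc.2 hab.le) (right_mem_Icc.2 hab.le) hab, hmap _ hB, hmap _ hA,
        Subset.antisymm ?_ (intermediate_value_Ioo' hab.le hcI)⟩
      rintro _ ⟨t, ht, rfl⟩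
      exact ⟨hm (Ioo_subset_Icc_self ht) (right_mem_Icc.2 hab.le) ht.2,
        hm (left_mem_Icc.2 hab.le) (Ioo_subset_Icc_self ht) ht.1⟩
  obtain ⟨c', d', hc'd, hd'd, hcd', hc', hd', him⟩ := key
  have hsrc : (f.restrOpen (Ioo a' b') isOpen_Ioo).source = Ioo a' b' := by
    rw [f.restrOpen_source, hsource]; exact inter_eq_right.2 hIo
  refine ⟨a', b', c', d', f.restrOpen (Ioo a' b') isOpen_Ioo,
    ⟨h.shrink hC' hC ha'd hb'd hab (by linarith [hA.1, hB.2]),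
      h'.shrink hC' hC hc'd hd'd hcd' (by linarith [hc'.1, hd'.2]), hsrc, ?_,
      hPL.mono hIo, fun x hx t ht => hg x (hC hx) t (hIo ht)⟩, ⟨ha's, hsb'⟩, rfl, ?_⟩
  · rw [← OpenPartialHomeomorph.image_source_eq_target, hsrc]; exact him
  · rw [← him]
    rintro _ ⟨t, ht, rfl⟩
    exact (hI (Ioo_subset_Icc_self ht)).2

/-- `g` has a dyadic piecewise linear chart expression around the point `[x, s]`. -/
def HasChartAt (φ : X ≃ₜ X) (g : Suspension φ ≃ₜ Suspension φ) (x : X) (s : ℝ) : Prop :=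
  ∃ C a b c d f, IsDyadicPLInChart φ g C a b c d f ∧ x ∈ C ∧ s ∈ Ioo a b

theorem hasChartAt_of_mem_domain {g : Suspension φ ≃ₜ Suspension φ} {C : Set X} {a b c d : ℝ}
    {f : OpenPartialHomeomorph ℝ ℝ} (h : IsDyadicPLInChart φ g C a b c d f) {x : X} {s : ℝ}
    (hy : Suspension.mk φ x s ∈ domain φ C (Ioo a b)) : HasChartAt φ g x s := by
  obtain ⟨x', hx', t, ht, hxt⟩ := hy
  obtain ⟨n, rfl, rfl⟩ := (Suspension.mk_eq φ).1 hxt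
  obtain ⟨f', hf'⟩ := h.translate n
  exact ⟨_, _, _, _, _, f', hf', hx', by linarith [ht.1], by linarith [ht.2]⟩

theorem HasChartAt.one (x : X) (s : ℝ) : HasChartAt φ 1 x s := by
  obtain ⟨a, had, ha, ha'⟩ := exists_dyadic_between (show s - 1 / 2 < s by linarith)
  obtain ⟨b, hbd, hb, hb'⟩ := exists_dyadic_between (show s < s + 1 / 2 by linarith)
  have h : IsDyadicChart φ univ a b := ⟨isClopen_univ, had, hbd, ha'.trans hb, fun n hn _ => by
    have : (1 : ℝ) ≤ n := by exact_mod_cast hn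
    linarith⟩
  exact ⟨univ, a, b, a, b, OpenPartialHomeomorph.ofSet (Ioo a b) isOpen_Ioo,
    ⟨h, h, rfl, rfl, (isDyadicPLOn_add_const (IsDyadic.int 0) _).congr fun t _ => by simp,
      fun _ _ _ _ => rfl⟩, mem_univ x, ha', hb⟩

theorem HasChartAt.mul {g h : Suspension φ ≃ₜ Suspension φ}
    (hg : ∀ x s, HasChartAt φ g x s) (hh : ∀ x s, HasChartAt φ h x s) (x : X) (s : ℝ) :
    HasChartAt φ (g * h) x s := by
  obtain ⟨C, a, b, c, d, f, hf, hx, hs⟩ := hh x s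
  obtain ⟨D, a₁, b₁, c₁, d₁, f₁, hf₁, hx₁, hs₁⟩ := hg x (f s)
  have hCD : IsClopen (C ∩ D) := hf.chart_source.isClopen.inter hf₁.chart_source.isClopen
  obtain ⟨a₂, b₂, c₂, d₂, f₂, hf₂, hs₂, hfs₂, hV⟩ :=
    exists_isDyadicPLInChart hf.chart_source hf.chart_target hf.source_eq hf.target_eq.subset
      hf.dyadicPL hf.map_eq hs hCD inter_subset_left (isOpen_Ioo.mem_nhds hs₁)
  have hm : MapsTo f₂ (Ioo a₂ b₂) (Ioo a₁ b₁) := fun t ht =>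
    hV (hf₂.target_eq ▸ f₂.map_source (hf₂.source_eq ▸ ht))
  obtain ⟨a₃, b₃, c₃, d₃, f₃, hf₃, hs₃, -, -⟩ :=
    exists_isDyadicPLInChart (g := g * h) (f := f₂.trans f₁) hf₂.chart_source
      (hf₁.chart_target.shrink hCD inter_subset_right hf₁.chart_target.left
        hf₁.chart_target.right hf₁.chart_target.lt le_rfl)
      (by
        rw [OpenPartialHomeomorph.trans_source, hf₂.source_eq, hf₁.source_eq]
        exact inter_eq_left.2 hm)
      (by
        rw [OpenPartialHomeomorph.trans_target, hf₁.target_eq]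
        exact inter_subset_left)
      (hf₁.dyadicPL.comp hf₂.dyadicPL isOpen_Ioo (hf₂.source_eq ▸ f₂.continuousOn)
        (hf₂.source_eq ▸ f₂.injOn) hm)
      (fun x hx t ht => by
        change g (h _) = _
        rw [hf₂.map_eq x hx t ht, hf₁.map_eq x hx.2 _ (hm ht)]
        rfl)
      hs₂ hCD subset_rfl univ_mem
  exact ⟨_, _, _, _, _, f₃, hf₃, ⟨hx, hx₁⟩, hs₃⟩

theorem IsDyadicPLInChart.inv {g : Suspension φ ≃ₜ Suspension φ} {C : Set X} {a b c d : ℝ}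
    {f : OpenPartialHomeomorph ℝ ℝ} (h : IsDyadicPLInChart φ g C a b c d f) :
    IsDyadicPLInChart φ g⁻¹ C c d a b f.symm where
  chart_source := h.chart_target
  chart_target := h.chart_source
  source_eq := h.target_eq
  target_eq := h.source_eq
  dyadicPL := h.target_eq ▸ IsDyadicPLOn.symm (h.source_eq ▸ h.dyadicPL)
  map_eq := fun x hx t ht => by
    change g.symm _ = _
    rw [← h.target_eq] at ht
    rw [Homeomorph.symm_apply_eq, h.map_eq x hx _ (h.source_eq ▸ f.map_target ht),
      f.right_inv ht]

theorem HasChartAt.inv {g : Suspension φ ≃ₜ Suspension φ}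
    (hg : ∀ x s, HasChartAt φ g x s) (x : X) (s : ℝ) : HasChartAt φ g⁻¹ x s := by
  obtain ⟨x', s', hxs⟩ := Suspension.exists_rep φ (g.symm (Suspension.mk φ x s))
  obtain ⟨C, a, b, c, d, f, hf, hx, hs⟩ := hg x' s'
  refine hasChartAt_of_mem_domain hf.inv ⟨x', hx, f s', ?_, ?_⟩
  · exact hf.target_eq ▸ f.map_source (hf.source_eq ▸ hs)
  · rw [← hf.map_eq x' hx s' hs, ← hxs, g.apply_symm_apply]

end Closure

/-- The group `T(φ)`: the homeomorphisms `g` of the suspension isotopic to the identity such that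
every point lies in the domain of a dyadic chart in which `g` has the form `(x, t) ↦ (x, f t)`
for a dyadic piecewise linear homeomorphism `f` between open dyadic intervals. -/
def groupT {X : Type*} [TopologicalSpace X] (φ : X ≃ₜ X) :
    Subgroup (Suspension φ ≃ₜ Suspension φ) where
  carrier := {g | g ∈ isotopicToId (Suspension φ) ∧ ∀ y, ∃ C a b c d f,
    y ∈ domain φ C (Ioo a b) ∧ IsDyadicPLInChart φ g C a b c d f}
  one_mem' := by
    refine ⟨one_mem _, fun y => ?_⟩
    obtain ⟨x, s, rfl⟩ := Suspension.exists_rep φ y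
    obtain ⟨C, a, b, c, d, f, hf, hx, hs⟩ := HasChartAt.one (φ := φ) x s
    exact ⟨C, a, b, c, d, f, ⟨x, hx, s, hs, rfl⟩, hf⟩
  mul_mem' := by
    rintro g h ⟨hg, hg'⟩ ⟨hh, hh'⟩
    refine ⟨mul_mem hg hh, fun y => ?_⟩
    obtain ⟨x, s, rfl⟩ := Suspension.exists_rep φ y
    obtain ⟨C, a, b, c, d, f, hf, hx, hs⟩ := HasChartAt.mul (g := g) (h := h)
      (fun x s => by
        obtain ⟨C, a, b, c, d, f, hy, hf⟩ := hg' (Suspension.mk φ x s)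
        exact hasChartAt_of_mem_domain hf hy)
      (fun x s => by
        obtain ⟨C, a, b, c, d, f, hy, hf⟩ := hh' (Suspension.mk φ x s)
        exact hasChartAt_of_mem_domain hf hy) x s
    exact ⟨C, a, b, c, d, f, ⟨x, hx, s, hs, rfl⟩, hf⟩
  inv_mem' := by
    rintro g ⟨hg, hg'⟩
    refine ⟨inv_mem hg, fun y => ?_⟩
    obtain ⟨x, s, rfl⟩ := Suspension.exists_rep φ y
    obtain ⟨C, a, b, c, d, f, hf, hx, hs⟩ := HasChartAt.inv (g := g)
      (fun x s => by
        obtain ⟨C, a, b, c, d, f, hy, hf⟩ := hg' (Suspension.mk φ x s)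
        exact hasChartAt_of_mem_domain hf hy) x s
    exact ⟨C, a, b, c, d, f, ⟨x, hx, s, hs, rfl⟩, hf⟩

/-- `g` is the transport of `f`, acting on `C × J` as `(x, t) ↦ (x, f t)`, to the domain
`U_{C × J}`, and it is the identity outside of this domain. -/
def IsTransport {X : Type*} [TopologicalSpace X] (φ : X ≃ₜ X) (C : Set X) (J : Set ℝ)
    (f : ℝ ≃ₜ ℝ) (g : Suspension φ ≃ₜ Suspension φ) : Prop :=
  (∀ x ∈ C, ∀ t ∈ J, g (Suspension.mk φ x t) = Suspension.mk φ x (f t)) ∧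
    ∀ y, y ∉ domain φ C J → g y = y

/-- The subgroup `F_{C, J}` of `T(φ)`, formed by the transports to `U_{C × J}` of the
elements of `F_J`. -/
def localF {X : Type*} [TopologicalSpace X] (φ : X ≃ₜ X) (C : Set X) (J : Set ℝ) :
    Subgroup (groupT φ) where
  carrier := {g | ∃ f ∈ dyadicPLGroup J, IsTransport φ C J f g}
  one_mem' := ⟨1, one_mem _, fun _ _ _ _ => rfl, fun _ _ => rfl⟩
  mul_mem' := by
    rintro g g' ⟨f, hf, h1, h2⟩ ⟨f', hf', h1', h2'⟩
    refine ⟨f * f', mul_mem hf hf', fun x hx t ht => ?_, fun y hy => ?_⟩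
    · change (g : Suspension φ ≃ₜ Suspension φ) ((g' : Suspension φ ≃ₜ Suspension φ) _) = _
      rw [h1' x hx t ht, h1 x hx _ ((mem_iff_of_mem_dyadicPLGroup hf' t).2 ht)]
      rfl
    · change (g : Suspension φ ≃ₜ Suspension φ) ((g' : Suspension φ ≃ₜ Suspension φ) _) = _
      rw [h2' y hy, h2 y hy]
  inv_mem' := by
    rintro g ⟨f, hf, h1, h2⟩
    refine ⟨f⁻¹, inv_mem hf, fun x hx t ht => ?_, fun y hy => ?_⟩
    · change (g : Suspension φ ≃ₜ Suspension φ).symm _ = Suspension.mk φ x (f.symm t)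
      have ht' : f.symm t ∈ J := (mem_iff_of_mem_dyadicPLGroup (inv_mem hf) t).2 ht
      rw [Homeomorph.symm_apply_eq, h1 x hx _ ht', f.apply_symm_apply]
    · change (g : Suspension φ ≃ₜ Suspension φ).symm y = y
      rw [Homeomorph.symm_apply_eq, h2 y hy]

/-- The interval `(-1/4, 1/2)`. -/
def I₀ : Set ℝ := Ioo (-1 / 4) (1 / 2)

/-- The interval `(1/4, 1 + 1/8)`. -/
def I₁ : Set ℝ := Ioo (1 / 4) (1 + 1 / 8)

end StoneSystem

namespace StoneSystem

/-! ### Dyadic piecewise linear homeomorphisms of the line -/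

/-! As `X` is totally disconnected, an isotopy starting at the identity lifts to the covering `X ×
ℝ` without moving the `X`-coordinate (`exists_lift`). The elements of `T(φ)` are thus induced by
equivariant families `G_x` of increasing homeomorphisms of `ℝ` that are locally constant in `x` and
locally dyadic PL (`isLocallyPL_of_descend_mem`, `descend_mem_of_isLocallyPL`). Let `H` be the
subgroup generated by the given copies of `F`. It is all of `T(φ)` because `H` contains every
transport to `D × J`, with `D` clopen and `J` dyadic of length at most 1, and because such
transports generate.

Containment (`containsTransports_of_isGeneratingPartition`): the integer translates of `I₀` and `I₁`
overlap enough for `H` to contain the transports to `X × J` for all short `J`. Conjugation by these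
slides a chart `C i × J` along `ℝ`. Since `D × J` and `φ⁻ⁿ(D) × (J + n)` have the same domain, all
translates of the `C i` are reached. The commutator of `f` on `D × J` with `f'` on `D' × J` is `[f,
f']` on `(D ∩ D') × J`, and an element supported compactly inside `J` lies in the commutator
subgroup of `F_J` (`dyadicPLGroup_le_commutator`), because the slopes at the two endpoints detect
the abelianization of `F`. This gives intersections; dividing by a transport to `X × J` gives
complements. A Boolean algebra of clopen sets that separates points contains every clopen set
(`isClopen_induction`), and overlapping intervals are then merged into longer ones
(`dyadicPLGroup_le_sup`).

Generation (`groupT_le_of_containsTransports`): the lift `G` carries the zero section to the graph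
of `x ↦ G_x(0)`, which is locally constant with dyadic values. Inserting midpoints repeatedly
reduces to two transversals that are close compared with the gaps between successive crossings of a
flow line, and finitely many transports with disjoint effects carry one to the other
(`movesTo_of_gap`). What remains fixes the zero section, so it is a locally constant family in `F`,
a finite product of transports to `D × (0, 1)` (`descend_mem_of_fixes`).

Finite generation follows since `F` is generated by two elements (`closure_caret_eq`) and the letter
at 0 partitions a subshift. -/

theorem exists_homeomorph_of_strictMono {f : ℝ → ℝ} (hf : StrictMono f)
    (hs : Function.Surjective f) : ∃ g : ℝ ≃ₜ ℝ, ∀ t, g t = f t :=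
  ⟨(hf.orderIsoOfSurjective f hs).toHomeomorph, fun _ => rfl⟩

/-- Between breakpoints the slope is a power of 2, hence positive, which rules out the decreasing
case. -/
theorem strictMono_of_isDyadicPLOn {f : ℝ ≃ₜ ℝ} {a b : ℝ} (hab : a < b)
    (hf : IsDyadicPLOn f (Ioo a b)) : StrictMono f := by
  refine (f.continuous.strictMono_of_inj f.injective).resolve_right fun hanti => ?_
  obtain ⟨B, hB, -, hp⟩ := hf
  obtain ⟨t, ht, htB⟩ := ((Ioo_infinite hab).sdiff hB).nonempty
  have hU : Ioo a b ∩ Bᶜ ∈ 𝓝 t :=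
    inter_mem (isOpen_Ioo.mem_nhds ht) (hB.isClosed.isOpen_compl.mem_nhds htB)
  obtain ⟨l, u, ⟨hl, hu⟩, hlu⟩ := mem_nhds_iff_exists_Ioo_subset.1 hU
  obtain ⟨m, c, -, hm⟩ := hp (Ioo l u) ordConnected_Ioo (fun s hs => (hlu hs).1)
    (disjoint_left.2 fun s hs => (hlu hs).2)
  have h1 : (t + u) / 2 ∈ Ioo l u := ⟨by linarith, by linarith⟩
  have h2 := hanti (show t < (t + u) / 2 by linarith)
  rw [hm t ⟨hl, hu⟩, hm _ h1] at h2
  have : (0 : ℝ) < 2 ^ m := by positivity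
  nlinarith

theorem dyadicPLGroup_mono {J J' : Set ℝ} (h : J ⊆ J') : dyadicPLGroup J ≤ dyadicPLGroup J' :=
  fun _ hf => ⟨hf.1, fun t ht => hf.2 t fun ht' => ht (h ht')⟩

theorem strictMono_of_mem {J : Set ℝ} {f : ℝ ≃ₜ ℝ} (hf : f ∈ dyadicPLGroup J) : StrictMono f :=
  strictMono_of_isDyadicPLOn zero_lt_one (hf.1.mono (subset_univ _))

theorem isDyadic_apply_iff {J : Set ℝ} {f : ℝ ≃ₜ ℝ} (hf : f ∈ dyadicPLGroup J) {r : ℝ} :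
    IsDyadic (f r) ↔ IsDyadic r :=
  hf.1.isDyadic_iff isOpen_univ f.continuous.continuousOn (mem_univ r)

theorem affine_mem (m : ℤ) {c : ℝ} (hc : IsDyadic c) :
    ∃ h ∈ dyadicPLGroup univ, ∀ t, h t = 2 ^ m * t + c :=
  ⟨affineHomeomorph (2 ^ m) c (by positivity), ⟨⟨∅, finite_empty, by simp,
    fun _ _ _ _ => ⟨m, c, hc, fun _ _ => rfl⟩⟩, by simp⟩, fun _ => rfl⟩

/-- An interval avoiding `p` lies on one side of it and sees only one of the two maps, so it
suffices to add `p` to the breakpoints of both. -/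
theorem exists_glue {h k : ℝ ≃ₜ ℝ} (hh : h ∈ dyadicPLGroup univ) (hk : k ∈ dyadicPLGroup univ)
    {p : ℝ} (hp : IsDyadic p) (hhk : h p = k p) :
    ∃ g ∈ dyadicPLGroup univ, (∀ t ≤ p, g t = h t) ∧ ∀ t, p ≤ t → g t = k t := by
  have hmono : StrictMono fun t => if t ≤ p then h t else k t := by
    intro s t hst
    have h1 := strictMono_of_mem hh
    have h2 := strictMono_of_mem hk
    by_cases ht : t ≤ p
    · simpa [ht, hst.le.trans ht] using h1 hst
    · by_cases hs : s ≤ p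
      · simp only [hs, ht, if_true, if_false]
        calc h s ≤ h p := h1.monotone hs
          _ = k p := hhk
          _ < k t := h2 (not_le.1 ht)
      · simpa [hs, ht] using h2 hst
  have hsurj : Function.Surjective fun t => if t ≤ p then h t else k t := by
    intro s
    rcases le_total s (h p) with hs | hs
    · refine ⟨h.symm s, ?_⟩
      have : h.symm s ≤ p := by
        rw [← (strictMono_of_mem hh).le_iff_le]; simpa using hs
      simp [this]
    · refine ⟨k.symm s, ?_⟩
      have : p ≤ k.symm s := by
        rw [← (strictMono_of_mem hk).le_iff_le, ← hhk]; simpa using hs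
      rcases this.eq_or_lt with h' | h'
      · have : k p = s := by rw [h']; simp
        simp [← h', hhk, this]
      · simp [not_le.2 h']
  obtain ⟨g, hg⟩ := exists_homeomorph_of_strictMono hmono hsurj
  have hg1 : ∀ t ≤ p, g t = h t := fun t ht => by simp [hg, ht]
  have hg2 : ∀ t, p ≤ t → g t = k t := fun t ht => by
    rcases ht.eq_or_lt with rfl | ht
    · simp [hg, hhk]
    · simp [hg, not_le.2 ht]
  refine ⟨g, ⟨?_, by simp⟩, hg1, hg2⟩
  obtain ⟨B, hB, hBd, hpB⟩ := hh.1
  obtain ⟨B', hB', hBd', hpB'⟩ := hk.1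
  refine ⟨insert p (B ∪ B'), (hB.union hB').insert p, ?_, ?_⟩
  · rintro r (rfl | hr | hr)
    exacts [hp, hBd r hr, hBd' r hr]
  · intro S hS _ hd
    rw [disjoint_insert_right, disjoint_union_right] at hd
    have : (∀ t ∈ S, t ≤ p) ∨ ∀ t ∈ S, p ≤ t := by
      by_contra! hcon
      obtain ⟨⟨t, ht, hpt⟩, s, hs, hsp⟩ := hcon
      exact hd.1 (hS.out hs ht ⟨hsp.le, hpt.le⟩)
    rcases this with hl | hl
    · obtain ⟨m, c, hc, hm⟩ := hpB S hS (subset_univ _) hd.2.1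
      exact ⟨m, c, hc, fun t ht => by rw [hg1 t (hl t ht), hm t ht]⟩
    · obtain ⟨m, c, hc, hm⟩ := hpB' S hS (subset_univ _) hd.2.2
      exact ⟨m, c, hc, fun t ht => by rw [hg2 t (hl t ht), hm t ht]⟩

theorem exists_interpolation {p q : ℕ → ℝ} {m : ℕ → ℤ} {n : ℕ}
    (hp : ∀ i ≤ n, IsDyadic (p i)) (hq : ∀ i ≤ n, IsDyadic (q i)) (hlt : ∀ i < n, p i < p (i + 1))
    (hstep : ∀ i < n, q (i + 1) - q i = 2 ^ m i * (p (i + 1) - p i)) :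
    ∃ h ∈ dyadicPLGroup univ, (∀ t ≤ p 0, h t = t + (q 0 - p 0)) ∧
      (∀ i < n, ∀ t ∈ Icc (p i) (p (i + 1)), h t = q i + 2 ^ m i * (t - p i)) ∧
      ∀ t, p n ≤ t → h t = t + (q n - p n) := by
  induction n with
  | zero =>
    obtain ⟨h, hh, hh'⟩ := affine_mem 0 ((hq 0 le_rfl).sub (hp 0 le_rfl))
    refine ⟨h, hh, fun t _ => by simp [hh'], by simp, fun t _ => by simp [hh']⟩
  | succ n ih =>
    obtain ⟨h, hh, h0, h1, h2⟩ := ih (fun i hi => hp i (by omega)) (fun i hi => hq i (by omega))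
      (fun i hi => hlt i (by omega)) (fun i hi => hstep i (by omega))
    obtain ⟨k, hk, hk'⟩ := affine_mem (m n)
      ((hq n (by omega)).sub ((hp n (by omega)).zpow_mul (m n)))
    obtain ⟨e, he, he'⟩ := affine_mem 0 ((hq (n + 1) le_rfl).sub (hp (n + 1) le_rfl))
    obtain ⟨g, hg, hg1, hg2⟩ := exists_glue hh hk (hp n (by omega))
      (by rw [h2 _ le_rfl, hk']; ring)
    have hpn := hlt n (by omega)
    obtain ⟨f, hf, hf1, hf2⟩ := exists_glue hg he (hp (n + 1) le_rfl)
      (by rw [hg2 _ hpn.le, hk', he']; linear_combination -hstep n (by omega))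
    have hmon : ∀ i ≤ n, p i ≤ p n := by
      intro i hi
      induction hi using Nat.decreasingInduction with
      | self => rfl
      | of_succ k hk ih => exact (hlt k (by omega)).le.trans ih
    refine ⟨f, hf, fun t ht => ?_, fun i hi t ht => ?_, fun t ht => by rw [hf2 t ht, he']; simp⟩
    · have := hmon 0 (Nat.zero_le _)
      rw [hf1 t (by linarith), hg1 t (by linarith), h0 t ht]
    · rcases (Nat.lt_succ_iff.1 hi).eq_or_lt with rfl | hi'
      · rw [hf1 t ht.2, hg2 t ht.1, hk']; ring
      · have := hmon (i + 1) hi'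
        rw [hf1 t (by linarith [ht.2]), hg1 t (by linarith [ht.2]), h1 i hi' t ht]

/-- Lengths are counted in units of `2 ^ (-K)`. Doubling the last unit of the image, and leaving
everything before it alone, lengthens the image by one unit. -/
theorem exists_map_of_le {a c : ℝ} (ha : IsDyadic a) (hc : IsDyadic c) (K : ℕ) {A B : ℕ}
    (hA : 1 ≤ A) (hAB : A ≤ B) :
    ∃ h ∈ dyadicPLGroup univ, h a = c ∧ h (a + A / 2 ^ K) = c + B / 2 ^ K := by
  induction B, hAB using Nat.le_induction with
  | base =>
    obtain ⟨h, hh, hh'⟩ := affine_mem 0 (hc.sub ha)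
    exact ⟨h, hh, by simp [hh'], by rw [hh']; simp; ring⟩
  | succ B hB ih =>
    obtain ⟨h, hh, h1, h2⟩ := ih
    have hp : IsDyadic (c + ((B : ℤ) - 1 : ℤ) / 2 ^ K) := hc.add ⟨_, K, rfl⟩
    obtain ⟨e, he, he'⟩ := affine_mem 1 hp.neg
    obtain ⟨g, hg, hg1, hg2⟩ := exists_glue (one_mem _) he hp (by rw [he']; simp; ring)
    refine ⟨g * h, mul_mem hg hh, ?_, ?_⟩
    · change g (h a) = c
      rw [h1, hg1]
      · rfl
      · have : (1 : ℝ) ≤ B := by exact_mod_cast hA.trans hB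
        have : (0 : ℝ) ≤ (B - 1) / 2 ^ K := div_nonneg (by linarith) (by positivity)
        push_cast
        linarith
    · change g (h _) = _
      rw [h2, hg2, he']
      · push_cast; ring
      · push_cast
        gcongr
        linarith

/-- Over the common denominator `2 ^ (k + l)` both lengths are integers, and `exists_map_of_le`
applies, to the inverse if the target is the shorter one. -/
theorem exists_map_of_lt {a b c d : ℝ} (ha : IsDyadic a) (hb : IsDyadic b) (hc : IsDyadic c)
    (hd : IsDyadic d) (hab : a < b) (hcd : c < d) :
    ∃ h ∈ dyadicPLGroup univ, h a = c ∧ h b = d := by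
  obtain ⟨p, k, hp⟩ := hb.sub ha
  obtain ⟨q, l, hq⟩ := hd.sub hc
  have hp0 : 0 < p := by
    have : (0 : ℝ) < p / 2 ^ k := by linarith
    have := (div_pos_iff_of_pos_right (by positivity)).1 this
    exact_mod_cast this
  have hq0 : 0 < q := by
    have : (0 : ℝ) < q / 2 ^ l := by linarith
    have := (div_pos_iff_of_pos_right (by positivity)).1 this
    exact_mod_cast this
  lift p to ℕ using hp0.le
  lift q to ℕ using hq0.le
  have hp0 : 0 < p := by exact_mod_cast hp0
  have hq0 : 0 < q := by exact_mod_cast hq0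
  have hp1 : 1 ≤ p * 2 ^ l := Nat.one_le_iff_ne_zero.2 (by positivity)
  have hq1 : 1 ≤ q * 2 ^ k := Nat.one_le_iff_ne_zero.2 (by positivity)
  have hbe : b = a + (p * 2 ^ l : ℕ) / 2 ^ (k + l) := by
    push_cast at hp ⊢
    rw [eq_add_of_sub_eq' hp, pow_add]; field_simp
  have hde : d = c + (q * 2 ^ k : ℕ) / 2 ^ (k + l) := by
    push_cast at hq ⊢
    rw [eq_add_of_sub_eq' hq, pow_add]; field_simp
  rcases le_total (p * 2 ^ l) (q * 2 ^ k) with h | h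
  · rw [hbe, hde]
    exact exists_map_of_le ha hc _ hp1 h
  · obtain ⟨h, hh, h1, h2⟩ := exists_map_of_le hc ha (k + l) hq1 h
    rw [← hbe, ← hde] at h2
    refine ⟨h⁻¹, inv_mem hh, ?_, ?_⟩
    · exact h.symm_apply_eq.2 h1.symm
    · exact h.symm_apply_eq.2 h2.symm

/-- Controlling two points allows an interval to be carried onto another inside `(u, v)`, as
`ContainsTransports.move` requires. -/
theorem exists_mem_map_pair {u v p q p' q' : ℝ} (hu : IsDyadic u) (hv : IsDyadic v)
    (hp : IsDyadic p) (hq : IsDyadic q) (hp' : IsDyadic p') (hq' : IsDyadic q') (hup : u < p)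
    (hpq : p < q) (hqv : q < v) (hup' : u < p') (hpq' : p' < q') (hqv' : q' < v) :
    ∃ h ∈ dyadicPLGroup (Ioo u v), h p = p' ∧ h q = q' := by
  obtain ⟨h₁, hh₁, h₁u, h₁p⟩ := exists_map_of_lt hu hp hu hp' hup hup'
  obtain ⟨h₂, hh₂, h₂p, h₂q⟩ := exists_map_of_lt hp hq hp' hq' hpq hpq'
  obtain ⟨h₃, hh₃, h₃q, h₃v⟩ := exists_map_of_lt hq hv hq' hv hqv hqv'
  obtain ⟨g₁, hg₁, a₁, b₁⟩ := exists_glue (one_mem _) hh₁ hu h₁u.symm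
  obtain ⟨g₂, hg₂, a₂, b₂⟩ := exists_glue hg₁ hh₂ hp (by rw [b₁ p hup.le, h₁p, h₂p])
  obtain ⟨g₃, hg₃, a₃, b₃⟩ := exists_glue hg₂ hh₃ hq (by rw [b₂ q hpq.le, h₂q, h₃q])
  obtain ⟨g₄, hg₄, a₄, b₄⟩ := exists_glue hg₃ (one_mem _) hv (by rw [b₃ v hqv.le, h₃v]; rfl)
  refine ⟨g₄, ⟨hg₄.1, fun t ht => ?_⟩, ?_, ?_⟩
  · rcases le_or_gt t u with h | h
    · rw [a₄ t (by linarith), a₃ t (by linarith), a₂ t (by linarith), a₁ t h]; rfl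
    · exact b₄ t (not_lt.1 fun h' => ht ⟨h, h'⟩)
  · rw [a₄ p (by linarith), a₃ p hpq.le, a₂ p le_rfl, b₁ p hup.le, h₁p]
  · rw [a₄ q hqv.le, a₃ q le_rfl, b₂ q hpq.le, h₂q]

theorem exists_mem_map {u v p p' : ℝ} (hu : IsDyadic u) (hv : IsDyadic v)
    (hp : IsDyadic p) (hp' : IsDyadic p') (hup : p ∈ Ioo u v) (hup' : p' ∈ Ioo u v) :
    ∃ h ∈ dyadicPLGroup (Ioo u v), h p = p' := by
  obtain ⟨q, hq, hpq, hqv⟩ := exists_dyadic_between hup.2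
  obtain ⟨q', hq', hpq', hqv'⟩ := exists_dyadic_between hup'.2
  obtain ⟨h, hh, h1, -⟩ := exists_mem_map_pair hu hv hp hq hp' hq' hup.1 hpq hqv hup'.1 hpq' hqv'
  exact ⟨h, hh, h1⟩

theorem exists_split {u v p : ℝ} {f : ℝ ≃ₜ ℝ} (hf : f ∈ dyadicPLGroup (Ioo u v))
    (hp : IsDyadic p) (hfp : f p = p) :
    ∃ f₁ ∈ dyadicPLGroup (Ioo u p), ∃ f₂ ∈ dyadicPLGroup (Ioo p v), f = f₁ * f₂ := by
  have hf' := dyadicPLGroup_mono (subset_univ _) hf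
  obtain ⟨f₁, hf₁, a₁, b₁⟩ := exists_glue hf' (one_mem _) hp hfp
  obtain ⟨f₂, hf₂, a₂, b₂⟩ := exists_glue (one_mem _) hf' hp hfp.symm
  refine ⟨f₁, ⟨hf₁.1, fun t ht => ?_⟩, f₂, ⟨hf₂.1, fun t ht => ?_⟩, Homeomorph.ext fun t => ?_⟩
  · rcases le_or_gt t p with h | h
    · rcases h.eq_or_lt with rfl | h'
      · rw [a₁ t h, hfp]
      · rw [a₁ t h]
        exact hf.2 t fun h'' => ht ⟨h''.1, h'⟩
    · exact b₁ t h.le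
  · rcases le_or_gt t p with h | h
    · exact a₂ t h
    · rw [b₂ t h.le]
      exact hf.2 t fun h' => ht ⟨h, h'.2⟩
  · change f t = f₁ (f₂ t)
    rcases le_or_gt t p with h | h
    · rw [a₂ t h]; exact (a₁ t h).symm
    · have h2 : p ≤ f t := by rw [← hfp]; exact (strictMono_of_mem hf).monotone h.le
      rw [b₂ t h.le, b₁ _ h2]; rfl

/-- The groups of two overlapping intervals generate the group of their union. -/
theorem dyadicPLGroup_le_sup {a b b' c : ℝ} (ha : IsDyadic a) (hb : IsDyadic b)
    (hb' : IsDyadic b') (hc : IsDyadic c) (hab : a ≤ b) (hbb' : b < b') (hb'c : b' ≤ c) :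
    dyadicPLGroup (Ioo a c) ≤ dyadicPLGroup (Ioo a b') ⊔ dyadicPLGroup (Ioo b c) := by
  intro f hf
  obtain ⟨p, hp, hbp, hpb'⟩ := exists_dyadic_between hbb'
  have hq : IsDyadic (f p) := (isDyadic_apply_iff hf).2 hp
  have hfp : f p ∈ Ioo a c := (mem_iff_of_mem_dyadicPLGroup hf p).2 ⟨by linarith, by linarith⟩
  -- `γ` carries `p` to `f p` within one of the two groups: the left one if `f p < b'`, the right
  -- one otherwise. Then `γ⁻¹ * f` fixes `p` and splits there.
  have key : ∃ γ ∈ dyadicPLGroup (Ioo a b') ⊔ dyadicPLGroup (Ioo b c),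
      γ ∈ dyadicPLGroup (Ioo a c) ∧ γ p = f p := by
    rcases lt_or_ge (f p) b' with h | h
    · obtain ⟨γ, hγ, h1⟩ := exists_mem_map ha hb' hp hq ⟨by linarith, hpb'⟩ ⟨hfp.1, h⟩
      exact ⟨γ, le_sup_left (a := dyadicPLGroup (Ioo a b')) hγ,
        dyadicPLGroup_mono (Ioo_subset_Ioo_right hb'c) hγ, h1⟩
    · obtain ⟨γ, hγ, h1⟩ := exists_mem_map hb hc hp hq ⟨hbp, by linarith⟩ ⟨by linarith, hfp.2⟩
      exact ⟨γ, le_sup_right (a := dyadicPLGroup (Ioo a b')) hγ,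
        dyadicPLGroup_mono (Ioo_subset_Ioo_left hab) hγ, h1⟩
  obtain ⟨γ, hγ, hγ', hγp⟩ := key
  obtain ⟨f₁, hf₁, f₂, hf₂, h12⟩ := exists_split (f := γ⁻¹ * f) (mul_mem (inv_mem hγ') hf) hp
    (by change γ.symm (f p) = p; rw [← hγp, γ.symm_apply_apply])
  have : f = γ * (f₁ * f₂) := by rw [← h12]; group
  rw [this]
  exact mul_mem hγ (mul_mem
    (le_sup_left (a := dyadicPLGroup (Ioo a b'))
      (dyadicPLGroup_mono (Ioo_subset_Ioo_right hpb'.le) hf₁))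
    (le_sup_right (a := dyadicPLGroup (Ioo a b'))
      (dyadicPLGroup_mono (Ioo_subset_Ioo_left hbp.le) hf₂)))

theorem conj_mem {h f : ℝ ≃ₜ ℝ} {u v : ℝ} (hh : h ∈ dyadicPLGroup univ)
    (hf : f ∈ dyadicPLGroup (Ioo u v)) : h * f * h⁻¹ ∈ dyadicPLGroup (Ioo (h u) (h v)) := by
  refine ⟨(mul_mem (mul_mem hh (dyadicPLGroup_mono (subset_univ _) hf)) (inv_mem hh)).1,
    fun t ht => ?_⟩
  change h (f (h.symm t)) = t
  rw [hf.2, h.apply_symm_apply]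
  have hm := strictMono_of_mem hh
  exact fun h' => ht ⟨by simpa using hm h'.1, by simpa using hm h'.2⟩

theorem map_conj_dyadicPLGroup {h : ℝ ≃ₜ ℝ} {u v : ℝ} (hh : h ∈ dyadicPLGroup univ) :
    (dyadicPLGroup (Ioo u v)).map (MulAut.conj h).toMonoidHom
      = dyadicPLGroup (Ioo (h u) (h v)) := by
  refine le_antisymm ?_ fun f hf => ?_
  · rintro _ ⟨f, hf, rfl⟩
    exact conj_mem hh hf
  · refine ⟨h⁻¹ * f * h⁻¹⁻¹, ?_, ?_⟩
    · have h1 : h⁻¹ (h u) = u := h.symm_apply_apply u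
      have h2 : h⁻¹ (h v) = v := h.symm_apply_apply v
      have := conj_mem (inv_mem hh) hf
      rwa [h1, h2] at this
    · simp [MulAut.conj_apply]; group

theorem nonempty_mulEquiv {a b c d : ℝ} (ha : IsDyadic a) (hb : IsDyadic b) (hc : IsDyadic c)
    (hd : IsDyadic d) (hab : a < b) (hcd : c < d) :
    Nonempty (dyadicPLGroup (Ioo a b) ≃* dyadicPLGroup (Ioo c d)) := by
  obtain ⟨h, hh, rfl, rfl⟩ := exists_map_of_lt ha hb hc hd hab hcd
  exact ⟨((MulAut.conj h).subgroupMap _).trans (MulEquiv.subgroupCongr (map_conj_dyadicPLGroup hh))⟩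

/-! ### Generators of Thompson's group -/

/-- The points `1 - 2 ^ (-i)`, which cut `[0, 1)` into the dyadic intervals
`[1 - 2 ^ (-i), 1 - 2 ^ (-i - 1)]`. -/
noncomputable def vine (i : ℕ) : ℝ := 1 - 1 / 2 ^ i

theorem isDyadic_one_div (i : ℕ) : IsDyadic (1 / 2 ^ i) := ⟨1, i, by simp⟩

theorem isDyadic_vine (i : ℕ) : IsDyadic (vine i) := by
  simpa [vine] using (IsDyadic.int 1).sub (isDyadic_one_div i)

theorem vine_succ (i : ℕ) : vine (i + 1) = vine i + 1 / 2 ^ (i + 1) := by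
  rw [vine, vine, pow_succ]; field_simp; ring

theorem one_div_pow_succ (i : ℕ) : (1 : ℝ) / 2 ^ i = 2 * (1 / 2 ^ (i + 1)) := by
  rw [pow_succ]; field_simp

theorem vine_zero : vine 0 = 0 := by simp [vine]

theorem vine_strictMono : StrictMono vine :=
  strictMono_nat_of_lt_succ fun i => by
    rw [vine_succ]; linarith [show (0 : ℝ) < 1 / 2 ^ (i + 1) by positivity]

/-- With `[vine i, 1]` rescaled to `[0, 1]`, the pieces `[0, 1/4]`, `[1/4, 1/2]`, `[1/2, 1]` go to
`[0, 1/2]`, `[1/2, 3/4]`, `[3/4, 1]`, with slopes 2, 1, 1/2. -/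
theorem exists_caret (i : ℕ) : ∃ x ∈ dyadicPLGroup (Ioo 0 1),
    (∀ t ≤ vine i, x t = t) ∧
    (∀ t ∈ Icc (vine i) (vine i + 1 / 2 ^ (i + 2)), x t = 2 * t - vine i) ∧
    (∀ t ∈ Icc (vine i + 1 / 2 ^ (i + 2)) (vine (i + 1)), x t = t + 1 / 2 ^ (i + 2)) ∧
    (∀ t ∈ Icc (vine (i + 1)) 1, x t = (t + 1) / 2) ∧ ∀ t, 1 ≤ t → x t = t := by
  have he : (0 : ℝ) < 1 / 2 ^ (i + 2) := by positivity
  have e1 := one_div_pow_succ i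
  have e2 := one_div_pow_succ (i + 1)
  have hv : vine i = 1 - 1 / 2 ^ i := rfl
  have hv' := vine_succ i
  have hvd := isDyadic_vine i
  have hed := isDyadic_one_div (i + 2)
  have hvd' := isDyadic_vine (i + 1)
  have h0 : 0 ≤ vine i := vine_zero ▸ vine_strictMono.monotone (Nat.zero_le i)
  obtain ⟨h₁, hh₁, a₁⟩ := affine_mem 1 hvd.neg
  obtain ⟨h₂, hh₂, a₂⟩ := affine_mem 0 hed
  obtain ⟨h₃, hh₃, a₃⟩ := affine_mem (-1) (isDyadic_one_div 1)
  obtain ⟨g₁, hg₁, b₁, c₁⟩ := exists_glue (one_mem _) hh₁ hvd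
    (by rw [a₁]; change vine i = _; norm_num; ring)
  obtain ⟨g₂, hg₂, b₂, c₂⟩ := exists_glue hg₁ hh₂ (hvd.add hed)
    (by rw [c₁ _ (by linarith), a₁, a₂]; norm_num; ring)
  obtain ⟨g₃, hg₃, b₃, c₃⟩ := exists_glue hg₂ hh₃ hvd'
    (by rw [c₂ _ (by linarith), a₂, a₃]; norm_num; norm_num at *; linarith)
  obtain ⟨g₄, hg₄, b₄, c₄⟩ := exists_glue hg₃ (one_mem _) (p := 1) (by simpa using IsDyadic.int 1)
    (by rw [c₃ _ (by linarith), a₃]; change _ = (1 : ℝ); norm_num)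
  have p1 : ∀ t ≤ vine i, g₄ t = t := fun t ht => by
    rw [b₄ t (by linarith), b₃ t (by linarith), b₂ t (by linarith), b₁ t ht]; rfl
  have p5 : ∀ t, 1 ≤ t → g₄ t = t := fun t ht => c₄ t ht
  refine ⟨g₄, ⟨hg₄.1, fun t ht => ?_⟩, p1, fun t ht => ?_, fun t ht => ?_, fun t ht => ?_, p5⟩
  · rcases le_or_gt t 0 with h | h
    · exact p1 t (h.trans h0)
    · exact p5 t (not_lt.1 fun h' => ht ⟨h, h'⟩)
  · rw [b₄ t (by linarith [ht.2]), b₃ t (by linarith [ht.2]), b₂ t ht.2, c₁ t ht.1, a₁]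
    norm_num; ring
  · rw [b₄ t (by linarith [ht.2]), b₃ t ht.2, c₂ t ht.1, a₂]; norm_num
  · rw [b₄ t ht.2, c₃ t ht.1, a₃]; norm_num; ring

/-- The standard generators of Thompson's group: `caret i` acts as the first one on the interval
`[vine i, 1]`. -/
noncomputable def caret (i : ℕ) : ℝ ≃ₜ ℝ := (exists_caret i).choose

theorem caret_mem (i : ℕ) : caret i ∈ dyadicPLGroup (Ioo 0 1) := (exists_caret i).choose_spec.1

theorem caret_apply_of_le {i : ℕ} {t : ℝ} (ht : t ≤ vine i) : caret i t = t :=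
  (exists_caret i).choose_spec.2.1 t ht

theorem caret_apply₁ {i : ℕ} {t : ℝ} (h : vine i ≤ t) (h' : t ≤ vine i + 1 / 2 ^ (i + 2)) :
    caret i t = 2 * t - vine i :=
  (exists_caret i).choose_spec.2.2.1 t ⟨h, h'⟩

theorem caret_apply₂ {i : ℕ} {t : ℝ} (h : vine i + 1 / 2 ^ (i + 2) ≤ t) (h' : t ≤ vine (i + 1)) :
    caret i t = t + 1 / 2 ^ (i + 2) :=
  (exists_caret i).choose_spec.2.2.2.1 t ⟨h, h'⟩

theorem caret_apply₃ {i : ℕ} {t : ℝ} (h : vine (i + 1) ≤ t) (h' : t ≤ 1) :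
    caret i t = (t + 1) / 2 :=
  (exists_caret i).choose_spec.2.2.2.2.1 t ⟨h, h'⟩

theorem caret_apply_of_ge {i : ℕ} {t : ℝ} (ht : 1 ≤ t) : caret i t = t :=
  (exists_caret i).choose_spec.2.2.2.2.2 t ht

/-- On `[vine (i + 1), 1]` the map `caret 0` is `t ↦ (t + 1) / 2`, an affine bijection onto `[vine
(i + 2), 1]` that carries one caret to the next. -/
theorem caret_succ (i : ℕ) : caret (i + 2) = caret 0 * caret (i + 1) * (caret 0)⁻¹ := by
  rw [eq_mul_inv_iff_mul_eq]
  refine Homeomorph.ext fun t => ?_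
  change caret (i + 2) (caret 0 t) = caret 0 (caret (i + 1) t)
  have e1 := one_div_pow_succ (i + 1)
  have e2 := one_div_pow_succ (i + 2)
  have e3 := one_div_pow_succ (i + 3)
  have he : (0 : ℝ) < 1 / 2 ^ (i + 4) := by positivity
  have hv1 : vine (i + 1) = 1 - 1 / 2 ^ (i + 1) := rfl
  have hv2 : vine (i + 2) = 1 - 1 / 2 ^ (i + 2) := rfl
  have hv3 : vine (i + 3) = 1 - 1 / 2 ^ (i + 3) := rfl
  have hle : vine 1 ≤ vine (i + 1) := vine_strictMono.monotone (by omega)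
  have hm := (strictMono_of_mem (caret_mem 0)).monotone
  have h0 : ∀ {t : ℝ}, vine (i + 1) ≤ t → t ≤ 1 → caret 0 t = (t + 1) / 2 :=
    fun h h' => caret_apply₃ (hle.trans h) h'
  rcases le_total t (vine (i + 1)) with h | h
  · rw [caret_apply_of_le h, caret_apply_of_le]
    refine (hm h).trans ?_
    rw [h0 le_rfl (by linarith)]
    linarith
  rcases le_total 1 t with h' | h'
  · simp only [caret_apply_of_ge h']
  rw [h0 h h']
  rcases le_total t (vine (i + 1) + 1 / 2 ^ (i + 3)) with h2 | h2
  · rw [caret_apply₁ h h2, caret_apply₁ (by linarith) (by linarith), h0 (by linarith) (by linarith)]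
    linarith
  rcases le_total t (vine (i + 2)) with h3 | h3
  · rw [caret_apply₂ h2 h3, caret_apply₂ (by linarith) (by linarith),
      h0 (by linarith) (by linarith)]
    linarith
  · rw [caret_apply₃ h3 h', caret_apply₃ (by linarith) (by linarith),
      h0 (by linarith) (by linarith)]

/-- The length of the `i`-th interval of the subdivision of `[0, 1]` by the points
`vine 0, …, vine n`. -/
noncomputable def vineLength (n i : ℕ) : ℝ := if i < n then 1 / 2 ^ (i + 1) else 1 / 2 ^ n

/-- `g` maps the intervals of the subdivision of `[0, 1]` by `vine 0, …, vine n` affinely onto the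
standard dyadic intervals `[k i / 2 ^ m i, (k i + 1) / 2 ^ m i]`. -/
def IsVineMap (n : ℕ) (g : ℝ → ℝ) (k m : ℕ → ℕ) : Prop :=
  ∀ i ≤ n, ∀ s ∈ Icc (0 : ℝ) 1, g (vine i + vineLength n i * s) = (k i + s) / 2 ^ m i

theorem vineLength_of_lt {n i : ℕ} (h : i < n) : vineLength n i = 1 / 2 ^ (i + 1) := if_pos h

theorem vineLength_self (n : ℕ) : vineLength n n = 1 / 2 ^ n := if_neg (lt_irrefl n)

theorem IsVineMap.left {n : ℕ} {g : ℝ → ℝ} {k m : ℕ → ℕ} (h : IsVineMap n g k m) {i : ℕ}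
    (hi : i ≤ n) : g (vine i) = k i / 2 ^ m i := by
  simpa using h i hi 0 (by simp)

theorem IsVineMap.right {n : ℕ} {g : ℝ → ℝ} {k m : ℕ → ℕ} (h : IsVineMap n g k m) {i : ℕ}
    (hi : i < n) : g (vine (i + 1)) = (k i + 1) / 2 ^ m i := by
  have := h i hi.le 1 (by simp)
  rwa [vineLength_of_lt hi, mul_one, ← vine_succ] at this

theorem IsVineMap.one {n : ℕ} {g : ℝ → ℝ} {k m : ℕ → ℕ} (h : IsVineMap n g k m) :
    g 1 = (k n + 1) / 2 ^ m n := by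
  have := h n le_rfl 1 (by simp)
  rwa [vineLength_self, mul_one, vine, sub_add_cancel] at this

/-- The data describe consecutive standard dyadic intervals filling `[0, 1]`. Take one of maximal
depth. Its endpoint with odd numerator (the right one if `k i` is even, the left one otherwise)
cannot be an endpoint of a shallower interval, so the neighbour there has the same depth and is its
sibling. -/
theorem exists_sibling {N : ℕ} {k m : ℕ → ℕ} (h0 : k 0 = 0)
    (hs : ∀ i < N + 1, (k i + 1) * 2 ^ m (i + 1) = k (i + 1) * 2 ^ m i)
    (h1 : k (N + 1) + 1 = 2 ^ m (N + 1)) :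
    ∃ j < N + 1, m j = m (j + 1) ∧ k (j + 1) = k j + 1 ∧ Even (k j) := by
  obtain ⟨i, hi, hmax⟩ := Finset.exists_max_image (Finset.range (N + 2)) m ⟨0, by simp⟩
  simp only [Finset.mem_range] at hi hmax
  have cancel : ∀ {a b x y : ℕ}, x ≤ y → a * 2 ^ y = b * 2 ^ x → b = a * 2 ^ (y - x) := by
    intro a b x y hxy h
    obtain ⟨d, rfl⟩ := Nat.exists_eq_add_of_le hxy
    rw [pow_add, ← mul_assoc, mul_right_comm] at h
    simpa using (Nat.eq_of_mul_eq_mul_right (by positivity) h).symm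
  rcases Nat.even_or_odd (k i) with he | ho
  · have hiN : i < N + 1 := by
      refine (Nat.lt_succ_iff.1 hi).lt_of_ne ?_
      rintro rfl
      have hpos : 0 < k (N + 1) * 2 ^ m N := by rw [← hs N (by omega)]; positivity
      have hk : k (N + 1) ≠ 0 := by rintro h; simp [h] at hpos
      have : m (N + 1) ≠ 0 := by rintro h; rw [h] at h1; omega
      have h2 : Even (k (N + 1) + 1) := by rw [h1]; exact (Nat.even_pow.2 ⟨even_two, this⟩)
      rw [Nat.even_add_one] at h2
      exact h2 he
    have hle := hmax (i + 1) (by omega)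
    have hk := cancel hle (hs i hiN).symm
    have hm : m i = m (i + 1) := by
      by_contra hne
      have h2 : Even (k i + 1) := by
        rw [hk]
        exact (Nat.even_pow.2 ⟨even_two, by omega⟩).mul_left _
      rw [Nat.even_add_one] at h2
      exact h2 he
    rw [hm] at hk
    exact ⟨i, hiN, hm, by simpa using hk.symm, he⟩
  · obtain ⟨j, rfl⟩ := Nat.exists_eq_succ_of_ne_zero (n := i) (by
      rintro rfl; rw [h0] at ho; exact absurd ho (by decide))
    have hle := hmax j (by omega)
    have hk := cancel hle (hs j (by omega))
    have hm : m j = m (j + 1) := by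
      by_contra hne
      have h2 : Even (k (j + 1)) := by
        rw [hk]
        exact (Nat.even_pow.2 ⟨even_two, by
          simp only [Nat.succ_eq_add_one] at hle ⊢; omega⟩).mul_left _
      exact (Nat.not_even_iff_odd.2 ho) h2
    simp only [Nat.succ_eq_add_one] at hk ho
    rw [hm] at hk
    have hk' : k (j + 1) = k j + 1 := by simpa using hk
    refine ⟨j, by omega, hm, hk', ?_⟩
    rw [hk'] at ho
    by_contra h
    exact (Nat.not_even_iff_odd.2 ho) (Nat.even_add_one.2 h)

/-- Induction on the number of target intervals, merging the siblings `j` and `j + 1` of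
`exists_sibling` into their parent. On the source side, `caret j` maps the two halves of the `j`-th
interval of the shorter vine onto the intervals `j` and `j + 1` of the longer one, so `g * caret j`
is a vine map with one interval fewer. -/
theorem IsVineMap.mem_closure {n : ℕ} {g : ℝ ≃ₜ ℝ} {k m : ℕ → ℕ}
    (hg : g ∈ dyadicPLGroup (Ioo 0 1)) (h : IsVineMap n g k m) :
    g ∈ Subgroup.closure (range caret) := by
  have g0 : ∀ {f : ℝ ≃ₜ ℝ}, f ∈ dyadicPLGroup (Ioo 0 1) → f 0 = 0 := fun hf => hf.2 0 (by simp)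
  have g1 : ∀ {f : ℝ ≃ₜ ℝ}, f ∈ dyadicPLGroup (Ioo 0 1) → f 1 = 1 := fun hf => hf.2 1 (by simp)
  induction n generalizing g k m with
  | zero =>
    have : g = 1 := by
      refine Homeomorph.ext fun t => ?_
      by_cases ht : t ∈ Ioo (0 : ℝ) 1
      · have h0 := h.left le_rfl
        have h1 := h.one
        have h2 := h 0 le_rfl t ⟨ht.1.le, ht.2.le⟩
        rw [vine_zero, g0 hg] at h0
        rw [g1 hg] at h1
        simp only [vine_zero, vineLength_self, pow_zero, div_one, one_mul, zero_add] at h2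
        rw [h2]
        change _ = t
        rw [add_div, ← h0] at h1 ⊢
        rw [div_eq_mul_one_div, ← zero_add (1 / (2 : ℝ) ^ m 0), ← h1]
        ring
      · exact hg.2 t ht
    rw [this]; exact one_mem _
  | succ N ih =>
    have hpow : ∀ i, (2 : ℝ) ^ m i ≠ 0 := fun i => by positivity
    have h0 : k 0 = 0 := by
      have := h.left (Nat.zero_le _)
      rw [vine_zero, g0 hg, eq_comm, div_eq_zero_iff] at this
      exact_mod_cast this.resolve_right (hpow 0)
    have hstep : ∀ i < N + 1, (k i + 1) * 2 ^ m (i + 1) = k (i + 1) * 2 ^ m i := fun i hi => by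
      have := (h.right hi).symm.trans (h.left hi)
      rw [div_eq_div_iff (hpow _) (hpow _)] at this
      exact_mod_cast this
    have h1 : k (N + 1) + 1 = 2 ^ m (N + 1) := by
      have := h.one
      rw [g1 hg, eq_div_iff (hpow _), one_mul] at this
      exact_mod_cast this.symm
    obtain ⟨j, hj, hm, hk, e, he⟩ := exists_sibling h0 hstep h1
    rw [← two_mul] at he
    -- The siblings have a parent: at depth 0 the second of them would end beyond 1.
    obtain ⟨M, hM⟩ : ∃ M, m j = M + 1 := by
      refine Nat.exists_eq_succ_of_ne_zero fun hm0 => ?_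
      have h2 : g (vine (j + 1) + vineLength (N + 1) (j + 1) * 1) ≤ g 1 := by
        refine (strictMono_of_mem hg).monotone ?_
        rw [mul_one, vineLength]
        split_ifs with h3
        · rw [← vine_succ, vine]; linarith [show (0 : ℝ) < 1 / 2 ^ (j + 1 + 1) by positivity]
        · rw [show j = N by omega, vine]; linarith
      rw [h (j + 1) (by omega) 1 (by simp), g1 hg, ← hm, hm0, hk] at h2
      push_cast at h2
      have : (0 : ℝ) ≤ k j := by positivity
      linarith
    have hkj : (k j : ℝ) = 2 * e := by exact_mod_cast he
    have hkj' : (k (j + 1) : ℝ) = 2 * e + 1 := by rw [hk]; push_cast; rw [hkj]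
    have hmj : (2 : ℝ) ^ m j = 2 ^ M * 2 := by rw [hM, pow_succ]
    have hmj' : (2 : ℝ) ^ m (j + 1) = 2 ^ M * 2 := by rw [← hm, hmj]
    have hv := vine_succ j
    have e1 := one_div_pow_succ j
    have e2 := one_div_pow_succ (j + 1)
    have he0 : (0 : ℝ) < 1 / 2 ^ (j + 2) := by positivity
    -- If the siblings are the last two intervals, their sources are the halves of the last interval
    -- of the shorter vine, and `g` itself is already a vine map for it.
    rcases (Nat.lt_succ_iff.1 hj).eq_or_lt with rfl | hjN
    · refine ih (k := Function.update k j e) (m := Function.update m j M) hg fun i hi s hs => ?_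
      rcases hi.eq_or_lt with rfl | hi'
      · simp only [Function.update_self, vineLength_self]
        rcases le_total s (1 / 2) with h2 | h2
        · have := h i (by omega) (2 * s) ⟨by linarith [hs.1], by linarith⟩
          rw [vineLength_of_lt hj, hkj, hmj] at this
          rw [show vine i + 1 / 2 ^ i * s = vine i + 1 / 2 ^ (i + 1) * (2 * s) by rw [e1]; ring,
            this]
          field_simp
        · have := h (i + 1) (by omega) (2 * s - 1) ⟨by linarith, by linarith [hs.2]⟩
          rw [vineLength_self, hkj', hmj'] at this
          rw [show vine i + 1 / 2 ^ i * s = vine (i + 1) + 1 / 2 ^ (i + 1) * (2 * s - 1) by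
            rw [e1, hv]; ring, this]
          field_simp; ring
      · rw [Function.update_of_ne hi'.ne, Function.update_of_ne hi'.ne, vineLength_of_lt hi',
          ← vineLength_of_lt (show i < j + 1 by omega)]
        exact h i (by omega) s hs
    · have hc : caret j ∈ Subgroup.closure (range caret) := Subgroup.subset_closure ⟨j, rfl⟩
      refine (Subgroup.mul_mem_cancel_right _ hc).1 (ih
        (k := fun i => if i < j then k i else if i = j then e else k (i + 1))
        (m := fun i => if i < j then m i else if i = j then M else m (i + 1))
        (mul_mem hg (caret_mem j)) fun i hi s hs => ?_)
      change g (caret j _) = _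
      rcases lt_trichotomy i j with hij | rfl | hij
      · simp only [hij, if_true]
        rw [vineLength_of_lt (show i < N by omega), ← h i (by omega) s hs,
          vineLength_of_lt (show i < N + 1 by omega), caret_apply_of_le]
        have h2 : vine (i + 1) ≤ vine j := vine_strictMono.monotone hij
        rw [vine_succ] at h2
        have : (0 : ℝ) < 1 / 2 ^ (i + 1) := by positivity
        nlinarith [hs.2]
      · simp only [lt_irrefl, if_false, if_true]
        rw [vineLength_of_lt hjN]
        rcases le_total s (1 / 2) with h2 | h2
        · have := h i (by omega) (2 * s) ⟨by linarith [hs.1], by linarith⟩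
          rw [vineLength_of_lt hj, hkj, hmj] at this
          rw [caret_apply₁ (by nlinarith [hs.1]) (by rw [e2]; nlinarith),
            show 2 * (vine i + 1 / 2 ^ (i + 1) * s) - vine i
              = vine i + 1 / 2 ^ (i + 1) * (2 * s) by ring, this]
          field_simp
        · have := h (i + 1) (by omega) (2 * s - 1) ⟨by linarith, by linarith [hs.2]⟩
          rw [vineLength_of_lt (by omega), hkj', hmj'] at this
          rw [caret_apply₂ (by rw [e2]; nlinarith) (by rw [hv, e2]; nlinarith [hs.2]),
            show vine i + 1 / 2 ^ (i + 1) * s + 1 / 2 ^ (i + 2)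
              = vine (i + 1) + 1 / 2 ^ (i + 1 + 1) * (2 * s - 1) by rw [hv, e2]; ring, this]
          field_simp; ring
      · have hl : vineLength N i = 2 * vineLength (N + 1) (i + 1) := by
          rw [vineLength, vineLength]
          simp only [Nat.add_lt_add_iff_right]
          split_ifs
          exacts [one_div_pow_succ _, one_div_pow_succ _]
        have hl0 : 0 < vineLength (N + 1) (i + 1) := by
          rw [vineLength]; split_ifs <;> positivity
        have hl1 : vine i + vineLength N i ≤ 1 := by
          rw [vineLength]
          split_ifs with h3
          · rw [← vine_succ, vine]; linarith [show (0 : ℝ) < 1 / 2 ^ (i + 1) by positivity]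
          · rw [show i = N by omega, vine]; linarith
        have hvi : vine (j + 1) ≤ vine i := vine_strictMono.monotone hij
        simp only [hij.not_gt, hij.ne', if_false]
        rw [← h (i + 1) (by omega) s hs, caret_apply₃ (by rw [hl]; nlinarith [hs.1])
          (by rw [hl] at hl1 ⊢; nlinarith [hs.2])]
        congr 1
        rw [hl, vine, vine, one_div_pow_succ i]; ring

theorem exists_uniform_vineMap (N : ℕ) : ∃ g ∈ dyadicPLGroup (Ioo 0 1),
    IsVineMap (2 ^ N - 1) g id fun _ => N := by
  set n := 2 ^ N - 1 with hn
  have hN : n + 1 = 2 ^ N := Nat.sub_add_cancel Nat.one_le_two_pow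
  have hN' : (n : ℝ) + 1 = 2 ^ N := by exact_mod_cast hN
  -- The points `vine i` never reach the right end of the last interval, so 1 is appended.
  let p : ℕ → ℝ := fun i => if i ≤ n then vine i else 1
  have hpi : ∀ i ≤ n, p i = vine i := fun i hi => if_pos hi
  have hpn : p (n + 1) = 1 := if_neg (by omega)
  have hlen : ∀ i < n + 1, p (i + 1) - p i = vineLength n i := fun i hi => by
    rcases (Nat.lt_succ_iff.1 hi).eq_or_lt with h | hi'
    · rw [h, hpn, hpi n le_rfl, vineLength_self, vine]; ring
    · rw [hpi i hi'.le, hpi (i + 1) hi', vine_succ, vineLength_of_lt hi']; ring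
  have hpos : ∀ i, 0 < vineLength n i := fun i => by rw [vineLength]; split_ifs <;> positivity
  -- The slope on each piece is the target length `2 ^ (-N)` divided by the source length
  -- `vineLength n i`.
  let m : ℕ → ℤ := fun i => (if i < n then i + 1 else n : ℤ) - N
  have hm : ∀ i < n + 1, (2 : ℝ) ^ m i * vineLength n i = 1 / 2 ^ N := fun i _ => by
    simp only [m, vineLength]
    rw [zpow_sub₀ two_ne_zero]
    split_ifs
    · norm_cast
      push_cast
      field_simp
    · norm_cast
      push_cast
      field_simp
  obtain ⟨g, hg, h0, h1, h2⟩ := exists_interpolation (p := p) (q := fun i => i / 2 ^ N) (m := m)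
    (n := n + 1) (fun i _ => by
      simp only [p]
      split_ifs
      · exact isDyadic_vine i
      · simpa using IsDyadic.int 1)
    (fun i _ => ⟨i, N, by simp⟩) (fun i hi => by linarith [hlen i hi, hpos i])
    (fun i hi => by rw [hlen i hi, hm i hi]; push_cast; ring)
  refine ⟨g, ⟨hg.1, fun t ht => ?_⟩, fun i hi s hs => ?_⟩
  · rcases le_or_gt t 0 with h | h
    · rw [h0 t (by rw [hpi 0 (Nat.zero_le _), vine_zero]; exact h), hpi 0 (Nat.zero_le _),
        vine_zero]
      simp
    · rw [h2 t (by rw [hpn]; exact not_lt.1 fun h' => ht ⟨h, h'⟩), hpn]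
      push_cast
      rw [hN']
      simp
  · have hi' : i < n + 1 := by omega
    rw [h1 i hi', hpi i hi]
    · rw [add_sub_cancel_left, ← mul_assoc, hm i hi']
      simp only [id]
      ring
    · have := hlen i hi'
      rw [hpi i hi] at this ⊢
      have := hpos i
      constructor <;> nlinarith [hs.1, hs.2]

theorem exists_common_level {B : Set ℝ} (hB : B.Finite) (hd : ∀ r ∈ B, IsDyadic r) :
    ∃ N : ℕ, ∀ r ∈ B, ∃ p : ℤ, r = p / 2 ^ N := by
  have : ∀ᶠ N : ℕ in atTop, ∀ r ∈ B, ∃ p : ℤ, r = p / 2 ^ N := by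
    rw [eventually_all_finite hB]
    intro r hr
    obtain ⟨p, q, rfl⟩ := hd r hr
    filter_upwards [eventually_ge_atTop q] with N hN
    obtain ⟨d, rfl⟩ := Nat.exists_eq_add_of_le hN
    exact ⟨p * 2 ^ d, by push_cast; rw [pow_add]; field_simp⟩
  exact this.exists

/-- On a cell of a level that resolves all breakpoints, `f` is `t ↦ 2 ^ μ * t + p / 2 ^ q`. At a
level `N ≥ μ + q` the images have length `2 ^ (μ - N)`, and `p / 2 ^ q` is an integer multiple of
this length, so the images are standard dyadic intervals. -/
theorem exists_standard_level {f : ℝ ≃ₜ ℝ} (hf : f ∈ dyadicPLGroup (Ioo 0 1)) :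
    ∃ N : ℕ, ∀ j : ℕ, j < 2 ^ N → ∃ k m : ℕ, ∀ s ∈ Icc (0 : ℝ) 1,
      f ((j + s) / 2 ^ N) = (k + s) / 2 ^ m := by
  obtain ⟨B, hB, hBd, hp⟩ := hf.1
  obtain ⟨N₀, hN₀⟩ := exists_common_level hB hBd
  have hcell : ∀ j : ℕ, ∃ (μ : ℤ) (p : ℤ) (q : ℕ),
      ∀ t ∈ Icc ((j : ℝ) / 2 ^ N₀) ((j + 1) / 2 ^ N₀), f t = 2 ^ μ * t + p / 2 ^ q := by
    intro j
    have h2 : (0 : ℝ) < 2 ^ N₀ := by positivity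
    obtain ⟨μ, c, ⟨p, q, rfl⟩, hm⟩ := hp (Ioo ((j : ℝ) / 2 ^ N₀) ((j + 1) / 2 ^ N₀))
      ordConnected_Ioo (subset_univ _) (by
        rw [disjoint_left]
        intro t ht htB
        obtain ⟨p, rfl⟩ := hN₀ t htB
        have h3 := (div_lt_div_iff_of_pos_right h2).1 ht.1
        have h4 := (div_lt_div_iff_of_pos_right h2).1 ht.2
        have h3' : (j : ℤ) < p := by exact_mod_cast h3
        have h4' : p < (j : ℤ) + 1 := by exact_mod_cast h4
        omega)
    refine ⟨μ, p, q, ?_⟩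
    have hcl := (show EqOn f (fun t => 2 ^ μ * t + p / 2 ^ q) _ from hm).closure f.continuous
      (by fun_prop)
    rw [closure_Ioo] at hcl
    · exact hcl
    · exact ((div_lt_div_iff_of_pos_right h2).2 (by linarith)).ne
  choose μ p q hcell using hcell
  obtain ⟨N, hNN, hN⟩ : ∃ N, N₀ ≤ N ∧ ∀ j ∈ Finset.range (2 ^ N₀), μ j + q j ≤ N ∧ μ j ≤ N := by
    refine ((eventually_ge_atTop N₀).and ((Finset.eventually_all _).2 fun j _ => ?_)).exists
    filter_upwards [eventually_ge_atTop (μ j + q j).toNat, eventually_ge_atTop (μ j).toNat]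
      with N h1 h2
    omega
  refine ⟨N, fun j hj => ?_⟩
  obtain ⟨d, rfl⟩ := Nat.exists_eq_add_of_le hNN
  set i := j / 2 ^ d with hi
  have hiN : i < 2 ^ N₀ := by
    rw [hi, Nat.div_lt_iff_lt_mul (by positivity), ← pow_add]; exact hj
  obtain ⟨h1, h2⟩ := hN i (Finset.mem_range.2 hiN)
  obtain ⟨M, hM⟩ := Int.eq_ofNat_of_zero_le (sub_nonneg.2 h2)
  obtain ⟨e, rfl⟩ : ∃ e, M = q i + e := Nat.exists_eq_add_of_le (by omega)
  have hμ : (2 : ℝ) ^ μ i = 2 ^ (N₀ + d) / 2 ^ (q i + e) := by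
    rw [show μ i = ((N₀ + d : ℕ) : ℤ) - ((q i + e : ℕ) : ℤ) by omega, zpow_sub₀ two_ne_zero,
      zpow_natCast, zpow_natCast]
  have hform : ∀ s ∈ Icc (0 : ℝ) 1, f ((j + s) / 2 ^ (N₀ + d))
      = ((j + p i * 2 ^ e : ℤ) + s) / 2 ^ (q i + e) := by
    intro s hs
    have hlo : (i : ℝ) * 2 ^ d ≤ j := by exact_mod_cast Nat.div_mul_le_self j (2 ^ d)
    have hhi : (j : ℝ) + 1 ≤ (i + 1) * 2 ^ d := by
      have := Nat.lt_div_mul_add (a := j) (b := 2 ^ d) (by positivity)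
      rw [← hi] at this
      have h3 : j + 1 ≤ (i + 1) * 2 ^ d := by rw [add_mul]; omega
      exact_mod_cast h3
    rw [hcell i, hμ]
    · push_cast
      rw [pow_add _ (q i)]
      field_simp
      ring
    · have h3 : (0 : ℝ) < 2 ^ N₀ := by positivity
      have h4 : (0 : ℝ) < 2 ^ d := by positivity
      rw [pow_add]
      constructor
      · rw [div_le_div_iff₀ h3 (by positivity)]
        nlinarith [hs.1]
      · rw [div_le_div_iff₀ (by positivity) h3]
        nlinarith [hs.2]
  -- The numerator is a natural number because `f` is increasing and fixes 0.
  have hnn : (0 : ℤ) ≤ j + p i * 2 ^ e := by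
    have h3 := hform 0 (by simp)
    have h4 : f 0 ≤ f ((j + 0) / 2 ^ (N₀ + d)) := (strictMono_of_mem hf).monotone (by positivity)
    rw [hf.2 0 (by simp), h3, add_zero] at h4
    by_contra hneg
    have h5 : ((j + p i * 2 ^ e : ℤ) : ℝ) < 0 := by exact_mod_cast not_le.1 hneg
    have := div_neg_of_neg_of_pos h5 (show (0 : ℝ) < 2 ^ (q i + e) by positivity)
    linarith
  refine ⟨(j + p i * 2 ^ e : ℤ).toNat, q i + e, fun s hs => ?_⟩
  rw [hform s hs, ← Int.cast_natCast ((j + p i * 2 ^ e : ℤ).toNat), Int.toNat_of_nonneg hnn]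

/-- With `g` mapping a vine onto the uniform subdivision of a level standard for `f`, both `g` and
`f * g` are vine maps. -/
theorem dyadicPLGroup_le_closure_caret :
    dyadicPLGroup (Ioo 0 1) ≤ Subgroup.closure (range caret) := by
  intro f hf
  obtain ⟨N, hN⟩ := exists_standard_level hf
  obtain ⟨g, hg, hgN⟩ := exists_uniform_vineMap N
  choose! k m hkm using hN
  refine (Subgroup.mul_mem_cancel_right _ (hgN.mem_closure hg)).1
    (IsVineMap.mem_closure (n := 2 ^ N - 1) (k := k) (m := m) (mul_mem hf hg) fun i hi s hs => ?_)
  change f (g _) = _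
  rw [hgN i hi s hs]
  exact hkm i (by have := Nat.one_le_two_pow (n := N); omega) s hs

/-- By `caret_succ`, all later carets are conjugates of `caret 1` by powers of `caret 0`. -/
theorem closure_caret_eq : (⊤ : Subgroup thompsonF) =
    Subgroup.closure {⟨caret 0, caret_mem 0⟩, ⟨caret 1, caret_mem 1⟩} := by
  symm
  rw [eq_top_iff]
  have h1 : Subgroup.closure (range caret) ≤ Subgroup.closure {caret 0, caret 1} := by
    rw [Subgroup.closure_le]
    have h0 : caret 0 ∈ Subgroup.closure {caret 0, caret 1} := Subgroup.subset_closure (by simp)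
    have : ∀ i, caret (i + 1) ∈ Subgroup.closure {caret 0, caret 1} := by
      intro i
      induction i with
      | zero => exact Subgroup.subset_closure (by simp)
      | succ i ih => rw [caret_succ]; exact mul_mem (mul_mem h0 ih) (inv_mem h0)
    rintro _ ⟨_ | i, rfl⟩
    exacts [h0, this i]
  rintro ⟨f, hf⟩ -
  have h2 := h1 (dyadicPLGroup_le_closure_caret hf)
  have h3 : ({caret 0, caret 1} : Set (ℝ ≃ₜ ℝ))
      = thompsonF.subtype '' {⟨caret 0, caret_mem 0⟩, ⟨caret 1, caret_mem 1⟩} := by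
    simp [image_insert_eq]
  rw [h3, ← MonoidHom.map_closure] at h2
  obtain ⟨f', hf', rfl⟩ := h2
  exact hf'

theorem thompsonF_fg : Group.FG thompsonF :=
  Group.fg_iff.2 ⟨_, closure_caret_eq.symm, (finite_singleton _).insert _⟩

/-! ### Compactly supported elements are products of commutators -/

/-- The germ of `f` at `0` on the right is `t ↦ 2 ^ a * t`. -/
def HasGerm (f : ℝ → ℝ) (a : ℤ) : Prop := ∀ᶠ t in 𝓝[>] (0 : ℝ), f t = 2 ^ a * t

theorem tendsto_zpow_mul (a : ℤ) : Tendsto (fun t : ℝ => 2 ^ a * t) (𝓝[>] 0) (𝓝[>] 0) := by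
  refine tendsto_nhdsWithin_iff.2 ⟨?_, ?_⟩
  · exact ((by fun_prop : Continuous fun t : ℝ => (2 : ℝ) ^ a * t).tendsto' 0 0 (by simp)).mono_left
      nhdsWithin_le_nhds
  · filter_upwards [self_mem_nhdsWithin] with t ht
    exact mul_pos (show (0 : ℝ) < 2 ^ a by positivity) ht

theorem HasGerm.comp {f g : ℝ → ℝ} {a b : ℤ} (hf : HasGerm f a) (hg : HasGerm g b) :
    HasGerm (fun t => f (g t)) (a + b) := by
  filter_upwards [hg, (tendsto_zpow_mul b).eventually hf] with t h1 h2
  rw [h1, h2, zpow_add₀ two_ne_zero, mul_assoc]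

theorem HasGerm.inv {f g : ℝ → ℝ} {a : ℤ} (hf : HasGerm f a) (hfg : ∀ t, g (f t) = t) :
    HasGerm g (-a) := by
  filter_upwards [(tendsto_zpow_mul (-a)).eventually hf] with t h1
  rw [← mul_assoc, ← zpow_add₀ two_ne_zero] at h1
  rw [← hfg (2 ^ (-a) * t), h1]
  simp

theorem HasGerm.eq_zero {f : ℝ → ℝ} {a : ℤ} (hf : HasGerm f a)
    (h : ∀ᶠ t in 𝓝[>] (0 : ℝ), f t = t) : a = 0 := by
  obtain ⟨t, h1, h2, h3⟩ := (hf.and (h.and self_mem_nhdsWithin)).exists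
  rw [h2] at h1
  have h4 : (2 : ℝ) ^ a = 1 := by
    have : (t : ℝ) ≠ 0 := (show (0 : ℝ) < t from h3).ne'
    field_simp at h1
    exact h1.symm
  exact (zpow_eq_one_iff_right₀ (by norm_num : (0 : ℝ) ≤ 2) (by norm_num)).1 h4

theorem hasGerm_one : HasGerm (fun t => t) 0 := Eventually.of_forall fun t => by simp

/-- The exponent sums of a word in the two generators can be read off from slopes: at 0 they have
slopes 2 and 1, at 1 both have slope 1/2. The germ at 1 is brought to 0 by the reflection `t ↦ 1 -
t`. Consequently, trivial germs at both ends force a trivial class in the abelianization. -/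
theorem exists_abelianization_eq (f : thompsonF) : ∃ a b : ℤ,
    Abelianization.of f = Abelianization.of (⟨caret 0, caret_mem 0⟩ : thompsonF) ^ a *
      Abelianization.of (⟨caret 1, caret_mem 1⟩ : thompsonF) ^ b ∧
    HasGerm (f : ℝ ≃ₜ ℝ) a ∧ HasGerm (fun t => 1 - (f : ℝ ≃ₜ ℝ) (1 - t)) (-(a + b)) := by
  have hgerm : ∀ i, HasGerm (fun t => 1 - caret i (1 - t)) (-1) := by
    intro i
    have hv : (0 : ℝ) < 1 - vine (i + 1) := by simp [vine]
    filter_upwards [Ioo_mem_nhdsGT hv] with t ht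
    rw [caret_apply₃ (by linarith [ht.2]) (by linarith [ht.1])]
    norm_num
    ring
  have hf : f ∈ Subgroup.closure {⟨caret 0, caret_mem 0⟩, ⟨caret 1, caret_mem 1⟩} := by
    rw [← closure_caret_eq]; trivial
  induction hf using Subgroup.closure_induction with
  | mem f hf =>
    rcases hf with rfl | rfl
    · refine ⟨1, 0, by simp, ?_, by simpa using hgerm 0⟩
      filter_upwards [Ioo_mem_nhdsGT (show (0 : ℝ) < 1 / 2 ^ 2 by norm_num)] with t ht
      have := caret_apply₁ (i := 0) (t := t) (by rw [vine_zero]; exact ht.1.le)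
        (by rw [vine_zero]; simpa using ht.2.le)
      rw [vine_zero] at this
      simpa using this
    · refine ⟨0, 1, by simp, ?_, by simpa using hgerm 1⟩
      filter_upwards [Ioo_mem_nhdsGT (show (0 : ℝ) < vine 1 by norm_num [vine])] with t ht
      have := caret_apply_of_le ht.2.le
      simpa using this
  | one => exact ⟨0, 0, by simp, hasGerm_one, by
      simpa using hasGerm_one⟩
  | mul f g _ _ hf hg =>
    obtain ⟨a, b, h1, h2, h3⟩ := hf
    obtain ⟨a', b', h1', h2', h3'⟩ := hg
    refine ⟨a + a', b + b', ?_, h2.comp h2', ?_⟩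
    · rw [map_mul, h1, h1', zpow_add, zpow_add, mul_mul_mul_comm]
    · have := h3.comp h3'
      rw [show -(a + a' + (b + b')) = -(a + b) + -(a' + b') by ring]
      simpa using this
  | inv f _ hf =>
    obtain ⟨a, b, h1, h2, h3⟩ := hf
    refine ⟨-a, -b, ?_, h2.inv (f : ℝ ≃ₜ ℝ).symm_apply_apply, ?_⟩
    · rw [map_inv, h1, zpow_neg, zpow_neg, mul_inv]
    · have := h3.inv (g := fun t => 1 - (f : ℝ ≃ₜ ℝ).symm (1 - t)) (by simp)
      rw [show -(-a + -b) = -(-(a + b)) by ring]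
      exact this

theorem mem_commutator_unit {f : ℝ ≃ₜ ℝ} {u v : ℝ} (hf : f ∈ dyadicPLGroup (Ioo u v))
    (hu : 0 < u) (hv : v < 1) : f ∈ ⁅dyadicPLGroup (Ioo 0 1), dyadicPLGroup (Ioo 0 1)⁆ := by
  have hf' := dyadicPLGroup_mono (Ioo_subset_Ioo hu.le hv.le) hf
  obtain ⟨a, b, h1, h2, h3⟩ := exists_abelianization_eq ⟨f, hf'⟩
  have ha : a = 0 := h2.eq_zero (by
    filter_upwards [Ioo_mem_nhdsGT hu] with t ht
    exact hf.2 t fun h => by linarith [ht.2, h.1])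
  have hb : -(a + b) = 0 := h3.eq_zero (by
    filter_upwards [Ioo_mem_nhdsGT (sub_pos.2 hv)] with t ht
    rw [hf.2 (1 - t) fun h => by linarith [ht.2, h.2]]
    ring)
  have hb' : b = 0 := by omega
  subst ha hb'
  rw [zpow_zero, zpow_zero, one_mul, ← MonoidHom.mem_ker, Abelianization.ker_of] at h1
  rw [← Subgroup.map_subtype_commutator]
  exact ⟨_, h1, rfl⟩

theorem dyadicPLGroup_le_commutator {u v u' v' : ℝ} (hu : IsDyadic u) (hv : IsDyadic v)
    (huv : u < v) (hu' : u < u') (hv' : v' < v) :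
    dyadicPLGroup (Ioo u' v') ≤ ⁅dyadicPLGroup (Ioo u v), dyadicPLGroup (Ioo u v)⁆ := by
  obtain ⟨h, hh, rfl, rfl⟩ := exists_map_of_lt (a := 0) (b := 1) (by simpa using IsDyadic.int 0)
    (by simpa using IsDyadic.int 1) hu hv one_pos huv
  rw [← map_conj_dyadicPLGroup hh, ← Subgroup.map_commutator]
  obtain ⟨a, rfl⟩ := h.surjective u'
  obtain ⟨b, rfl⟩ := h.surjective v'
  rw [← map_conj_dyadicPLGroup hh]
  have hm := strictMono_of_mem hh
  exact Subgroup.map_mono fun f hf => mem_commutator_unit hf (hm.lt_iff_lt.1 hu')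
    (hm.lt_iff_lt.1 hv')

/-! ### Fibrewise lifts of homeomorphisms of the suspension -/

/-- The group of continuous families of increasing homeomorphisms of `ℝ`, indexed by `X`, that
commute with the action of `ℤ` on `X × ℝ`. -/
def liftGroup {X : Type*} [TopologicalSpace X] (φ : X ≃ₜ X) : Subgroup (X → ℝ ≃ₜ ℝ) where
  carrier := {G | (∀ x t, G (φ x) (t - 1) = G x t - 1) ∧ (∀ x, StrictMono (G x)) ∧
    Continuous fun p : X × ℝ => G p.1 p.2}
  one_mem' := ⟨fun _ _ => rfl, fun _ => strictMono_id, continuous_snd⟩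
  mul_mem' := by
    rintro G H ⟨hG, hG', hG''⟩ ⟨hH, hH', hH''⟩
    refine ⟨fun x t => ?_, fun x => (hG' x).comp (hH' x), ?_⟩
    · change G (φ x) (H (φ x) (t - 1)) = G x (H x t) - 1
      rw [hH, hG]
    · exact hG''.comp (continuous_fst.prodMk hH'')
  inv_mem' := by
    rintro G ⟨hG, hG', hG''⟩
    refine ⟨fun x t => ?_, fun x s t hst => ?_, continuous_iff_continuousAt.2 fun ⟨x, s⟩ => ?_⟩
    · change (G (φ x)).symm (t - 1) = (G x).symm t - 1
      rw [Homeomorph.symm_apply_eq, hG, (G x).apply_symm_apply]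
    · rw [← (hG' x).lt_iff_lt]
      change G x ((G x).symm s) < G x ((G x).symm t)
      simpa using hst
    · change Tendsto (fun p : X × ℝ => (G p.1).symm p.2) _ (𝓝 ((G x).symm s))
      set t := (G x).symm s with ht
      have hs : G x t = s := (G x).apply_symm_apply s
      -- Monotonicity turns a bound `a` on the inverse into a comparison of `p.2` with `G p.1 a`,
      -- which is an open condition on `p`.
      rw [tendsto_order]
      constructor
      · intro a ha
        have h1 : Continuous fun p : X × ℝ => G p.1 a :=
          hG''.comp (continuous_fst.prodMk continuous_const)
        have h2 : G x a < s := hs ▸ hG' x ha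
        filter_upwards [h1.continuousAt.eventually_lt continuous_snd.continuousAt h2] with p hp
        rw [← (hG' p.1).lt_iff_lt]
        simpa using hp
      · intro a ha
        have h1 : Continuous fun p : X × ℝ => G p.1 a :=
          hG''.comp (continuous_fst.prodMk continuous_const)
        have h2 : s < G x a := hs ▸ hG' x ha
        filter_upwards [continuous_snd.continuousAt.eventually_lt h1.continuousAt h2] with p hp
        rw [← (hG' p.1).lt_iff_lt]
        simpa using hp

section Lift

variable {X : Type*} [TopologicalSpace X] {φ : X ≃ₜ X}

theorem iter_succ (φ : X ≃ₜ X) (n : ℤ) (x : X) :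
    (φ ^ (n + 1) : X ≃ₜ X) x = φ ((φ ^ n : X ≃ₜ X) x) := by
  rw [add_comm, iter_add, zpow_one]

theorem equivariant_iter {G : X → ℝ → ℝ} (hG : ∀ x t, G (φ x) (t - 1) = G x t - 1) (n : ℤ) (x : X)
    (t : ℝ) : G ((φ ^ n : X ≃ₜ X) x) (t - n) = G x t - n := by
  induction n with
  | zero => simp
  | succ n ih =>
    rw [iter_succ, show t - ((n + 1 : ℤ) : ℝ) = t - (n : ℤ) - 1 by push_cast; ring, hG, ih]
    push_cast; ring
  | pred n ih =>
    have h := hG ((φ ^ (-(n : ℤ) - 1) : X ≃ₜ X) x) (t - ((-n - 1 : ℤ) : ℝ))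
    rw [← iter_succ, sub_add_cancel,
      show t - ((-n - 1 : ℤ) : ℝ) - 1 = t - (-n : ℤ) by push_cast; ring, ih] at h
    push_cast at h ⊢
    linarith

theorem liftGroup_iter {G : X → ℝ ≃ₜ ℝ} (hG : G ∈ liftGroup φ) (n : ℤ) (x : X) (t : ℝ) :
    G ((φ ^ n : X ≃ₜ X) x) (t - n) = G x t - n :=
  equivariant_iter (G := fun x => G x) hG.1 n x t

theorem continuous_mk (φ : X ≃ₜ X) : Continuous fun p : X × ℝ => Suspension.mk φ p.1 p.2 :=
  continuous_quotient_mk'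

/-- The map of the suspension induced by an equivariant family. -/
def descendFun (G : liftGroup φ) : Suspension φ → Suspension φ :=
  Quotient.lift (fun p : X × ℝ => Suspension.mk φ p.1 (G.1 p.1 p.2)) (by
    rintro ⟨x, t⟩ _ ⟨n, rfl⟩
    change Suspension.mk φ x (G.1 x t) = Suspension.mk φ _ (G.1 _ (t - n))
    rw [liftGroup_iter G.2, Suspension.mk_shift])

theorem descendFun_mk (G : liftGroup φ) (x : X) (t : ℝ) :
    descendFun G (Suspension.mk φ x t) = Suspension.mk φ x (G.1 x t) := rfl

theorem continuous_descendFun (G : liftGroup φ) : Continuous (descendFun G) :=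
  Continuous.quotient_lift ((continuous_mk φ).comp (continuous_fst.prodMk G.2.2.2)) _

/-- The homeomorphism of the suspension induced by an equivariant family. -/
def descend (φ : X ≃ₜ X) : liftGroup φ →* (Suspension φ ≃ₜ Suspension φ) where
  toFun G :=
    { toFun := descendFun G
      invFun := descendFun G⁻¹
      left_inv := fun y => by
        obtain ⟨x, t, rfl⟩ := Suspension.exists_rep φ y
        rw [descendFun_mk, descendFun_mk]
        exact congrArg _ ((G.1 x).symm_apply_apply t)
      right_inv := fun y => by
        obtain ⟨x, t, rfl⟩ := Suspension.exists_rep φ y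
        rw [descendFun_mk, descendFun_mk]
        exact congrArg _ ((G.1 x).apply_symm_apply t)
      continuous_toFun := continuous_descendFun G
      continuous_invFun := continuous_descendFun G⁻¹ }
  map_one' := Homeomorph.ext fun y => by
    obtain ⟨x, t, rfl⟩ := Suspension.exists_rep φ y
    rfl
  map_mul' G H := Homeomorph.ext fun y => by
    obtain ⟨x, t, rfl⟩ := Suspension.exists_rep φ y
    rfl

theorem descend_mk (G : liftGroup φ) (x : X) (t : ℝ) :
    descend φ G (Suspension.mk φ x t) = Suspension.mk φ x (G.1 x t) := rfl

/-- The action `n +ᵥ (x, t) = (φ ^ n x, t - n)`. -/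
@[reducible] def suspensionAction (φ : X ≃ₜ X) : AddAction ℤ (X × ℝ) where
  vadd n p := ((φ ^ n : X ≃ₜ X) p.1, p.2 - n)
  zero_vadd p := by
    change ((φ ^ (0 : ℤ) : X ≃ₜ X) p.1, p.2 - ((0 : ℤ) : ℝ)) = p
    simp
  add_vadd m n p := by
    change ((φ ^ (m + n) : X ≃ₜ X) p.1, p.2 - ((m + n : ℤ) : ℝ))
      = ((φ ^ m : X ≃ₜ X) ((φ ^ n : X ≃ₜ X) p.1), p.2 - n - m)
    rw [iter_add]
    push_cast
    ring_nf

/-- An open window of length 1 in `ℝ` is disjoint from its translates by non-zero integers. -/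
theorem isCoveringMap_mk (φ : X ≃ₜ X) :
    IsCoveringMap fun p : X × ℝ => Suspension.mk φ p.1 p.2 := by
  let _ := suspensionAction φ
  have hv : ∀ (n : ℤ) (p : X × ℝ), n +ᵥ p = ((φ ^ n : X ≃ₜ X) p.1, p.2 - n) := fun _ _ => rfl
  have : IsAddQuotientCoveringMap (fun p : X × ℝ => Suspension.mk φ p.1 p.2) ℤ :=
    { isQuotientMap_quotient_mk' (s := suspensionSetoid φ) with
      continuous_const_vadd := fun n =>
        ((φ ^ n : X ≃ₜ X).continuous.comp continuous_fst).prodMk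
          (continuous_snd.sub continuous_const)
      apply_eq_iff_mem_orbit := by
        rintro ⟨x, t⟩ ⟨x', t'⟩
        rw [eq_comm, Suspension.mk_eq]
        simp only [AddAction.mem_orbit_iff, hv, Prod.mk.injEq]
        exact exists_congr fun n => and_congr eq_comm eq_comm
      disjoint := by
        rintro ⟨x, t⟩
        refine ⟨univ ×ˢ Ioo (t - 1 / 2) (t + 1 / 2), prod_mem_nhds univ_mem
          (Ioo_mem_nhds (by linarith) (by linarith)), ?_⟩
        rintro n ⟨_, ⟨⟨y, s⟩, ⟨-, hs⟩, rfl⟩, ⟨-, hs'⟩⟩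
        have hs' : s - n ∈ Ioo (t - 1 / 2) (t + 1 / 2) := hs'
        simp only [mem_Ioo] at hs hs'
        have h1 : (-1 : ℝ) < n := by linarith
        have h2 : (n : ℝ) < 1 := by linarith
        have h1' : (-1 : ℤ) < n := by exact_mod_cast h1
        have h2' : n < (1 : ℤ) := by exact_mod_cast h2
        omega }
  exact this.isCoveringMap

theorem exists_homeomorph_family {G : X → ℝ → ℝ} (hG : ∀ x, StrictMono (G x))
    (hs : ∀ x, Function.Surjective (G x)) (hc : Continuous fun p : X × ℝ => G p.1 p.2)
    (he : ∀ x t, G (φ x) (t - 1) = G x t - 1) : ∃ F : liftGroup φ, ∀ x t, F.1 x t = G x t := by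
  choose F hF using fun x => exists_homeomorph_of_strictMono (hG x) (hs x)
  refine ⟨⟨F, fun x t => by rw [hF, hF, he],
    fun x s t hst => by rw [hF, hF]; exact hG x hst, ?_⟩, hF⟩
  simpa only [hF] using hc

/-- The straight-line isotopy `(1 - s) * t + s * G_x(t)` works, as convex combinations preserve
monotonicity and equivariance. -/
theorem descend_mem_isotopicToId (G : liftGroup φ) :
    descend φ G ∈ isotopicToId (Suspension φ) := by
  have hF : ∀ s : unitInterval, ∃ F : liftGroup φ, ∀ x t,
      F.1 x t = (1 - (s : ℝ)) * t + s * G.1 x t := by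
    intro s
    have h0 : 0 ≤ (s : ℝ) := s.2.1
    have h1 : 0 ≤ 1 - (s : ℝ) := by linarith [s.2.2]
    have hm : ∀ x, StrictMono fun t => (1 - (s : ℝ)) * t + s * G.1 x t := by
      intro x t t' htt'
      have h2 := G.2.2.1 x htt'
      rcases h0.eq_or_lt with h | h
      · simp only [← h]; linarith
      · exact add_lt_add_of_le_of_lt (mul_le_mul_of_nonneg_left htt'.le h1)
          (mul_lt_mul_of_pos_left h2 h)
    have hc : Continuous fun p : X × ℝ => (1 - (s : ℝ)) * p.2 + s * G.1 p.1 p.2 :=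
      (continuous_const.mul continuous_snd).add (continuous_const.mul G.2.2.2)
    have he : ∀ x t, (1 - (s : ℝ)) * (t - 1) + s * G.1 (φ x) (t - 1)
        = (1 - (s : ℝ)) * t + s * G.1 x t - 1 := fun x t => by rw [G.2.1]; ring
    refine exists_homeomorph_family hm (fun x => ?_) hc he
    refine Continuous.surjective (hc.comp (by fun_prop : Continuous fun t : ℝ => (x, t))) ?_ ?_
    · rcases h0.eq_or_lt with h | h
      · simp only [← h, sub_zero, one_mul, zero_mul, add_zero]
        exact tendsto_id
      · have h2 : Tendsto (G.1 x) atTop atTop :=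
          (G.2.2.1 x).monotone.tendsto_atTop_atTop fun b => ⟨(G.1 x).symm b, by simp⟩
        refine tendsto_atTop_mono' _ ?_ (h2.const_mul_atTop h)
        filter_upwards [eventually_ge_atTop 0] with t ht
        change _ ≤ (1 - (s : ℝ)) * t + s * G.1 x t
        nlinarith
    · rcases h0.eq_or_lt with h | h
      · simp only [← h, sub_zero, one_mul, zero_mul, add_zero]
        exact tendsto_id
      · have h2 : Tendsto (G.1 x) atBot atBot :=
          (G.2.2.1 x).monotone.tendsto_atBot_atBot fun b => ⟨(G.1 x).symm b, by simp⟩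
        refine tendsto_atBot_mono' _ ?_ (h2.const_mul_atBot h)
        filter_upwards [eventually_le_atBot 0] with t ht
        change (1 - (s : ℝ)) * t + s * G.1 x t ≤ _
        nlinarith
  choose F hF using hF
  refine ⟨fun p => descend φ (F p.1) p.2, ?_, fun s => (descend φ (F s)).isHomeomorph, ?_, ?_⟩
  · have hq : IsOpenQuotientMap fun p : X × ℝ => Suspension.mk φ p.1 p.2 :=
      ⟨Quotient.mk_surjective, continuous_mk φ, (isCoveringMap_mk φ).isLocalHomeomorph.isOpenMap⟩
    refine (IsOpenQuotientMap.id.prodMap hq).isQuotientMap.continuous_iff.2 ?_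
    change Continuous fun p : unitInterval × (X × ℝ) =>
      Suspension.mk φ p.2.1 ((F p.1).1 p.2.1 p.2.2)
    simp only [hF]
    have h1 : Continuous fun p : unitInterval × (X × ℝ) => G.1 p.2.1 p.2.2 :=
      G.2.2.2.comp continuous_snd
    have h2 : Continuous fun p : unitInterval × (X × ℝ) => (p.1 : ℝ) :=
      continuous_subtype_val.comp continuous_fst
    exact (continuous_mk φ).comp (continuous_snd.fst.prodMk
      (((continuous_const.sub h2).mul continuous_snd.snd).add (h2.mul h1)))
  · intro y
    obtain ⟨x, t, rfl⟩ := Suspension.exists_rep φ y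
    simp [descend_mk, hF]
  · intro y
    obtain ⟨x, t, rfl⟩ := Suspension.exists_rep φ y
    simp [descend_mk, hF]

/-- A homeomorphism of the suspension of a totally disconnected compact space that is isotopic to
the identity lifts to a continuous family of homeomorphisms of `ℝ`. -/
theorem exists_lift [CompactSpace X] [TotallyDisconnectedSpace X]
    {g : Suspension φ ≃ₜ Suspension φ} (hg : g ∈ isotopicToId (Suspension φ)) :
    ∃ G : liftGroup φ, descend φ G = g := by
  obtain ⟨H, hH, -, hH0, hH1⟩ := hg
  let q : X × ℝ → Suspension φ := fun p => Suspension.mk φ p.1 p.2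
  have cov : IsCoveringMap q := isCoveringMap_mk φ
  let HH : C(unitInterval × (X × ℝ), Suspension φ) :=
    ⟨fun p => H (p.1, q p.2), hH.comp (continuous_fst.prodMk (cov.continuous.comp continuous_snd))⟩
  have hHH : ∀ p, HH (0, p) = q (ContinuousMap.id (X × ℝ) p) := fun p => hH0 _
  let L := cov.liftHomotopy HH (ContinuousMap.id _) hHH
  have hL : ∀ p, q (L p) = HH p := fun p => congrFun (cov.liftHomotopy_lifts HH _ hHH) p
  have hL0 : ∀ p, L (0, p) = p := fun p => cov.liftHomotopy_zero HH _ hHH p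
  have hLc : ∀ p, Continuous fun s => L (s, p) := fun p => L.continuous.comp (by fun_prop)
  -- The `X`-coordinate of a lifted path has connected image in a totally disconnected space, so it
  -- is constant.
  have hfst : ∀ s p, (L (s, p)).1 = p.1 := by
    intro s p
    have h1 : IsPreconnected (range fun s => (L (s, p)).1) :=
      isPreconnected_range (continuous_fst.comp (hLc p))
    have h2 := h1.subsingleton ⟨s, rfl⟩ ⟨0, rfl⟩
    simpa only [hL0] using h2
  -- Both sides lift the same path from the same starting point, so uniqueness of lifts gives
  -- equivariance.
  have heq : ∀ x t s, L (s, (φ x, t - 1)) = (φ x, (L (s, (x, t))).2 - 1) := by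
    intro x t s
    have hshift : ∀ t, q (φ x, t - 1) = q (x, t) := fun t => by
      simpa using Suspension.mk_shift φ 1 x t
    refine congrFun (cov.eq_of_comp_eq (g₁ := fun s => L (s, (φ x, t - 1)))
      (g₂ := fun s => (φ x, (L (s, (x, t))).2 - 1)) (hLc _)
      (continuous_const.prodMk ((continuous_snd.comp (hLc _)).sub continuous_const)) ?_ 0 ?_) s
    · funext s
      change q (L (s, (φ x, t - 1))) = q (φ x, (L (s, (x, t))).2 - 1)
      rw [hshift, hL]
      change H (s, q (φ x, t - 1)) = _
      rw [hshift]
      have h2 : q (L (s, (x, t))) = q (x, (L (s, (x, t))).2) := by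
        rw [← Prod.mk.eta (p := L (s, (x, t))), hfst]
      rw [← h2, hL]
      rfl
    · simp [hL0]
  let G : X → ℝ → ℝ := fun x t => (L (1, (x, t))).2
  have hGg : ∀ x t, Suspension.mk φ x (G x t) = g (Suspension.mk φ x t) := by
    intro x t
    have h1 := hL (1, (x, t))
    have h2 : L (1, (x, t)) = (x, G x t) := Prod.ext (hfst 1 (x, t)) rfl
    rw [h2] at h1
    exact h1.trans (hH1 _)
  have hGc : Continuous fun p : X × ℝ => G p.1 p.2 :=
    continuous_snd.comp (L.continuous.comp (by fun_prop))
  have hGe : ∀ x t, G (φ x) (t - 1) = G x t - 1 := fun x t => by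
    simp only [G, heq x t 1]
  have hGn := equivariant_iter hGe
  have hGi : ∀ x, Function.Injective (G x) := by
    intro x t t' htt'
    have h1 : Suspension.mk φ x t = Suspension.mk φ x t' :=
      g.injective (by rw [← hGg, ← hGg, htt'])
    obtain ⟨n, hn, rfl⟩ := (Suspension.mk_eq φ).1 h1
    have h2 := hGn n x t
    rw [← hn, ← htt'] at h2
    have h3 : (n : ℝ) = 0 := by linarith
    rw [h3, sub_zero]
  -- The displacement is invariant under `ℤ`, so it is bounded by its maximum over the compact set
  -- `X × [0, 1]`. This yields surjectivity and excludes decreasing maps.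
  obtain ⟨M, hM⟩ : ∃ M, ∀ x t, |G x t - t| ≤ M := by
    obtain ⟨M, hM⟩ :=
      ((isCompact_univ (X := X)).prod (isCompact_Icc (a := (0 : ℝ)) (b := 1))).exists_bound_of_continuousOn
      (hGc.sub continuous_snd).continuousOn
    refine ⟨M, fun x t => ?_⟩
    have h1 := hM ((φ ^ ⌊t⌋ : X ≃ₜ X) x, t - ⌊t⌋)
      ⟨mem_univ _, by linarith [Int.floor_le t], by linarith [Int.lt_floor_add_one t]⟩
    change |G _ (t - ⌊t⌋) - (t - ⌊t⌋)| ≤ M at h1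
    rwa [hGn, sub_sub_sub_cancel_right] at h1
  have hGx : ∀ x, Continuous (G x) := fun x =>
    hGc.comp (by fun_prop : Continuous fun t : ℝ => (x, t))
  have htop : ∀ x, Tendsto (G x) atTop atTop := fun x =>
    tendsto_atTop_mono (fun t => by simp only [id]; linarith [(abs_le.1 (hM x t)).1])
      (tendsto_atTop_add_const_right _ (-M) tendsto_id)
  have hbot : ∀ x, Tendsto (G x) atBot atBot := fun x =>
    tendsto_atBot_mono (fun t => by simp only [id]; linarith [(abs_le.1 (hM x t)).2])
      (tendsto_atBot_add_const_right _ M tendsto_id)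
  have hmono : ∀ x, StrictMono (G x) := by
    intro x
    refine ((hGx x).strictMono_of_inj (hGi x)).resolve_right fun hanti => ?_
    have h1 := hanti (show 0 < |2 * M| + 1 by positivity)
    have h2 := abs_le.1 (hM x 0)
    have h3 := abs_le.1 (hM x (|2 * M| + 1))
    linarith [le_abs_self (2 * M)]
  obtain ⟨F, hF⟩ := exists_homeomorph_family hmono
    (fun x => (hGx x).surjective (htop x) (hbot x)) hGc hGe
  refine ⟨F, Homeomorph.ext fun y => ?_⟩
  obtain ⟨x, t, rfl⟩ := Suspension.exists_rep φ y
  rw [descend_mk, hF, hGg]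

/-- The family is locally constant in `X`, and locally dyadic piecewise linear in `ℝ`. -/
def IsLocallyPL (G : X → ℝ ≃ₜ ℝ) : Prop :=
  ∀ x s, ∃ a b, a < s ∧ s < b ∧ (∀ᶠ x' in 𝓝 x, ∀ t ∈ Ioo a b, G x' t = G x t) ∧
    IsDyadicPLOn (G x) (Ioo a b)

theorem IsLocallyPL.isDyadic_iff {G : X → ℝ ≃ₜ ℝ} (hG : IsLocallyPL G) (x : X) {s : ℝ} :
    IsDyadic (G x s) ↔ IsDyadic s := by
  obtain ⟨a, b, ha, hb, -, h⟩ := hG x s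
  exact h.isDyadic_iff isOpen_Ioo (G x).continuous.continuousOn ⟨ha, hb⟩

/-- At each point a chart expression agrees with the lift only up to an integer. Continuity makes
this integer constant near `(x, s)`, so the local form passes to the lift. -/
theorem isLocallyPL_of_descend_mem {G : liftGroup φ} (hG : descend φ G ∈ groupT φ) :
    IsLocallyPL G.1 := by
  intro x s
  obtain ⟨C, a, b, c, d, f, hy, hf⟩ := hG.2 (Suspension.mk φ x s)
  obtain ⟨C, a, b, c, d, f, hf, hx, hs⟩ := hasChartAt_of_mem_domain hf hy
  have key : ∀ x' ∈ C, ∀ t ∈ Ioo a b, ∃ n : ℤ, f t = G.1 x' t - n := by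
    intro x' hx' t ht
    have h1 := hf.map_eq x' hx' t ht
    rw [descend_mk] at h1
    obtain ⟨n, -, hn⟩ := (Suspension.mk_eq φ).1 h1
    exact ⟨n, hn⟩
  obtain ⟨n, hn⟩ := key x hx s hs
  have hfc : ContinuousAt f s := f.continuousAt (hf.source_eq ▸ hs)
  have h2 : ContinuousAt (fun p : X × ℝ => G.1 p.1 p.2 - f p.2 - n) (x, s) :=
    (G.2.2.2.continuousAt.sub (ContinuousAt.comp (f := Prod.snd) hfc continuousAt_snd)).sub
      continuousAt_const
  have h3 : ∀ᶠ p : X × ℝ in 𝓝 (x, s), G.1 p.1 p.2 - f p.2 - n ∈ Ioo (-1 : ℝ) 1 := by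
    refine h2 (Ioo_mem_nhds ?_ ?_) <;> simp [hn]
  have h4 : ∀ᶠ p : X × ℝ in 𝓝 (x, s), f p.2 = G.1 p.1 p.2 - n := by
    filter_upwards [h3, prod_mem_nhds (hf.chart_source.isClopen.isOpen.mem_nhds hx)
      (isOpen_Ioo.mem_nhds hs)] with p hp hp'
    obtain ⟨k, hk⟩ := key p.1 hp'.1 p.2 hp'.2
    have h5 : ((k - n : ℤ) : ℝ) ∈ Ioo (-1 : ℝ) 1 := by
      rw [hk] at hp
      push_cast
      simpa using hp
    have h6 : (-1 : ℤ) < k - n := by exact_mod_cast h5.1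
    have h7 : k - n < (1 : ℤ) := by exact_mod_cast h5.2
    rw [hk, show k = n by omega]
  rw [nhds_prod_eq, eventually_prod_iff] at h4
  obtain ⟨P, hP, Q, hQ, hPQ⟩ := h4
  obtain ⟨a', b', ⟨ha', hb'⟩, hab⟩ := mem_nhds_iff_exists_Ioo_subset.1
    (inter_mem hQ (isOpen_Ioo.mem_nhds hs))
  have hGx : ∀ t ∈ Ioo a' b', G.1 x t = f t + n := fun t ht => by
    rw [hPQ hP.self_of_nhds (hab ht).1]; ring
  refine ⟨a', b', ha', hb', ?_, ?_⟩
  · filter_upwards [hP] with x' hx' t ht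
    rw [hGx t ht, hPQ hx' (hab ht).1]; ring
  · obtain ⟨B, hB, hBd, hp⟩ := hf.dyadicPL
    refine ⟨B, hB, hBd, fun S hS hSI hSB => ?_⟩
    obtain ⟨m, c, hc, hm⟩ := hp S hS (fun t ht => (hab (hSI ht)).2) hSB
    exact ⟨m, c + n, hc.add (.int n), fun t ht => by rw [hGx t (hSI ht), hm t ht]; ring⟩

theorem isDyadicChart_of_lt_one {C : Set X} (hC : IsClopen C) {a b : ℝ} (ha : IsDyadic a)
    (hb : IsDyadic b) (hab : a < b) (h : b - a < 1) : IsDyadicChart φ C a b :=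
  ⟨hC, ha, hb, hab, fun n hn _ => h.trans_le (by exact_mod_cast hn)⟩

/-- Intervals shorter than 1 satisfy the return-time condition automatically, so it is enough to
shrink until both the interval and its image are that short, and to take a clopen neighbourhood of
`x` on which the family is constant there. -/
theorem descend_mem_of_isLocallyPL [CompactSpace X] [T2Space X] [TotallyDisconnectedSpace X]
    {G : liftGroup φ} (hG : IsLocallyPL G.1) : descend φ G ∈ groupT φ := by
  refine ⟨descend_mem_isotopicToId G, fun y => ?_⟩
  obtain ⟨x, s, rfl⟩ := Suspension.exists_rep φ y
  obtain ⟨a, b, ha, hb, hev, hPL⟩ := hG x s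
  have hc := (G.1 x).continuous.continuousAt (x := s)
  have h1 : Ioo a b ∩ (Ioo (s - 1 / 2) (s + 1 / 2) ∩
      G.1 x ⁻¹' Ioo (G.1 x s - 1 / 2) (G.1 x s + 1 / 2)) ∈ 𝓝 s :=
    inter_mem (Ioo_mem_nhds ha hb) (inter_mem (Ioo_mem_nhds (by linarith) (by linarith))
      (hc (Ioo_mem_nhds (by linarith) (by linarith))))
  obtain ⟨l, u, ⟨hl, hu⟩, hlu⟩ := mem_nhds_iff_exists_Ioo_subset.1 h1
  obtain ⟨a', ha', hla', ha's⟩ := exists_dyadic_between hl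
  obtain ⟨b', hb', hsb', hb'u⟩ := exists_dyadic_between hu
  obtain ⟨A1, ⟨A2, -⟩, A3, -⟩ := hlu (show a' ∈ Ioo l u from ⟨hla', by linarith⟩)
  obtain ⟨B1, ⟨-, B2⟩, -, B3⟩ := hlu (show b' ∈ Ioo l u from ⟨by linarith, hb'u⟩)
  have hsub : Ioo a' b' ⊆ Ioo a b := Ioo_subset_Ioo A1.1.le B1.2.le
  obtain ⟨U, hU, hUo, hxU⟩ := eventually_nhds_iff.1 hev
  obtain ⟨C, hC, hxC, hCU⟩ := compact_exists_isClopen_in_isOpen hUo hxU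
  have hm := G.2.2.1 x
  let f : OpenPartialHomeomorph ℝ ℝ :=
    (G.1 x).toOpenPartialHomeomorph.restrOpen (Ioo a' b') isOpen_Ioo
  have hsrc : f.source = Ioo a' b' := by simp [f]
  have him : G.1 x '' Ioo a' b' = Ioo (G.1 x a') (G.1 x b') := by
    ext t
    constructor
    · rintro ⟨r, hr, rfl⟩
      exact ⟨hm hr.1, hm hr.2⟩
    · intro ht
      refine ⟨(G.1 x).symm t, ⟨?_, ?_⟩, by simp⟩
      · rw [← hm.lt_iff_lt]; simpa using ht.1
      · rw [← hm.lt_iff_lt]; simpa using ht.2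
  refine ⟨C, a', b', G.1 x a', G.1 x b', f, ⟨x, hxC, s, ⟨ha's, hsb'⟩, rfl⟩,
    isDyadicChart_of_lt_one hC ha' hb' (by linarith) (by linarith),
    isDyadicChart_of_lt_one hC ((hG.isDyadic_iff x).2 ha') ((hG.isDyadic_iff x).2 hb')
      (hm (by linarith)) (by linarith), hsrc, ?_, hPL.mono hsub, fun x' hx' t ht => ?_⟩
  · rw [← f.image_source_eq_target, hsrc]
    exact him
  · rw [descend_mk, hU x' (hCU hx') t (hsub ht)]
    rfl

end Lift

/-! ### Homeomorphisms of the suspension preserving a transversal -/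

/-- The family that is `f` on `D` and trivial elsewhere, as a homomorphism in `f`. -/
noncomputable def indicatorHom {X : Type*} (D : Set X) : (ℝ ≃ₜ ℝ) →* (X → ℝ ≃ₜ ℝ) :=
  (Set.mulIndicatorHom (ℝ ≃ₜ ℝ) D).comp (Pi.constMonoidHom X (ℝ ≃ₜ ℝ))

theorem indicatorHom_of_mem {X : Type*} {D : Set X} {x : X} (hx : x ∈ D) (f : ℝ ≃ₜ ℝ) :
    indicatorHom D f x = f := Set.mulIndicator_of_mem hx _

theorem indicatorHom_of_notMem {X : Type*} {D : Set X} {x : X} (hx : x ∉ D) (f : ℝ ≃ₜ ℝ) :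
    indicatorHom D f x = 1 := Set.mulIndicator_of_notMem hx _

theorem indicatorHom_mem {X : Type*} {D : Set X} {J : Set ℝ} {f : ℝ ≃ₜ ℝ}
    (hf : f ∈ dyadicPLGroup J) (x : X) :
    indicatorHom D f x ∈ dyadicPLGroup J := by
  by_cases hx : x ∈ D
  · rwa [indicatorHom_of_mem hx]
  · rw [indicatorHom_of_notMem hx]; exact one_mem _

section Transversal

variable {X : Type*} [TopologicalSpace X] {φ : X ≃ₜ X}

theorem exists_rep_Ico (φ : X ≃ₜ X) (a : ℝ) (y : Suspension φ) :
    ∃ x, ∃ t ∈ Ico a (a + 1), y = Suspension.mk φ x t := by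
  obtain ⟨x, t, rfl⟩ := Suspension.exists_rep φ y
  refine ⟨(φ ^ ⌊t - a⌋ : X ≃ₜ X) x, t - ⌊t - a⌋, ⟨?_, ?_⟩, (Suspension.mk_shift φ _ x t).symm⟩
  · linarith [Int.floor_le (t - a)]
  · linarith [Int.lt_floor_add_one (t - a)]

/-- The homeomorphism `g` acts on the segment `{x} × [a, a + 1]` by `F x`. -/
def ActsBy (φ : X ≃ₜ X) (a : ℝ) (F : X → ℝ ≃ₜ ℝ) (g : Suspension φ ≃ₜ Suspension φ) : Prop :=
  ∀ x, ∀ t ∈ Icc a (a + 1), g (Suspension.mk φ x t) = Suspension.mk φ x (F x t)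

theorem ActsBy.unique {a : ℝ} {F : X → ℝ ≃ₜ ℝ} {g g' : Suspension φ ≃ₜ Suspension φ}
    (h : ActsBy φ a F g) (h' : ActsBy φ a F g') : g = g' := by
  refine Homeomorph.ext fun y => ?_
  obtain ⟨x, t, ht, rfl⟩ := exists_rep_Ico φ a y
  rw [h x t (Ico_subset_Icc_self ht), h' x t (Ico_subset_Icc_self ht)]

theorem apply_mem_Icc {a b : ℝ} {f : ℝ ≃ₜ ℝ} (hf : f ∈ dyadicPLGroup (Ioo a b)) {t : ℝ}
    (ht : t ∈ Icc a b) : f t ∈ Icc a b := by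
  have h1 := (strictMono_of_mem hf).monotone ht.1
  have h2 := (strictMono_of_mem hf).monotone ht.2
  rw [hf.2 a (by simp)] at h1
  rw [hf.2 b (by simp)] at h2
  exact ⟨h1, h2⟩

theorem exists_shift {a b : ℝ} {f : ℝ ≃ₜ ℝ} (hf : f ∈ dyadicPLGroup (Ioo a b)) (n : ℤ) :
    ∃ f' ∈ dyadicPLGroup (Ioo (a + n) (b + n)), ∀ t, f' t = f (t - n) + n := by
  obtain ⟨h, hh, hn⟩ := affine_mem 0 (IsDyadic.int n)
  simp only [zpow_zero, one_mul] at hn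
  refine ⟨h * f * h⁻¹, ?_, fun t => ?_⟩
  · rw [← hn, ← hn]; exact conj_mem hh hf
  · change h (f (h.symm t)) = _
    rw [hn, show h.symm t = t - n by rw [Homeomorph.symm_apply_eq, hn]; ring]

/-- A locally constant family of elements of `F_(a, a + 1)` extends to an equivariant family. -/
theorem exists_extension {a : ℝ} (ha : IsDyadic a) {F : X → ℝ ≃ₜ ℝ} (hF : IsLocallyConstant F)
    (hFm : ∀ x, F x ∈ dyadicPLGroup (Ioo a (a + 1))) :
    ∃ G : liftGroup φ, IsLocallyPL G.1 ∧ ∀ x, ∀ t ∈ Icc a (a + 1), G.1 x t = F x t := by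
  -- Equivariance dictates the value on each translate `[a + n, a + n + 1)`.
  let E : X → ℝ → ℝ := fun x t => F ((φ ^ ⌊t - a⌋ : X ≃ₜ X) x) (t - ⌊t - a⌋) + ⌊t - a⌋
  have hm : ∀ x, StrictMono (F x) := fun x => strictMono_of_mem (hFm x)
  have hFa : ∀ x, F x a = a := fun x => (hFm x).2 a (by simp)
  have hFa' : ∀ x, F x (a + 1) = a + 1 := fun x => (hFm x).2 (a + 1) (by simp)
  have hE' : ∀ x t (n : ℤ), a + n ≤ t → t < a + n + 1 →
      E x t = F ((φ ^ n : X ≃ₜ X) x) (t - n) + n := by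
    intro x t n h1 h2
    have : ⌊t - a⌋ = n := by rw [Int.floor_eq_iff]; constructor <;> linarith
    simp only [E, this]
  -- The formula also holds at the right endpoint because every `F x` fixes `a` and `a + 1`; this
  -- makes neighbouring pieces match.
  have hE : ∀ x t (n : ℤ), a + n ≤ t → t ≤ a + n + 1 →
      E x t = F ((φ ^ n : X ≃ₜ X) x) (t - n) + n := by
    intro x t n h1 h2
    rcases h2.eq_or_lt with rfl | h2
    · rw [hE' x _ (n + 1) (by push_cast; linarith) (by push_cast; linarith)]
      push_cast
      rw [show a + n + 1 - (n + 1 : ℝ) = a by ring, show a + n + 1 - (n : ℝ) = a + 1 by ring, hFa,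
        hFa']
      ring
    · exact hE' x t n h1 h2
  have hmem : ∀ t, a + ⌊t - a⌋ ≤ t ∧ t < a + ⌊t - a⌋ + 1 := fun t =>
    ⟨by linarith [Int.floor_le (t - a)], by linarith [Int.lt_floor_add_one (t - a)]⟩
  have hmono : ∀ x, StrictMono (E x) := by
    intro x s t hst
    obtain ⟨s1, s2⟩ := hmem s
    obtain ⟨t1, t2⟩ := hmem t
    have hle : ⌊s - a⌋ ≤ ⌊t - a⌋ := Int.floor_mono (by linarith)
    rw [hE' x s _ s1 s2, hE' x t _ t1 t2]
    rcases hle.eq_or_lt with h | h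
    · rw [h]
      have := hm ((φ ^ ⌊t - a⌋ : X ≃ₜ X) x) (show s - ⌊t - a⌋ < t - ⌊t - a⌋ by linarith)
      linarith
    · have h1 := hm ((φ ^ ⌊s - a⌋ : X ≃ₜ X) x) (show s - ⌊s - a⌋ < a + 1 by linarith)
      have h2 := (hm ((φ ^ ⌊t - a⌋ : X ≃ₜ X) x)).monotone (show a ≤ t - ⌊t - a⌋ by linarith)
      rw [hFa'] at h1
      rw [hFa] at h2
      have h3 : ((⌊s - a⌋ + 1 : ℤ) : ℝ) ≤ (⌊t - a⌋ : ℤ) := by exact_mod_cast h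
      push_cast at h3
      linarith
  have hsurj : ∀ x, Function.Surjective (E x) := by
    intro x y
    obtain ⟨y1, y2⟩ := hmem y
    set n := ⌊y - a⌋
    set f := F ((φ ^ n : X ≃ₜ X) x) with hf
    have hfm := hm ((φ ^ n : X ≃ₜ X) x)
    have h1 : a ≤ f.symm (y - n) := by
      rw [← hfm.le_iff_le, ← hf, f.apply_symm_apply, hf, hFa]; linarith
    have h2 : f.symm (y - n) < a + 1 := by
      rw [← hfm.lt_iff_lt, ← hf, f.apply_symm_apply, hf, hFa']; linarith
    refine ⟨f.symm (y - n) + n, ?_⟩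
    rw [hE' x _ n (by linarith) (by linarith), ← hf]
    simp
  have hloc : ∀ x s, ∃ b c, b < s ∧ s < c ∧ (∀ᶠ x' in 𝓝 x, ∀ t ∈ Ioo b c, E x' t = E x t) ∧
      IsDyadicPLOn (E x) (Ioo b c) := by
    intro x s
    obtain ⟨s1, s2⟩ := hmem s
    set n := ⌊s - a⌋
    have hcases : ∀ x t, t ∈ Ioo (a + n - 1) (a + n + 1) →
        (t ≤ a + n ∧ E x t = F ((φ ^ (n - 1) : X ≃ₜ X) x) (t - (n - 1 : ℤ)) + (n - 1 : ℤ)) ∨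
        (a + n ≤ t ∧ E x t = F ((φ ^ n : X ≃ₜ X) x) (t - n) + n) := by
      intro x t ht
      rcases le_total t (a + n) with h | h
      · refine .inl ⟨h, hE x t _ ?_ ?_⟩ <;> push_cast <;> linarith [ht.1]
      · exact .inr ⟨h, hE x t n h ht.2.le⟩
    -- This neighbourhood of `s` contains the single seam `a + n`, where two translated maps are
    -- glued.
    refine ⟨a + n - 1, a + n + 1, by linarith, s2, ?_, ?_⟩
    · have h1 := (hF.comp_continuous (φ ^ n : X ≃ₜ X).continuous).eventually_eq x
      have h2 := (hF.comp_continuous (φ ^ (n - 1) : X ≃ₜ X).continuous).eventually_eq x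
      filter_upwards [h1, h2] with x' h1 h2 t ht
      simp only [Function.comp_apply] at h1 h2
      rcases le_total t (a + n) with h | h
      · rw [hE x' t (n - 1) (by push_cast; linarith [ht.1]) (by push_cast; linarith),
          hE x t (n - 1) (by push_cast; linarith [ht.1]) (by push_cast; linarith), h2]
      · rw [hE x' t n h ht.2.le, hE x t n h ht.2.le, h1]
    · obtain ⟨f, hf, hf'⟩ := exists_shift (hFm ((φ ^ (n - 1) : X ≃ₜ X) x)) (n - 1)
      obtain ⟨k, hk, hk'⟩ := exists_shift (hFm ((φ ^ n : X ≃ₜ X) x)) n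
      obtain ⟨g, hg, g1, g2⟩ := exists_glue (dyadicPLGroup_mono (subset_univ _) hf)
        (dyadicPLGroup_mono (subset_univ _) hk) (ha.add (.int n)) (by
          rw [hf', hk']
          push_cast
          rw [show a + n - (n - 1 : ℝ) = a + 1 by ring, show a + n - (n : ℝ) = a by ring, hFa, hFa']
          ring)
      refine (hg.1.mono (subset_univ _)).congr fun t ht => ?_
      rcases hcases x t ht with ⟨h, h'⟩ | ⟨h, h'⟩
      · rw [g1 t h, hf', h']
      · rw [g2 t h, hk', h']
  have hcont : Continuous fun p : X × ℝ => E p.1 p.2 := by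
    refine continuous_iff_continuousAt.2 fun ⟨x, s⟩ => ?_
    obtain ⟨b, c, hb, hc, h, -⟩ := hloc x s
    obtain ⟨g, hg⟩ := exists_homeomorph_of_strictMono (hmono x) (hsurj x)
    have h1 : ContinuousAt (fun p : X × ℝ => g p.2) (x, s) :=
      (g.continuous.comp continuous_snd).continuousAt
    refine h1.congr ?_
    rw [nhds_prod_eq]
    filter_upwards [h.prod_mk (Ioo_mem_nhds hb hc)] with p hp
    rw [hg, hp.1 p.2 hp.2]
  have heq : ∀ x t, E (φ x) (t - 1) = E x t - 1 := by
    intro x t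
    obtain ⟨t1, t2⟩ := hmem t
    set n := ⌊t - a⌋
    rw [hE' x t n t1 t2, hE' (φ x) (t - 1) (n - 1) (by push_cast; linarith)
      (by push_cast; linarith)]
    have h1 : (φ ^ (n - 1) : X ≃ₜ X) (φ x) = (φ ^ n : X ≃ₜ X) x := by
      have := iter_add φ (n - 1) 1 x
      rw [sub_add_cancel, zpow_one] at this
      exact this.symm
    rw [h1]
    push_cast
    rw [sub_sub_sub_cancel_right]
    ring
  obtain ⟨G, hG⟩ := exists_homeomorph_family hmono hsurj hcont heq
  refine ⟨G, fun x s => ?_, fun x t ht => ?_⟩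
  · obtain ⟨b, c, hb, hc, h1, h2⟩ := hloc x s
    exact ⟨b, c, hb, hc, by simpa only [hG] using h1, h2.congr fun t _ => (hG x t).symm⟩
  · rw [hG, hE x t 0 (by simpa using ht.1) (by simpa using ht.2)]
    simp

theorem exists_actsBy [CompactSpace X] [T2Space X] [TotallyDisconnectedSpace X] {a : ℝ}
    (ha : IsDyadic a) {F : X → ℝ ≃ₜ ℝ} (hF : IsLocallyConstant F)
    (hFm : ∀ x, F x ∈ dyadicPLGroup (Ioo a (a + 1))) : ∃ g ∈ groupT φ, ActsBy φ a F g := by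
  obtain ⟨G, hG, h⟩ := exists_extension (φ := φ) ha hF hFm
  exact ⟨descend φ G, descend_mem_of_isLocallyPL hG, fun x t ht => by rw [descend_mk, h x t ht]⟩

/-- The families of elements of `F_(a, a + 1)` by which the elements of `H` act. -/
def fibreSubgroup (H : Subgroup (Suspension φ ≃ₜ Suspension φ)) (a : ℝ) :
    Subgroup (X → ℝ ≃ₜ ℝ) where
  carrier := {F | (∀ x, F x ∈ dyadicPLGroup (Ioo a (a + 1))) ∧ ∃ g ∈ H, ActsBy φ a F g}
  one_mem' := ⟨fun _ => one_mem _, 1, one_mem _, fun _ _ _ => rfl⟩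
  mul_mem' := by
    rintro F F' ⟨hF, g, hg, h⟩ ⟨hF', g', hg', h'⟩
    refine ⟨fun x => mul_mem (hF x) (hF' x), g * g', mul_mem hg hg', fun x t ht => ?_⟩
    change g (g' _) = _
    rw [h' x t ht, h x _ (apply_mem_Icc (hF' x) ht)]
    rfl
  inv_mem' := by
    rintro F ⟨hF, g, hg, h⟩
    refine ⟨fun x => inv_mem (hF x), g⁻¹, inv_mem hg, fun x t ht => ?_⟩
    change g.symm _ = Suspension.mk φ x ((F x).symm t)
    have ht' : (F x).symm t ∈ Icc a (a + 1) := apply_mem_Icc (inv_mem (hF x)) ht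
    rw [Homeomorph.symm_apply_eq, h x _ ht', (F x).apply_symm_apply]

theorem isLocallyConstant_indicatorHom {D : Set X} (hD : IsClopen D) (f : ℝ ≃ₜ ℝ) :
    IsLocallyConstant (indicatorHom D f) := by
  rw [IsLocallyConstant.iff_eventually_eq]
  intro x
  by_cases hx : x ∈ D
  · filter_upwards [hD.isOpen.mem_nhds hx] with y hy
    rw [indicatorHom_of_mem hx, indicatorHom_of_mem hy]
  · filter_upwards [hD.compl.isOpen.mem_nhds hx] with y hy
    rw [indicatorHom_of_notMem hx, indicatorHom_of_notMem hy]

theorem eq_of_mk_eq {a : ℝ} {x x' : X} {t t' : ℝ} (ht : t ∈ Icc a (a + 1))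
    (ht' : t' ∈ Ioo a (a + 1)) (h : Suspension.mk φ x t = Suspension.mk φ x' t') :
    x' = x ∧ t' = t := by
  obtain ⟨n, rfl, rfl⟩ := (Suspension.mk_eq φ).1 h
  have h1 : (-1 : ℝ) < n := by linarith [ht.1, ht'.2]
  have h2 : (n : ℝ) < 1 := by linarith [ht.2, ht'.1]
  have h1' : (-1 : ℤ) < n := by exact_mod_cast h1
  have h2' : n < (1 : ℤ) := by exact_mod_cast h2
  obtain rfl : n = 0 := by omega
  simp

/-- Because `J` lies within one period, `D × J` embeds in the suspension. Identities between
transports can then be checked fibre by fibre, for families indexed by `X`. -/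
theorem isTransport_iff {a : ℝ} {D : Set X} {J : Set ℝ} {f : ℝ ≃ₜ ℝ}
    {g : Suspension φ ≃ₜ Suspension φ} (hJ : J ⊆ Ioo a (a + 1)) (hf : f ∈ dyadicPLGroup J) :
    IsTransport φ D J f g ↔ ActsBy φ a (indicatorHom D f) g := by
  constructor
  · rintro ⟨h1, h2⟩ x t ht
    by_cases hx : x ∈ D ∧ t ∈ J
    · rw [h1 x hx.1 t hx.2, indicatorHom_of_mem hx.1]
    · have h3 : indicatorHom D f x t = t := by
        by_cases hxD : x ∈ D
        · rw [indicatorHom_of_mem hxD]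
          exact hf.2 t fun h => hx ⟨hxD, h⟩
        · rw [indicatorHom_of_notMem hxD]; rfl
      rw [h3]
      refine h2 _ ?_
      rintro ⟨x', hx', t', ht', h⟩
      obtain ⟨rfl, rfl⟩ := eq_of_mk_eq ht (hJ ht') h
      exact hx ⟨hx', ht'⟩
  · intro h
    refine ⟨fun x hx t ht => ?_, fun y hy => ?_⟩
    · rw [h x t (Ioo_subset_Icc_self (hJ ht)), indicatorHom_of_mem hx]
    · obtain ⟨x, t, ht, rfl⟩ := exists_rep_Ico φ a y
      rw [h x t (Ico_subset_Icc_self ht)]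
      by_cases hxD : x ∈ D
      · rw [indicatorHom_of_mem hxD, hf.2 t]
        exact fun h' => hy ⟨x, hxD, t, h', rfl⟩
      · rw [indicatorHom_of_notMem hxD]; rfl

/-- The group `H` contains all transports of elements of `F_J` to `D × J`. -/
def ContainsTransports (H : Subgroup (Suspension φ ≃ₜ Suspension φ)) (D : Set X) (J : Set ℝ) :
    Prop :=
  ∀ f ∈ dyadicPLGroup J, ∀ g, IsTransport φ D J f g → g ∈ H

theorem ContainsTransports.empty (H : Subgroup (Suspension φ ≃ₜ Suspension φ)) (J : Set ℝ) :
    ContainsTransports H ∅ J := by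
  intro f _ g hg
  have : g = 1 := Homeomorph.ext fun y => hg.2 y (by rintro ⟨x, hx, -⟩; exact hx)
  rw [this]; exact one_mem _

/-- Since `[x, t] = [φ ^ n x, t - n]`, the two charts have the same domain. -/
theorem ContainsTransports.shift {H : Subgroup (Suspension φ ≃ₜ Suspension φ)} {D : Set X}
    {u v : ℝ} (h : ContainsTransports H D (Ioo u v)) (n : ℤ) :
    ContainsTransports H ((φ ^ n : X ≃ₜ X) ⁻¹' D) (Ioo (u + n) (v + n)) := by
  intro f hf g hg
  obtain ⟨f', hf', hff'⟩ := exists_shift hf (-n)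
  push_cast at hf' hff'
  simp only [add_neg_cancel_right, sub_neg_eq_add] at hf' hff'
  have hmk : ∀ x t, Suspension.mk φ x t = Suspension.mk φ ((φ ^ (-n) : X ≃ₜ X) x) (t + n) := by
    intro x t
    have := Suspension.mk_shift φ (-n) x t
    push_cast at this
    rw [← this, sub_neg_eq_add]
  refine h f' hf' g ⟨fun x hx t ht => ?_, fun y hy => hg.2 y ?_⟩
  · rw [hmk x t, hg.1, hff', hmk x]
    · congr 1; ring
    · change (φ ^ n : X ≃ₜ X) ((φ ^ (-n) : X ≃ₜ X) x) ∈ D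
      rw [← iter_add]
      simpa using hx
    · exact ⟨by linarith [ht.1], by linarith [ht.2]⟩
  · rintro ⟨x, hx, t, ht, rfl⟩
    exact hy ⟨_, hx, t - n, ⟨by linarith [ht.1], by linarith [ht.2]⟩,
      (Suspension.mk_shift φ n x t).symm⟩

variable [CompactSpace X] [T2Space X] [TotallyDisconnectedSpace X]

theorem IsTransport.mem_groupT {a : ℝ} {D : Set X} {J : Set ℝ} {f : ℝ ≃ₜ ℝ}
    {g : Suspension φ ≃ₜ Suspension φ} (ha : IsDyadic a) (hD : IsClopen D)
    (hJ : J ⊆ Ioo a (a + 1)) (hf : f ∈ dyadicPLGroup J) (h : IsTransport φ D J f g) :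
    g ∈ groupT φ := by
  obtain ⟨g', hg', h'⟩ := exists_actsBy (φ := φ) ha (isLocallyConstant_indicatorHom hD f)
    fun x => dyadicPLGroup_mono hJ (indicatorHom_mem hf x)
  rwa [((isTransport_iff hJ hf).1 h).unique h']

/-- Transports exist and are unique, so the condition is an inclusion of subgroups, to which results
on generation and commutators in `dyadicPLGroup` apply directly. -/
theorem containsTransports_iff {H : Subgroup (Suspension φ ≃ₜ Suspension φ)} {a : ℝ} {D : Set X}
    {J : Set ℝ} (ha : IsDyadic a) (hD : IsClopen D) (hJ : J ⊆ Ioo a (a + 1)) :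
    ContainsTransports H D J ↔
      dyadicPLGroup J ≤ (fibreSubgroup H a).comap (indicatorHom D) := by
  constructor
  · intro h f hf
    have hm : ∀ x, indicatorHom D f x ∈ dyadicPLGroup (Ioo a (a + 1)) :=
      fun x => dyadicPLGroup_mono hJ (indicatorHom_mem hf x)
    obtain ⟨g, -, hg⟩ := exists_actsBy (φ := φ) ha (isLocallyConstant_indicatorHom hD f) hm
    exact ⟨hm, g, h f hf g ((isTransport_iff hJ hf).2 hg), hg⟩
  · intro h f hf g hg
    obtain ⟨-, g', hg', h'⟩ := h hf
    rwa [((isTransport_iff hJ hf).1 hg).unique h']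

end Transversal

/-! ### Enlarging the set of charts whose local groups lie in a subgroup -/

/-- Compactness is used twice: finitely many separating sets cut a point of `D` off from the
complement, and finitely many of the resulting neighbourhoods cover `D`. -/
theorem isClopen_induction {X : Type*} [TopologicalSpace X] [CompactSpace X] {P : Set X → Prop}
    (hP : ∀ D, P D → IsClopen D) (huniv : P univ) (hinter : ∀ D D', P D → P D' → P (D ∩ D'))
    (hcompl : ∀ D, P D → P Dᶜ) (hsep : ∀ x y, x ≠ y → ∃ A, P A ∧ x ∈ A ∧ y ∉ A) {D : Set X}
    (hD : IsClopen D) : P D := by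
  have hnhds : ∀ x ∈ D, ∃ A, P A ∧ x ∈ A ∧ Disjoint A Dᶜ := by
    intro x hx
    refine hD.compl.isClosed.isCompact.induction_on (p := fun s => ∃ A, P A ∧ x ∈ A ∧ Disjoint A s)
      ⟨univ, huniv, mem_univ x, disjoint_empty _⟩ ?_ ?_ ?_
    · rintro s t hst ⟨A, hA, hxA, h⟩
      exact ⟨A, hA, hxA, h.mono_right hst⟩
    · rintro s t ⟨A, hA, hxA, h⟩ ⟨B, hB, hxB, h'⟩
      exact ⟨A ∩ B, hinter A B hA hB, ⟨hxA, hxB⟩,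
        disjoint_union_right.2 ⟨h.mono_left inter_subset_left, h'.mono_left inter_subset_right⟩⟩
    · intro y hy
      obtain ⟨A, hA, hxA, hyA⟩ := hsep x y (by rintro rfl; exact hy hx)
      exact ⟨Aᶜ, mem_nhdsWithin_of_mem_nhds ((hP A hA).compl.isOpen.mem_nhds hyA), A, hA, hxA,
        disjoint_compl_right⟩
  obtain ⟨B, hB, hDB, hBD⟩ := hD.isClosed.isCompact.induction_on
    (p := fun s => ∃ B, P B ∧ s ⊆ B ∧ B ⊆ D)
    ⟨∅, by simpa using hcompl _ huniv, subset_rfl, empty_subset _⟩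
    (by
      rintro s t hst ⟨A, hA, h, h'⟩
      exact ⟨A, hA, hst.trans h, h'⟩)
    (by
      rintro s t ⟨A, hA, h1, h2⟩ ⟨B, hB, h3, h4⟩
      refine ⟨A ∪ B, ?_, union_subset_union h1 h3, union_subset h2 h4⟩
      rw [← compl_compl (A ∪ B), compl_union]
      exact hcompl _ (hinter _ _ (hcompl _ hA) (hcompl _ hB)))
    (fun x hx => by
      obtain ⟨A, hA, hxA, h⟩ := hnhds x hx
      exact ⟨A, mem_nhdsWithin_of_mem_nhds ((hP A hA).isOpen.mem_nhds hxA), A, hA, subset_rfl,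
        disjoint_compl_right_iff_subset.1 h⟩)
  rwa [hDB.antisymm hBD]

section Enlarge

variable {X : Type*} [TopologicalSpace X] [CompactSpace X] [T2Space X] [TotallyDisconnectedSpace X]
  {φ : X ≃ₜ X} {H : Subgroup (Suspension φ ≃ₜ Suspension φ)}

theorem ContainsTransports.mono {D : Set X} {u v u' v' : ℝ}
    (h : ContainsTransports H D (Ioo u v)) (hD : IsClopen D) (hu : IsDyadic u) (hv : v ≤ u + 1)
    (huu' : u ≤ u') (hv'v : v' ≤ v) : ContainsTransports H D (Ioo u' v') := by
  rw [containsTransports_iff hu hD (Ioo_subset_Ioo_right hv)] at h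
  rw [containsTransports_iff hu hD ((Ioo_subset_Ioo huu' hv'v).trans (Ioo_subset_Ioo_right hv))]
  exact (dyadicPLGroup_mono (Ioo_subset_Ioo huu' hv'v)).trans h

/-- The commutator of a family supported on `D` with one supported on `D'` is trivial outside `D ∩
D'`. Shrinking the interval strictly at both ends places its group in the commutator subgroup. -/
theorem ContainsTransports.inter {D D' : Set X} {u v u' v' : ℝ}
    (h : ContainsTransports H D (Ioo u v)) (h' : ContainsTransports H D' (Ioo u v))
    (hD : IsClopen D) (hD' : IsClopen D') (hu : IsDyadic u) (hv : IsDyadic v) (huv : u < v)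
    (hvu : v ≤ u + 1) (huu' : u < u') (hv'v : v' < v) :
    ContainsTransports H (D ∩ D') (Ioo u' v') := by
  have hJ : Ioo u v ⊆ Ioo u (u + 1) := Ioo_subset_Ioo_right hvu
  rw [containsTransports_iff hu hD hJ] at h
  rw [containsTransports_iff hu hD' hJ] at h'
  rw [containsTransports_iff hu (hD.inter hD') ((Ioo_subset_Ioo huu'.le hv'v.le).trans hJ)]
  refine (dyadicPLGroup_le_commutator hu hv huv huu' hv'v).trans (Subgroup.commutator_le.2 ?_)
  intro f hf f' hf'
  have : indicatorHom (D ∩ D') (f * f' * f⁻¹ * f'⁻¹) = indicatorHom D f * indicatorHom D' f' *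
      (indicatorHom D f)⁻¹ * (indicatorHom D' f')⁻¹ := by
    funext x
    simp only [Pi.mul_apply, Pi.inv_apply]
    by_cases hx : x ∈ D
    · by_cases hx' : x ∈ D'
      · rw [indicatorHom_of_mem (D := D ∩ D') ⟨hx, hx'⟩, indicatorHom_of_mem hx,
          indicatorHom_of_mem hx']
      · rw [indicatorHom_of_notMem (D := D ∩ D') fun h => hx' h.2,
          indicatorHom_of_notMem hx']; group
    · rw [indicatorHom_of_notMem (D := D ∩ D') fun h => hx h.1, indicatorHom_of_notMem hx]; group
  change indicatorHom (D ∩ D') (f * f' * f⁻¹ * f'⁻¹) ∈ fibreSubgroup H u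
  rw [this]
  exact mul_mem (mul_mem (mul_mem (h hf) (h' hf')) (inv_mem (h hf))) (inv_mem (h' hf'))

theorem ContainsTransports.compl {D : Set X} {u v : ℝ} (hX : ContainsTransports H univ (Ioo u v))
    (h : ContainsTransports H D (Ioo u v)) (hD : IsClopen D) (hu : IsDyadic u)
    (hvu : v ≤ u + 1) : ContainsTransports H Dᶜ (Ioo u v) := by
  have hJ : Ioo u v ⊆ Ioo u (u + 1) := Ioo_subset_Ioo_right hvu
  rw [containsTransports_iff hu hD hJ] at h
  rw [containsTransports_iff hu isClopen_univ hJ] at hX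
  rw [containsTransports_iff hu hD.compl hJ]
  intro f hf
  have : indicatorHom Dᶜ f = indicatorHom univ f * (indicatorHom D f)⁻¹ := by
    funext x
    rw [Pi.mul_apply, Pi.inv_apply, indicatorHom_of_mem (mem_univ x)]
    by_cases hx : x ∈ D
    · rw [indicatorHom_of_notMem (by simpa using hx), indicatorHom_of_mem hx]; group
    · rw [indicatorHom_of_mem (by simpa using hx), indicatorHom_of_notMem hx]; group
  rw [Subgroup.mem_comap, this]
  exact mul_mem (hX hf) (inv_mem (h hf))

theorem ContainsTransports.union {D D' : Set X} {u v : ℝ}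
    (h : ContainsTransports H D (Ioo u v)) (h' : ContainsTransports H D' (Ioo u v))
    (hD : IsClopen D) (hD' : IsClopen D') (hdisj : Disjoint D D') (hu : IsDyadic u)
    (hvu : v ≤ u + 1) : ContainsTransports H (D ∪ D') (Ioo u v) := by
  have hJ : Ioo u v ⊆ Ioo u (u + 1) := Ioo_subset_Ioo_right hvu
  rw [containsTransports_iff hu hD hJ] at h
  rw [containsTransports_iff hu hD' hJ] at h'
  rw [containsTransports_iff hu (hD.union hD') hJ]
  intro f hf
  have : indicatorHom (D ∪ D') f = indicatorHom D f * indicatorHom D' f := by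
    funext x
    rw [Pi.mul_apply]
    by_cases hx : x ∈ D
    · rw [indicatorHom_of_mem (.inl hx), indicatorHom_of_mem hx,
        indicatorHom_of_notMem (disjoint_left.1 hdisj hx), mul_one]
    · by_cases hx' : x ∈ D'
      · rw [indicatorHom_of_mem (.inr hx'), indicatorHom_of_mem hx', indicatorHom_of_notMem hx,
          one_mul]
      · rw [indicatorHom_of_notMem (by simp [hx, hx']), indicatorHom_of_notMem hx,
          indicatorHom_of_notMem hx', one_mul]
  rw [Subgroup.mem_comap, this]
  exact mul_mem (h hf) (h' hf)

theorem ContainsTransports.sup {D : Set X} {a b b' c : ℝ}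
    (h : ContainsTransports H D (Ioo a b')) (h' : ContainsTransports H D (Ioo b c))
    (hD : IsClopen D) (ha : IsDyadic a) (hb : IsDyadic b) (hb' : IsDyadic b') (hc : IsDyadic c)
    (hab : a ≤ b) (hbb' : b < b') (hb'c : b' ≤ c) (hca : c ≤ a + 1) :
    ContainsTransports H D (Ioo a c) := by
  rw [containsTransports_iff ha hD (Ioo_subset_Ioo_right (hb'c.trans hca))] at h
  rw [containsTransports_iff ha hD (Ioo_subset_Ioo hab hca)] at h'
  rw [containsTransports_iff ha hD (Ioo_subset_Ioo_right hca)]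
  exact (dyadicPLGroup_le_sup ha hb hb' hc hab hbb' hb'c).trans (sup_le h h')

/-- Conjugation by a transport to `X × (u, v)` of a map taking `(p', q')` to `(p, q)`; it acts on
all fibres alike and so preserves `D`. -/
theorem ContainsTransports.move {D : Set X} {u v p q p' q' : ℝ}
    (h : ContainsTransports H D (Ioo p q)) (hX : ContainsTransports H univ (Ioo u v))
    (hD : IsClopen D) (hu : IsDyadic u) (hv : IsDyadic v)
    (hp : IsDyadic p) (hq : IsDyadic q) (hp' : IsDyadic p') (hq' : IsDyadic q') (hup : u < p)
    (hpq : p < q) (hqv : q < v) (hup' : u < p') (hpq' : p' < q') (hqv' : q' < v)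
    (hvu : v ≤ u + 1) : ContainsTransports H D (Ioo p' q') := by
  have hJ : Ioo u v ⊆ Ioo u (u + 1) := Ioo_subset_Ioo_right hvu
  rw [containsTransports_iff hu hD ((Ioo_subset_Ioo hup.le hqv.le).trans hJ)] at h
  rw [containsTransports_iff hu isClopen_univ hJ] at hX
  rw [containsTransports_iff hu hD ((Ioo_subset_Ioo hup'.le hqv'.le).trans hJ)]
  intro f hf
  obtain ⟨k, hk, h1, h2⟩ := exists_mem_map_pair hu hv hp' hq' hp hq hup' hpq' hqv' hup hpq hqv
  have hf' := conj_mem (dyadicPLGroup_mono (subset_univ _) hk) hf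
  rw [h1, h2] at hf'
  have : indicatorHom D f
      = (indicatorHom univ k)⁻¹ * indicatorHom D (k * f * k⁻¹) * indicatorHom univ k := by
    funext x
    rw [Pi.mul_apply, Pi.mul_apply, Pi.inv_apply, indicatorHom_of_mem (mem_univ x)]
    by_cases hx : x ∈ D
    · rw [indicatorHom_of_mem hx, indicatorHom_of_mem hx]; group
    · rw [indicatorHom_of_notMem hx, indicatorHom_of_notMem hx]; group
  rw [Subgroup.mem_comap, this]
  exact mul_mem (mul_mem (inv_mem (hX hk)) (h hf')) (hX hk)

theorem isDyadic_div_pow (n : ℤ) (k : ℕ) : IsDyadic (n / 2 ^ k) := ⟨n, k, rfl⟩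

theorem isDyadic_div_sixteen (n : ℤ) : IsDyadic ((n : ℝ) / 16) := by
  have := isDyadic_div_pow n 4
  norm_num at this
  exact this

theorem containsTransports_univ_of_le (h₀ : ContainsTransports H univ I₀)
    (h₁ : ContainsTransports H univ I₁) {u v : ℝ} (hvu : v - u ≤ 1 / 4) :
    ContainsTransports H univ (Ioo u v) := by
  -- The translation brings the left endpoint into `[-1/4, 3/4)`. From there an interval of length
  -- at most 1/4 stays in `I₀` if it starts at or before 1/4, and in `I₁` otherwise.
  set n := ⌊u + 1 / 4⌋
  have h1 : (n : ℝ) ≤ u + 1 / 4 := Int.floor_le _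
  have h2 : u + 1 / 4 < n + 1 := Int.lt_floor_add_one _
  have key : ContainsTransports H univ (Ioo (u - n) (v - n)) := by
    rcases le_total (u - n) (1 / 4) with h | h
    · exact h₀.mono isClopen_univ (by convert isDyadic_div_sixteen (-4) using 1; norm_num)
        (by norm_num) (by linarith) (by linarith)
    · exact h₁.mono isClopen_univ (by convert isDyadic_div_sixteen 4 using 1; norm_num)
        (by norm_num) (by linarith) (by linarith)
  simpa using key.shift n

/-- The group `H` contains all transports to `D × J` for small dyadic intervals `J`. -/
def ContainsSmallTransports (H : Subgroup (Suspension φ ≃ₜ Suspension φ)) (D : Set X) : Prop :=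
  ∀ u v, IsDyadic u → IsDyadic v → u < v → v - u ≤ 1 / 8 → ContainsTransports H D (Ioo u v)

/-- One sixteenth is moved to the next inside windows of length 1/4. An interval of length at most
1/8 lies strictly inside such a window together with the sixteenth where it starts. -/
theorem containsSmallTransports_of_one {D : Set X} (hD : IsClopen D)
    (hX : ∀ u v, v - u ≤ 1 / 4 → ContainsTransports H univ (Ioo u v)) {j₀ : ℤ}
    (h : ContainsTransports H D (Ioo (j₀ / 16) ((j₀ + 1) / 16))) :
    ContainsSmallTransports H D := by
  have hd := isDyadic_div_sixteen
  have hall : ∀ j : ℤ, ContainsTransports H D (Ioo (j / 16) ((j + 1 : ℤ) / 16)) := by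
    intro j
    induction j using Int.inductionOn' (b := j₀) with
    | zero => simpa using h
    | succ j _ ih =>
      refine ih.move (hX ((j - 1 : ℤ) / 16) ((j + 3 : ℤ) / 16) ?_) hD (hd _) (hd _) (hd _) (hd _)
        (hd _) (hd _) ?_ ?_ ?_ ?_ ?_ ?_ ?_ <;> push_cast <;> linarith
    | pred j _ ih =>
      refine ih.move (hX ((j - 2 : ℤ) / 16) ((j + 2 : ℤ) / 16) ?_) hD (hd _) (hd _) (hd _) (hd _)
        (hd _) (hd _) ?_ ?_ ?_ ?_ ?_ ?_ ?_ <;> push_cast <;> linarith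
  intro u v hu hv huv hvu
  have h1 := Int.floor_le (16 * u)
  have h2 := Int.lt_floor_add_one (16 * u)
  refine (hall ⌊16 * u⌋).move (hX ((⌊16 * u⌋ - 1 : ℤ) / 16) ((⌊16 * u⌋ + 3 : ℤ) / 16) ?_) hD (hd _)
    (hd _) (hd _) (hd _) hu hv ?_ ?_ ?_ ?_ huv ?_ ?_ <;> push_cast <;> linarith

theorem containsSmallTransports_of_isClopen
    (hX : ∀ u v, v - u ≤ 1 / 4 → ContainsTransports H univ (Ioo u v)) {d : ℕ} {C : Fin d → Set X}
    (hC : IsGeneratingPartition φ C) (h : ∀ i, ContainsSmallTransports H (C i)) {D : Set X}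
    (hD : IsClopen D) : ContainsSmallTransports H D := by
  have d32 : ∀ n : ℤ, IsDyadic ((n : ℝ) / 32) := fun n => by
    have := isDyadic_div_pow n 5
    norm_num at this
    exact this
  refine (isClopen_induction (P := fun D => IsClopen D ∧ ContainsSmallTransports H D)
    (fun D h => h.1) ⟨isClopen_univ, fun u v _ _ _ h => hX u v (by linarith)⟩ ?_ ?_ ?_ hD).2
  · rintro D D' ⟨hD, h⟩ ⟨hD', h'⟩
    -- The commutator argument shrinks `(-1/32, 3/32)` to `(0, 1/16)`, but a single sixteenth
    -- recovers all short intervals.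
    refine ⟨hD.inter hD', containsSmallTransports_of_one (hD.inter hD') hX (j₀ := 0) ?_⟩
    refine (h _ _ (d32 (-1)) (d32 3) ?_ ?_).inter (h' _ _ (d32 (-1)) (d32 3) ?_ ?_) hD hD'
      (d32 (-1)) (d32 3) ?_ ?_ ?_ ?_ <;> norm_num
  · rintro D ⟨hD, h⟩
    exact ⟨hD.compl, fun u v hu hv huv hvu =>
      (hX u v (by linarith)).compl (h u v hu hv huv hvu) hD hu
      (by linarith)⟩
  · intro x y hxy
    obtain ⟨n, i, hx, hy⟩ := hC.separates x y hxy
    have himg : (φ ^ n : X ≃ₜ X) '' C i = (φ ^ (-n) : X ≃ₜ X) ⁻¹' C i := by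
      rw [zpow_neg]
      exact (φ ^ n : X ≃ₜ X).image_eq_preimage_symm (C i)
    rw [himg] at hx hy
    refine ⟨_, ⟨(hC.isClopen i).preimage (φ ^ (-n) : X ≃ₜ X).continuous, fun u v hu hv huv hvu => ?_⟩,
      hx, hy⟩
    -- The property is required for short intervals anywhere on the line, so an integer shift trades
    -- `C i` for its translate.
    have := (h i (u - (-n : ℤ)) (v - (-n : ℤ)) (hu.sub (.int _)) (hv.sub (.int _)) (by linarith)
      (by linarith)).shift (-n)
    simpa only [sub_add_cancel] using this

/-- The interval grows by 1/16 at a time: one of length 1/8 is attached with an overlap of 1/16.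
Length 1 is reached at `n = 14`. -/
theorem ContainsSmallTransports.containsTransports {D : Set X} (hD : IsClopen D)
    (h : ContainsSmallTransports H D) {u v : ℝ} (hu : IsDyadic u) (hv : IsDyadic v) (huv : u < v)
    (hvu : v ≤ u + 1) : ContainsTransports H D (Ioo u v) := by
  have key : ∀ n : ℕ, ∀ v, IsDyadic v → u < v → v ≤ u + 1 → v - u ≤ (n + 2) / 16 →
      ContainsTransports H D (Ioo u v) := by
    intro n
    induction n with
    | zero => exact fun v hv huv _ h' => h u v hu hv huv (by norm_num at h'; linarith)
    | succ n ih =>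
      intro v hv huv hvu hn
      rcases le_or_gt (v - u) (1 / 8) with h' | h'
      · exact h u v hu hv huv h'
      · have d1 : IsDyadic (v - (2 : ℤ) / 16) := hv.sub (isDyadic_div_sixteen 2)
        have d2 : IsDyadic (v - (1 : ℤ) / 16) := hv.sub (isDyadic_div_sixteen 1)
        push_cast at d1 d2 hn
        exact (ih _ d2 (by linarith) (by linarith) (by linarith)).sup
          (h _ v d1 hv (by linarith) (by linarith)) hD hu d1 d2 hv (by linarith) (by linarith)
          (by linarith) hvu
  exact key 14 v hv huv hvu (by norm_num; linarith)

theorem containsTransports_of_isGeneratingPartition (h₀ : ContainsTransports H univ I₀) {d : ℕ}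
    {C : Fin d → Set X} (hC : IsGeneratingPartition φ C)
    (h₁ : ∀ i, ContainsTransports H (C i) I₁) {D : Set X} (hD : IsClopen D) {u v : ℝ}
    (hu : IsDyadic u) (hv : IsDyadic v) (huv : u < v) (hvu : v ≤ u + 1) :
    ContainsTransports H D (Ioo u v) := by
  have hd : IsDyadic (1 / 4) := by convert isDyadic_div_sixteen 4 using 1; norm_num
  have hfin : ∀ s : Finset (Fin d), IsClopen (⋃ i ∈ s, C i) ∧
      ContainsTransports H (⋃ i ∈ s, C i) I₁ := by
    intro s
    induction s using Finset.induction_on with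
    | empty => simpa using And.intro isClopen_empty (ContainsTransports.empty H I₁)
    | insert i s hi ih =>
      rw [Finset.set_biUnion_insert]
      refine ⟨(hC.isClopen i).union ih.1, (h₁ i).union ih.2 (hC.isClopen i) ih.1 ?_ hd
        (by norm_num)⟩
      rw [disjoint_iUnion₂_right]
      exact fun j hj => hC.disjoint i j (by rintro rfl; exact hi hj)
  have hX₁ : ContainsTransports H univ I₁ := by
    have := (hfin Finset.univ).2
    simpa [hC.cover] using this
  have hX : ∀ u v, v - u ≤ 1 / 4 → ContainsTransports H univ (Ioo u v) :=
    fun u v h => containsTransports_univ_of_le h₀ hX₁ h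
  refine (containsSmallTransports_of_isClopen hX hC (fun i => ?_) hD).containsTransports hD hu hv
    huv hvu
  -- The sixteenth `(8/16, 9/16)` lies in `I₁`.
  exact containsSmallTransports_of_one (hC.isClopen i) hX (j₀ := 8)
    ((h₁ i).mono (hC.isClopen i) hd (by norm_num) (by norm_num) (by norm_num))

end Enlarge

/-! ### Fragmentation -/

/-- On a compact interval, a locally dyadic piecewise linear map has finitely many breakpoints. -/
theorem isDyadicPLOn_Icc {f : ℝ → ℝ} {u v : ℝ}
    (h : ∀ s ∈ Icc u v, ∃ a b, a < s ∧ s < b ∧ IsDyadicPLOn f (Ioo a b)) :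
    IsDyadicPLOn f (Icc u v) := by
  -- The inductive property concerns every `S` that merely meets `s`, which makes it stable under
  -- unions. Locally, dyadic points `a'` and `b'` are added to the breakpoints to confine such an
  -- `S` to `(a, b)`.
  obtain ⟨B, hB, hBd, hp⟩ := isCompact_Icc.induction_on (s := Icc u v)
    (p := fun s => ∃ B : Set ℝ, B.Finite ∧ (∀ r ∈ B, IsDyadic r) ∧
      ∀ S : Set ℝ, S.OrdConnected → Disjoint S B → (S ∩ s).Nonempty →
        ∃ (m : ℤ) (c : ℝ), IsDyadic c ∧ ∀ t ∈ S, f t = 2 ^ m * t + c)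
    ⟨∅, finite_empty, by simp, by simp⟩
    (by
      rintro s t hst ⟨B, hB, hBd, hp⟩
      exact ⟨B, hB, hBd, fun S hS hSB hne =>
        hp S hS hSB (hne.mono (inter_subset_inter_right S hst))⟩)
    (by
      rintro s t ⟨B, hB, hBd, hp⟩ ⟨B', hB', hBd', hp'⟩
      refine ⟨B ∪ B', hB.union hB', fun r hr => hr.elim (hBd r) (hBd' r), fun S hS hSB hne => ?_⟩
      rw [disjoint_union_right] at hSB
      rw [inter_union_distrib_left, union_nonempty] at hne
      exact hne.elim (hp S hS hSB.1) (hp' S hS hSB.2))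
    (fun s hs => by
      obtain ⟨a, b, ha, hb, B, hB, hBd, hp⟩ := h s hs
      obtain ⟨a', ha', haa', has⟩ := exists_dyadic_between ha
      obtain ⟨b', hb', hsb, hbb'⟩ := exists_dyadic_between hb
      refine ⟨Ioo a' b', mem_nhdsWithin_of_mem_nhds (Ioo_mem_nhds has hsb), insert a' (insert b' B),
        (hB.insert _).insert _, ?_, fun S hS hSB ⟨t, htS, ht⟩ => ?_⟩
      · rintro r (rfl | rfl | hr)
        exacts [ha', hb', hBd r hr]
      · rw [disjoint_insert_right, disjoint_insert_right] at hSB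
        refine hp S hS (fun r hr => ⟨?_, ?_⟩) hSB.2.2
        · by_contra hra
          exact hSB.1 (hS.out hr htS ⟨(not_lt.1 hra).trans haa'.le, ht.1.le⟩)
        · by_contra hrb
          exact hSB.2.1 (hS.out htS hr ⟨ht.2.le, hbb'.le.trans (not_lt.1 hrb)⟩))
  refine ⟨B, hB, hBd, fun S hS hSI hSB => ?_⟩
  rcases S.eq_empty_or_nonempty with rfl | hne
  · exact ⟨0, 0, by simpa using IsDyadic.int 0, by simp⟩
  · exact hp S hS hSB (by rwa [inter_eq_left.2 hSI])

/-- A homeomorphism fixing `0` and `1` can be cut off outside `[0, 1]`. -/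
theorem exists_cutoff {f : ℝ ≃ₜ ℝ} (hf : StrictMono f) (h0 : f 0 = 0) (h1 : f 1 = 1)
    (hPL : IsDyadicPLOn f (Icc 0 1)) :
    ∃ g ∈ dyadicPLGroup (Ioo 0 1), ∀ t ∈ Icc (0 : ℝ) 1, g t = f t := by
  have hmem : ∀ t, 0 ≤ t → t ≤ 1 → 0 ≤ f t ∧ f t ≤ 1 := fun t ht ht' =>
    ⟨h0 ▸ hf.monotone ht, h1 ▸ hf.monotone ht'⟩
  have hmono : StrictMono fun t => if 0 ≤ t ∧ t ≤ 1 then f t else t := by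
    intro s t hst
    have hs := hmem s
    have ht := hmem t
    have h := hf hst
    by_cases h2 : 0 ≤ s ∧ s ≤ 1
    · by_cases h3 : 0 ≤ t ∧ t ≤ 1
      · simpa only [h2, h3, and_self, if_true] using h
      · have : 1 < t := by
          by_contra h4; exact h3 ⟨by linarith [h2.1], not_lt.1 h4⟩
        simp only [h2, h3, and_self, if_true, if_false]
        linarith [(hs h2.1 h2.2).2]
    · by_cases h3 : 0 ≤ t ∧ t ≤ 1
      · have : s < 0 := by
          by_contra h4; exact h2 ⟨not_lt.1 h4, by linarith [h3.2]⟩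
        simp only [h2, h3, and_self, if_true, if_false]
        linarith [(ht h3.1 h3.2).1]
      · simpa only [h2, h3, if_false] using hst
  have hsurj : Function.Surjective fun t => if 0 ≤ t ∧ t ≤ 1 then f t else t := by
    intro y
    by_cases h : 0 ≤ y ∧ y ≤ 1
    · have h2 : 0 ≤ f.symm y := by rw [← hf.le_iff_le, h0]; simpa using h.1
      have h3 : f.symm y ≤ 1 := by rw [← hf.le_iff_le, h1]; simpa using h.2
      exact ⟨f.symm y, by simp [h2, h3]⟩
    · exact ⟨y, by simp only [h, if_false]⟩
  obtain ⟨g, hg⟩ := exists_homeomorph_of_strictMono hmono hsurj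
  have hgI : ∀ t ∈ Icc (0 : ℝ) 1, g t = f t := fun t ht => (hg t).trans (if_pos ht)
  refine ⟨g, ⟨?_, fun t ht => ?_⟩, hgI⟩
  · obtain ⟨B, hB, hBd, hp⟩ := hPL
    refine ⟨insert 0 (insert 1 B), (hB.insert _).insert _, ?_, fun S hS _ hSB => ?_⟩
    · rintro r (rfl | rfl | hr)
      exacts [by simpa using IsDyadic.int 0, by simpa using IsDyadic.int 1, hBd r hr]
    · rw [disjoint_insert_right, disjoint_insert_right] at hSB
      by_cases hS01 : S ⊆ Icc 0 1
      · obtain ⟨m, c, hc, hm⟩ := hp S hS hS01 hSB.2.2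
        exact ⟨m, c, hc, fun t ht => by rw [hgI t (hS01 ht), hm t ht]⟩
      · obtain ⟨s, hs, hs01⟩ := not_subset.1 hS01
        refine ⟨0, 0, by simpa using IsDyadic.int 0, fun t ht => ?_⟩
        have : ¬(0 ≤ t ∧ t ≤ 1) := by
          rintro ⟨h2, h3⟩
          rcases lt_or_ge s 0 with h4 | h4
          · exact hSB.1 (hS.out hs ht ⟨h4.le, h2⟩)
          · have h5 : 1 < s := by by_contra h5; exact hs01 ⟨h4, not_lt.1 h5⟩
            exact hSB.2.1 (hS.out ht hs ⟨h3, h5.le⟩)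
        rw [hg, if_neg this]; simp
  · rw [hg]
    split_ifs with h
    · rcases h.1.eq_or_lt with rfl | h2
      · exact h0
      · rcases h.2.eq_or_lt with rfl | h3
        · exact h1
        · exact absurd ⟨h2, h3⟩ ht
    · rfl

/-! ### Moving transversals, and factoring elements of `T(φ)` into transports. -/

section Fragmentation

variable {X : Type*} [TopologicalSpace X] {φ : X ≃ₜ X}

/-- The transversals `{[x, v x] | x ∈ X}` and `{[x, w x] | x ∈ X}` differ by an element of `H`. -/
def MovesTo (H : Subgroup (Suspension φ ≃ₜ Suspension φ)) (v w : X → ℝ) : Prop :=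
  ∃ K : liftGroup φ, descend φ K ∈ H ∧ ∀ x, K.1 x (v x) = w x

theorem MovesTo.refl (H : Subgroup (Suspension φ ≃ₜ Suspension φ)) (v : X → ℝ) : MovesTo H v v :=
  ⟨1, by rw [map_one]; exact one_mem _, fun _ => rfl⟩

theorem MovesTo.trans {H : Subgroup (Suspension φ ≃ₜ Suspension φ)} {u v w : X → ℝ}
    (h : MovesTo H u v) (h' : MovesTo H v w) : MovesTo H u w := by
  obtain ⟨K, hK, hKv⟩ := h
  obtain ⟨L, hL, hLv⟩ := h'
  refine ⟨L * K, by rw [map_mul]; exact mul_mem hL hK, fun x => ?_⟩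
  change L.1 x (K.1 x (u x)) = w x
  rw [hKv, hLv]

/-- The line through `x` meets the transversal of `v` at the parameters `v (φ ^ n x) + n`; the
hypothesis keeps successive ones at least `δ` apart. -/
theorem gap_iter {v : X → ℝ} {δ : ℝ} (hv : ∀ x, δ ≤ v (φ x) + 1 - v x) (x : X) (n : ℕ) :
    n * δ ≤ v ((φ ^ (n : ℤ) : X ≃ₜ X) x) + n - v x := by
  induction n with
  | zero => simp
  | succ n ih =>
    have := hv ((φ ^ (n : ℤ) : X ≃ₜ X) x)
    rw [← iter_succ] at this
    push_cast at this ⊢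
    linarith

theorem eq_zero_of_gap {v : X → ℝ} {δ : ℝ} (hδ : 0 < δ) (hv : ∀ x, δ ≤ v (φ x) + 1 - v x) (x : X)
    (n : ℤ) (h : |v ((φ ^ n : X ≃ₜ X) x) + n - v x| < δ) : n = 0 := by
  by_contra hn
  obtain ⟨k, rfl | rfl⟩ := n.eq_nat_or_neg
  · have h1 := gap_iter hv x k
    have hk : (1 : ℝ) ≤ k := by exact_mod_cast Nat.one_le_iff_ne_zero.2 (by simpa using hn)
    have h2 := le_abs_self (v ((φ ^ (k : ℤ) : X ≃ₜ X) x) + (k : ℤ) - v x)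
    push_cast at h h2
    nlinarith
  · have h1 := gap_iter hv ((φ ^ (-(k : ℤ)) : X ≃ₜ X) x) k
    rw [← iter_add, add_neg_cancel, zpow_zero] at h1
    change _ ≤ v x + k - _ at h1
    have hk : (1 : ℝ) ≤ k := by exact_mod_cast Nat.one_le_iff_ne_zero.2 (by simpa using hn)
    have h2 := neg_le_abs (v ((φ ^ (-(k : ℤ)) : X ≃ₜ X) x) + (-(k : ℤ) : ℤ) - v x)
    push_cast at h h2
    nlinarith

/-- By compactness the family takes finitely many values. Each fibre is clopen, and splitting off
one value at a time writes the family as a product of indicator families. -/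
theorem mem_fibreSubgroup [CompactSpace X] {H : Subgroup (Suspension φ ≃ₜ Suspension φ)} {a : ℝ}
    (h : ∀ D, IsClopen D →
      dyadicPLGroup (Ioo a (a + 1)) ≤ (fibreSubgroup H a).comap (indicatorHom D))
    {F : X → ℝ ≃ₜ ℝ} (hF : IsLocallyConstant F) (hFm : ∀ x, F x ∈ dyadicPLGroup (Ioo a (a + 1))) :
    F ∈ fibreSubgroup H a := by
  classical
  have key : ∀ s : Finset (ℝ ≃ₜ ℝ), ∀ F : X → ℝ ≃ₜ ℝ, IsLocallyConstant F →
      (∀ x, F x ∈ dyadicPLGroup (Ioo a (a + 1))) → (∀ x, F x = 1 ∨ F x ∈ s) →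
      F ∈ fibreSubgroup H a := by
    intro s
    induction s using Finset.induction_on with
    | empty =>
      intro F _ _ h1
      have : F = 1 := funext fun x => by simpa using h1 x
      rw [this]; exact one_mem _
    | insert f s _ ih =>
      intro F hF hFm h1
      by_cases hf : ∃ x, F x = f
      · obtain ⟨x₀, rfl⟩ := hf
        set f := F x₀
        let F' : X → ℝ ≃ₜ ℝ := (fun k => if k = f then 1 else k) ∘ F
        have hF' : F' ∈ fibreSubgroup H a := by
          refine ih F' (hF.comp _) (fun x => ?_) fun x => ?_
          · by_cases hx : F x = f
            · simp only [F', Function.comp, hx, if_true]; exact one_mem _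
            · simpa only [F', Function.comp, hx, if_false] using hFm x
          · by_cases hx : F x = f
            · simp [F', hx]
            · simp only [F', Function.comp, hx, if_false]
              exact (h1 x).imp_right fun h2 => (Finset.mem_insert.1 h2).resolve_left hx
        have heq : F = indicatorHom {x | F x = f} f * F' := by
          funext x
          rw [Pi.mul_apply]
          by_cases hx : F x = f
          · rw [indicatorHom_of_mem (show x ∈ {x | F x = f} from hx)]
            simp only [F', Function.comp, hx, if_true, mul_one]
          · rw [indicatorHom_of_notMem (show x ∉ {x | F x = f} from hx)]
            simp only [F', Function.comp, hx, if_false, one_mul]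
        rw [heq]
        exact mul_mem (h _ (hF.isClopen_fiber f) (hFm x₀)) hF'
      · exact ih F hF hFm fun x => (h1 x).imp_right fun h2 =>
          (Finset.mem_insert.1 h2).resolve_left fun h3 => hf ⟨x, h3⟩
  exact key hF.range_finite.toFinset F hF hFm fun x => .inr (by simp)

/-- A transport supported on `D × (p - η, p + η)`, which embeds as `η ≤ 1/2`. The last clause
records that lines are fixed at parameters representing points outside this domain. -/
theorem exists_step {H : Subgroup (Suspension φ ≃ₜ Suspension φ)}
    (hH : ∀ D u v, IsClopen D → IsDyadic u → IsDyadic v → u < v → v ≤ u + 1 →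
      ContainsTransports H D (Ioo u v)) {D : Set X} (hD : IsClopen D) {p q η : ℝ}
    (hp : IsDyadic p) (hq : IsDyadic q)
    (hη : IsDyadic η) (hη0 : η ≤ 1 / 2) (hpq : |q - p| < η) :
    ∃ K : liftGroup φ, descend φ K ∈ H ∧ (∀ x ∈ D, K.1 x p = q) ∧
      ∀ (x : X) (t : ℝ), (∀ n : ℤ, (φ ^ n : X ≃ₜ X) x ∈ D → t - n ∉ Ioo (p - η) (p + η)) →
        K.1 x t = t := by
  have hpos : 0 < η := (abs_nonneg _).trans_lt hpq
  obtain ⟨hq1, hq2⟩ := abs_lt.1 hpq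
  have hu := hp.sub hη
  have hv := hp.add hη
  have hJ : Ioo (p - η) (p + η) ⊆ Ioo (p - η) (p - η + 1) := Ioo_subset_Ioo_right (by linarith)
  obtain ⟨f, hf, hfp⟩ := exists_mem_map hu hv hp hq ⟨by linarith, by linarith⟩
    ⟨by linarith, by linarith⟩
  obtain ⟨K, hK, hKF⟩ := exists_extension (φ := φ) hu (isLocallyConstant_indicatorHom hD f)
    fun x => dyadicPLGroup_mono hJ (indicatorHom_mem hf x)
  refine ⟨K, ?_, fun x hx => ?_, fun x t ht => ?_⟩
  · refine hH D _ _ hD hu hv (by linarith) (by linarith) f hf _ ((isTransport_iff hJ hf).2 ?_)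
    exact fun x t ht => by rw [descend_mk, hKF x t ht]
  · rw [hKF x p ⟨by linarith, by linarith⟩, indicatorHom_of_mem hx, hfp]
  · set n := ⌊t - (p - η)⌋
    have h1 : (n : ℝ) ≤ t - (p - η) := Int.floor_le _
    have h2 : t - (p - η) < n + 1 := Int.lt_floor_add_one _
    have h3 := liftGroup_iter K.2 n x t
    rw [hKF _ _ ⟨by linarith, by linarith⟩] at h3
    by_cases hx : (φ ^ n : X ≃ₜ X) x ∈ D
    · rw [indicatorHom_of_mem hx, hf.2 _ (ht n hx)] at h3
      linarith
    · rw [indicatorHom_of_notMem hx] at h3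
      change t - n = _ at h3
      linarith

variable [CompactSpace X] {H : Subgroup (Suspension φ ≃ₜ Suspension φ)}

variable (hH : ∀ D u v, IsClopen D → IsDyadic u → IsDyadic v → u < v → v ≤ u + 1 →
    ContainsTransports H D (Ioo u v))

include hH

/-- The pairs of values `(v x, w x)` are finite in number and are treated one at a time, by a
transport that moves the part of the transversal with the given pair and fixes the rest. -/
theorem movesTo_of_close {v w : X → ℝ} (hv : IsLocallyConstant v) (hw : IsLocallyConstant w)
    (hvd : ∀ x, IsDyadic (v x)) (hwd : ∀ x, IsDyadic (w x)) {δ : ℝ} (hδd : IsDyadic δ)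
    (hδ : 0 < δ) (hδ1 : δ ≤ 1) (hvδ : ∀ x, δ ≤ v (φ x) + 1 - v x)
    (hvw : ∀ x, |w x - v x| ≤ δ / 8) : MovesTo H v w := by
  classical
  have hη : IsDyadic (δ / 2) := by
    have := hδd.zpow_mul (-1)
    rwa [zpow_neg_one, mul_comm, ← div_eq_mul_inv] at this
  -- `u` is the intermediate transversal: it has already reached `w`, except where the pair of
  -- values still belongs to `s`.
  have key : ∀ s : Finset (ℝ × ℝ), ∀ u : X → ℝ, IsLocallyConstant u →
      (∀ x, u x = w x ∨ u x = v x ∧ (v x, w x) ∈ s) → MovesTo H u w := by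
    intro s
    induction s using Finset.induction_on with
    | empty =>
      intro u _ h
      have : u = w := funext fun x => by simpa using h x
      rw [this]; exact MovesTo.refl H w
    | insert pq s _ ih =>
      intro u hu h
      obtain ⟨p, q⟩ := pq
      let D : Set X := {x | (u x, v x, w x) = (p, p, q)}
      have hD : IsClopen D := (hu.prodMk (hv.prodMk hw)).isClopen_fiber _
      have hmem : ∀ x, x ∈ D ↔ u x = p ∧ v x = p ∧ w x = q := fun x => by simp [D]
      rcases D.eq_empty_or_nonempty with hempty | ⟨x₀, hx₀⟩
      · refine ih u hu fun x => (h x).imp_right fun hx => ⟨hx.1, ?_⟩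
        refine (Finset.mem_insert.1 hx.2).resolve_left fun heq => ?_
        rw [Prod.mk.injEq] at heq
        have : x ∈ D := (hmem x).2 ⟨hx.1.trans heq.1, heq⟩
        rw [hempty] at this
        exact this
      · obtain ⟨-, hvp, hwq⟩ := (hmem x₀).1 hx₀
        have hp : IsDyadic p := hvp ▸ hvd x₀
        have hq : IsDyadic q := hwq ▸ hwd x₀
        have hpq : |q - p| < δ / 2 := by
          have := hvw x₀
          rw [hvp, hwq] at this
          linarith
        obtain ⟨K, hK, hK1, hK2⟩ := exists_step hH hD hp hq hη (by linarith) hpq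
        have huv : ∀ x, |u x - v x| ≤ δ / 8 := fun x => by
          rcases h x with hx | ⟨hx, -⟩
          · rw [hx]; exact hvw x
          · rw [hx, sub_self, abs_zero]; positivity
        -- `u` stays within `δ / 8` of `v`, so its gaps shrink by at most `δ / 4`; the radius `δ /
        -- 2` of the transport is therefore safe.
        have hgap : ∀ x, δ / 2 ≤ u (φ x) + 1 - u x := fun x => by
          have h1 := hvδ x
          have h2 := abs_le.1 (huv x)
          have h3 := abs_le.1 (huv (φ x))
          linarith
        let u' : X → ℝ := fun x => K.1 x (u x)
        have hu'1 : ∀ x ∈ D, u' x = w x := fun x hx => by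
          obtain ⟨h1, -, h3⟩ := (hmem x).1 hx
          simp only [u', h1, h3, hK1 x hx]
        -- A point of the transversal inside the support would be a crossing closer than the gap to
        -- one over `D`, hence that very crossing.
        have hu'2 : ∀ x ∉ D, u' x = u x := fun x hx => by
          refine hK2 x _ fun n hn ht => hx ?_
          have h1 := ((hmem _).1 hn).1
          have h2 : n = 0 := by
            refine eq_zero_of_gap (by positivity) hgap x n ?_
            rw [h1, abs_lt]
            constructor <;> linarith [ht.1, ht.2]
          subst h2
          exact hn
        have hu' : IsLocallyConstant u' := by
          rw [IsLocallyConstant.iff_eventually_eq]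
          intro x
          by_cases hx : x ∈ D
          · filter_upwards [hD.isOpen.mem_nhds hx, hw.eventually_eq x] with y hy hwy
            rw [hu'1 y hy, hu'1 x hx, hwy]
          · filter_upwards [hD.compl.isOpen.mem_nhds hx, hu.eventually_eq x] with y hy huy
            rw [hu'2 y hy, hu'2 x hx, huy]
        refine MovesTo.trans ⟨K, hK, fun x => rfl⟩ (ih u' hu' fun x => ?_)
        by_cases hx : x ∈ D
        · exact .inl (hu'1 x hx)
        · rw [hu'2 x hx]
          refine (h x).imp_right fun hx' => ⟨hx'.1, ?_⟩
          refine (Finset.mem_insert.1 hx'.2).resolve_left fun heq => ?_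
          rw [Prod.mk.injEq] at heq
          exact hx ((hmem x).2 ⟨hx'.1.trans heq.1, heq⟩)
  exact key (hv.prodMk hw).range_finite.toFinset v hv fun x =>
    .inr ⟨rfl, (Set.Finite.mem_toFinset _).2 ⟨x, rfl⟩⟩

/-- The midpoint of two dyadic transversals is dyadic, inherits the lower bound on gaps by
linearity, and halves the distance. -/
theorem movesTo_of_gap {δ : ℝ} (hδd : IsDyadic δ) (hδ : 0 < δ) (hδ1 : δ ≤ 1) (N : ℕ)
    {v w : X → ℝ} (hv : IsLocallyConstant v) (hw : IsLocallyConstant w)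
    (hvd : ∀ x, IsDyadic (v x)) (hwd : ∀ x, IsDyadic (w x))
    (hvδ : ∀ x, δ ≤ v (φ x) + 1 - v x) (hwδ : ∀ x, δ ≤ w (φ x) + 1 - w x)
    (hvw : ∀ x, |w x - v x| ≤ 2 ^ N * (δ / 8)) : MovesTo H v w := by
  induction N generalizing v w with
  | zero => exact movesTo_of_close hH hv hw hvd hwd hδd hδ hδ1 hvδ (by simpa using hvw)
  | succ N ih =>
    let u : X → ℝ := fun x => 2 ^ (-1 : ℤ) * (v x + w x)
    have hux : ∀ x, u x = (v x + w x) / 2 := fun x => by simp only [u]; rw [zpow_neg_one]; ring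
    have hu : IsLocallyConstant u := (hv.prodMk hw).comp fun p => 2 ^ (-1 : ℤ) * (p.1 + p.2)
    have hud : ∀ x, IsDyadic (u x) := fun x => ((hvd x).add (hwd x)).zpow_mul _
    have huδ : ∀ x, δ ≤ u (φ x) + 1 - u x := fun x => by
      rw [hux, hux]; linarith [hvδ x, hwδ x]
    have hhalf : ∀ x, |(w x - v x) / 2| ≤ 2 ^ N * (δ / 8) := fun x => by
      rw [abs_div, abs_two]
      have := hvw x
      rw [pow_succ] at this
      linarith
    refine (ih hv hu hvd hud hvδ huδ fun x => ?_).trans (ih hu hw hud hwd huδ hwδ fun x => ?_)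
    · rw [hux, show (v x + w x) / 2 - v x = (w x - v x) / 2 by ring]; exact hhalf x
    · rw [hux, show w x - (v x + w x) / 2 = (w x - v x) / 2 by ring]; exact hhalf x

variable [T2Space X] [TotallyDisconnectedSpace X]

/-- Fixing the zero section, the lift also fixes the section at 1, so it restricts to `[0, 1]` as a
family in `F`, locally constant by compactness of `[0, 1]`. -/
theorem descend_mem_of_fixes {G : liftGroup φ} (hG : IsLocallyPL G.1) (h0 : ∀ x, G.1 x 0 = 0) :
    descend φ G ∈ H := by
  have h1 : ∀ x, G.1 x 1 = 1 := by
    intro x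
    have := G.2.1 x 1
    rw [sub_self, h0] at this
    linarith
  have hPL : ∀ x, IsDyadicPLOn (G.1 x) (Icc 0 1) := fun x => isDyadicPLOn_Icc fun s _ => by
    obtain ⟨a, b, ha, hb, -, h⟩ := hG x s
    exact ⟨a, b, ha, hb, h⟩
  choose F hF hFG using fun x => exists_cutoff (G.2.2.1 x) (h0 x) (h1 x) (hPL x)
  have hloc : IsLocallyConstant F := by
    rw [IsLocallyConstant.iff_eventually_eq]
    intro x
    have h2 : ∀ᶠ x' in 𝓝 x, ∀ t ∈ Icc (0 : ℝ) 1, G.1 x' t = G.1 x t :=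
      isCompact_Icc.induction_on (p := fun s => ∀ᶠ x' in 𝓝 x, ∀ t ∈ s, G.1 x' t = G.1 x t)
        (by simp) (fun s t hst h => h.mono fun x' h r hr => h r (hst hr))
        (fun s t hs ht => by
          filter_upwards [hs, ht] with x' h h' r hr
          exact hr.elim (h r) (h' r))
        (fun s _ => by
          obtain ⟨a, b, ha, hb, h, -⟩ := hG x s
          exact ⟨Ioo a b, mem_nhdsWithin_of_mem_nhds (Ioo_mem_nhds ha hb), h⟩)
    filter_upwards [h2] with x' hx'
    refine Homeomorph.ext fun t => ?_
    by_cases ht : t ∈ Icc (0 : ℝ) 1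
    · rw [hFG x' t ht, hFG x t ht, hx' t ht]
    · have ht' : t ∉ Ioo (0 : ℝ) 1 := fun h => ht (Ioo_subset_Icc_self h)
      rw [(hF x').2 t ht', (hF x).2 t ht']
  have d0 : IsDyadic 0 := by simpa using IsDyadic.int 0
  have d1 : IsDyadic (0 + 1) := by simpa using IsDyadic.int 1
  obtain ⟨-, g, hg, hgF⟩ := mem_fibreSubgroup (H := H) (a := 0)
    (fun D hD => (containsTransports_iff d0 hD subset_rfl).1
      (hH D 0 (0 + 1) hD d0 d1 (by norm_num) le_rfl)) hloc (by simpa using hF)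
  have hGF : ActsBy φ 0 F (descend φ G) := fun x t ht => by
    rw [descend_mk, hFG x t (by simpa using ht)]
  rwa [hGF.unique hgF]

theorem groupT_le_of_containsTransports [Nonempty X] (hHT : H ≤ groupT φ) : groupT φ ≤ H := by
  intro g hg
  obtain ⟨G, rfl⟩ := exists_lift hg.1
  have hG := isLocallyPL_of_descend_mem hg
  have hw : IsLocallyConstant fun x => G.1 x 0 := by
    rw [IsLocallyConstant.iff_eventually_eq]
    intro x
    obtain ⟨a, b, ha, hb, h, -⟩ := hG x 0
    exact h.mono fun x' h => h 0 ⟨ha, hb⟩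
  have hc : ∀ t : ℝ, Continuous fun x => G.1 x t := fun t =>
    G.2.2.2.comp (by fun_prop : Continuous fun x : X => (x, t))
  have d0 : IsDyadic 0 := by simpa using IsDyadic.int 0
  -- By equivariance the gap of the image of the zero section at `x` is `G_x(1) - G_x(0)`. Its
  -- minimum over `X` is positive, and `δ = 2 ^ (-k)` is chosen below it.
  obtain ⟨x₀, -, hx₀⟩ := isCompact_univ.exists_isMinOn (univ_nonempty (α := X))
    ((hc 1).sub (hc 0)).continuousOn
  have hε : 0 < G.1 x₀ 1 - G.1 x₀ 0 := sub_pos.2 (G.2.2.1 x₀ one_pos)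
  obtain ⟨k, hk⟩ := exists_pow_lt_of_lt_one hε (by norm_num : (1 / 2 : ℝ) < 1)
  rw [div_pow, one_pow] at hk
  have hδ : (0 : ℝ) < 1 / 2 ^ k := by positivity
  have hδ1 : (1 : ℝ) / 2 ^ k ≤ 1 := by
    rw [div_le_one (by positivity)]; exact one_le_pow₀ (by norm_num)
  -- `M` bounds the displacement of the zero section, and `N` halvings bring it below `δ / 8`.
  obtain ⟨M, hM⟩ := (isCompact_univ (X := X)).exists_bound_of_continuousOn (hc 0).continuousOn
  obtain ⟨N, hN⟩ := pow_unbounded_of_one_lt (M / (1 / 2 ^ k / 8)) (one_lt_two (α := ℝ))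
  rw [div_lt_iff₀ (by positivity)] at hN
  obtain ⟨K, hK, hK0⟩ := movesTo_of_gap hH (isDyadic_one_div k) hδ hδ1 N
    (IsLocallyConstant.const (0 : ℝ)) hw (fun _ => d0) (fun x => (hG.isDyadic_iff x).2 d0)
    (fun x => by simpa using hδ1) (fun x => by
      have h1 := G.2.1 x 1
      rw [sub_self] at h1
      have h2 : G.1 x₀ 1 - G.1 x₀ 0 ≤ G.1 x 1 - G.1 x 0 := hx₀ (mem_univ x)
      rw [h1]
      linarith) (fun x => by
      have := hM x (mem_univ x)
      simp only [Function.const_apply, sub_zero]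
      exact this.trans hN.le)
  have hKG : descend φ (K⁻¹ * G) ∈ groupT φ := by
    rw [map_mul, map_inv]
    exact mul_mem (inv_mem (hHT hK)) hg
  have h1 : descend φ (K⁻¹ * G) ∈ H := by
    refine descend_mem_of_fixes hH (isLocallyPL_of_descend_mem hKG) fun x => ?_
    change (K.1 x).symm (G.1 x 0) = 0
    rw [Homeomorph.symm_apply_eq]
    exact (hK0 x).symm
  rw [map_mul, map_inv] at h1
  exact (Subgroup.mul_mem_cancel_left _ (inv_mem hK)).1 h1

end Fragmentation

/-! ### The local groups as copies of Thompson's group, and the generation of `T(φ)`. -/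

section LocalGroups

variable {X : Type*} [TopologicalSpace X] {φ : X ≃ₜ X} [CompactSpace X] [T2Space X]
  [TotallyDisconnectedSpace X]

theorem exists_transportHom {a : ℝ} (ha : IsDyadic a) {D : Set X} (hD : IsClopen D) {J : Set ℝ}
    (hJ : J ⊆ Ioo a (a + 1)) :
    ∃ e : dyadicPLGroup J →* localF φ D J,
      Function.Surjective e ∧ ∀ f : dyadicPLGroup J, IsTransport φ D J f (e f).1.1 := by
  have hex : ∀ f : dyadicPLGroup J, ∃ g : localF φ D J, IsTransport φ D J f g.1.1 := fun f => by
    obtain ⟨g, hg, h⟩ := exists_actsBy (φ := φ) ha (isLocallyConstant_indicatorHom hD f.1)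
      fun x => dyadicPLGroup_mono hJ (indicatorHom_mem f.2 x)
    have h' := (isTransport_iff hJ f.2).2 h
    exact ⟨⟨⟨g, hg⟩, f.1, f.2, h'⟩, h'⟩
  choose e he using hex
  have huniq : ∀ (f : dyadicPLGroup J) (g : localF φ D J), IsTransport φ D J f g.1.1 → e f = g :=
    fun f g h => Subtype.ext <| Subtype.ext <|
      ((isTransport_iff hJ f.2).1 (he f)).unique ((isTransport_iff hJ f.2).1 h)
  refine ⟨MonoidHom.mk' e fun f f' => huniq _ _ ⟨fun x hx t ht => ?_, fun y hy => ?_⟩, ?_, he⟩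
  · change (e f).1.1 ((e f').1.1 _) = _
    rw [(he f').1 x hx t ht, (he f).1 x hx _ ((mem_iff_of_mem_dyadicPLGroup f'.2 t).2 ht)]
    rfl
  · change (e f).1.1 ((e f').1.1 _) = _
    rw [(he f').2 y hy, (he f).2 y hy]
  · rintro ⟨g, f, hf, h⟩
    exact ⟨⟨f, hf⟩, huniq _ _ h⟩

/-- Along one point `x ∈ D`, `f` can be read off from `[x, f t]`, since distinct parameters within a
period give distinct classes. -/
theorem exists_transportEquiv {a : ℝ} (ha : IsDyadic a) {D : Set X} (hD : IsClopen D)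
    (hne : D.Nonempty) {J : Set ℝ} (hJ : J ⊆ Ioo a (a + 1)) :
    ∃ e : dyadicPLGroup J ≃* localF φ D J,
      ∀ f : dyadicPLGroup J, IsTransport φ D J f (e f).1.1 := by
  obtain ⟨e, he, h⟩ := exists_transportHom (φ := φ) ha hD hJ
  obtain ⟨x, hx⟩ := hne
  have hinj : Function.Injective e := fun f f' hff' => by
    refine Subtype.ext (Homeomorph.ext fun t => ?_)
    by_cases ht : t ∈ J
    · have h1 := (h f).1 x hx t ht
      rw [hff', (h f').1 x hx t ht] at h1
      exact (eq_of_mk_eq (Ioo_subset_Icc_self (hJ ((mem_iff_of_mem_dyadicPLGroup f'.2 t).2 ht)))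
        (hJ ((mem_iff_of_mem_dyadicPLGroup f.2 t).2 ht)) h1).2
    · rw [f.2.2 t ht, f'.2.2 t ht]
  exact ⟨MulEquiv.ofBijective e ⟨hinj, he⟩, h⟩

/-- A surjection from `F` suffices, so `D` may be empty. -/
theorem localF_fg {u v : ℝ} (hu : IsDyadic u) (hv : IsDyadic v) (huv : u < v) (hvu : v ≤ u + 1)
    {D : Set X} (hD : IsClopen D) : (localF φ D (Ioo u v)).FG := by
  obtain ⟨e, he, -⟩ := exists_transportHom (φ := φ) hu hD (Ioo_subset_Ioo_right hvu)
  obtain ⟨i⟩ := nonempty_mulEquiv (by simpa using IsDyadic.int 0) (by simpa using IsDyadic.int 1)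
    hu hv one_pos huv
  have := thompsonF_fg
  have : Group.FG (dyadicPLGroup (Ioo u v)) :=
    Group.fg_of_surjective (f := i.toMonoidHom) i.surjective
  rw [← Group.fg_iff_subgroup_fg]
  exact Group.fg_of_surjective he

theorem containsTransports_map {a : ℝ} (ha : IsDyadic a) {D : Set X} (hD : IsClopen D) {J : Set ℝ}
    (hJ : J ⊆ Ioo a (a + 1)) {S : Subgroup (groupT φ)} (hS : localF φ D J ≤ S) :
    ContainsTransports (S.map (groupT φ).subtype) D J := fun f hf g hg =>
  ⟨⟨g, hg.mem_groupT ha hD hJ hf⟩, hS ⟨f, hf, hg⟩, rfl⟩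

theorem isDyadic_neg_quarter : IsDyadic (-1 / 4) := by
  convert isDyadic_div_sixteen (-4) using 1; norm_num

theorem isDyadic_quarter : IsDyadic (1 / 4) := by
  convert isDyadic_div_sixteen 4 using 1; norm_num

theorem isDyadic_half : IsDyadic (1 / 2) := by
  convert isDyadic_div_sixteen 8 using 1; norm_num

theorem isDyadic_nine_eighths : IsDyadic (1 + 1 / 8) := by
  convert isDyadic_div_sixteen 18 using 1; norm_num

theorem I₀_subset : I₀ ⊆ Ioo (-1 / 4) (-1 / 4 + 1) := Ioo_subset_Ioo_right (by norm_num)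

theorem I₁_subset : I₁ ⊆ Ioo (1 / 4) (1 / 4 + 1) := Ioo_subset_Ioo_right (by norm_num)

theorem localF_sup_iSup_localF_eq_top [Nonempty X] {d : ℕ} {C : Fin d → Set X}
    (hC : IsGeneratingPartition φ C) : localF φ univ I₀ ⊔ ⨆ i, localF φ (C i) I₁ = ⊤ := by
  set S := localF φ univ I₀ ⊔ ⨆ i, localF φ (C i) I₁
  have h₀ : ContainsTransports (S.map (groupT φ).subtype) univ I₀ :=
    containsTransports_map isDyadic_neg_quarter isClopen_univ I₀_subset le_sup_left
  have h₁ : ∀ i, ContainsTransports (S.map (groupT φ).subtype) (C i) I₁ := fun i =>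
    containsTransports_map isDyadic_quarter (hC.isClopen i) I₁_subset
      ((le_iSup (fun i => localF φ (C i) I₁) i).trans le_sup_right)
  have hle : groupT φ ≤ S.map (groupT φ).subtype :=
    groupT_le_of_containsTransports (fun D u v hD hu hv huv hvu =>
      containsTransports_of_isGeneratingPartition h₀ hC h₁ hD hu hv huv hvu)
      (Subgroup.map_subtype_le S)
  refine eq_top_iff.2 fun g _ => ?_
  obtain ⟨g', hg', h⟩ := hle g.2
  rwa [← Subtype.ext (show g'.1 = g.1 from h)]

theorem groupT_fg [Nonempty X] {d : ℕ} {C : Fin d → Set X} (hC : IsGeneratingPartition φ C) :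
    Group.FG (groupT φ) := by
  refine ⟨?_⟩
  rw [← localF_sup_iSup_localF_eq_top hC]
  have h1 : ∀ i, (localF φ (C i) I₁).FG := fun i =>
    localF_fg isDyadic_quarter isDyadic_nine_eighths (by norm_num) (by norm_num) (hC.isClopen i)
  exact (localF_fg isDyadic_neg_quarter isDyadic_half (by norm_num) (by norm_num)
    isClopen_univ).sup (Subgroup.FG.iSup _ h1)

end LocalGroups

/-! ### Subshifts have generating partitions. -/

theorem IsConjugateToSubshift.exists_isGeneratingPartition {X : Type*} [TopologicalSpace X]
    {φ : X ≃ₜ X} (h : IsConjugateToSubshift φ) :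
    ∃ (d : ℕ) (C : Fin d → Set X), IsGeneratingPartition φ C := by
  obtain ⟨A, hA, _, _, S, -, -, -, e, he⟩ := h
  obtain ⟨d, ⟨enum⟩⟩ := Finite.exists_equiv_fin A
  have hcont : Continuous fun x => (e x : ℤ → A) 0 :=
    (continuous_apply 0).comp (continuous_subtype_val.comp e.continuous)
  have hnat : ∀ (n : ℕ) (x : X) (m : ℤ),
      (e ((φ ^ (n : ℤ) : X ≃ₜ X) x) : ℤ → A) m = (e x : ℤ → A) (m + n) := by
    intro n x
    induction n with
    | zero => simp
    | succ n ih =>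
      intro m
      rw [Nat.cast_succ, iter_succ, he, shift, ih, add_assoc, add_comm 1]
  have hiter : ∀ (n : ℤ) (x : X), (e ((φ ^ n : X ≃ₜ X) x) : ℤ → A) 0 = (e x : ℤ → A) n := by
    intro n x
    obtain ⟨k, rfl | rfl⟩ := n.eq_nat_or_neg
    · rw [hnat, zero_add]
    -- The forward formula, applied at `φ⁻ᵏ x` and coordinate `-k`, gives the negative powers.
    · have := hnat k ((φ ^ (-(k : ℤ)) : X ≃ₜ X) x) (-k)
      rw [← iter_add, add_neg_cancel, neg_add_cancel] at this
      simpa using this.symm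
  -- The pieces are the cylinders of the letter at coordinate 0; their translates read off every
  -- other coordinate.
  refine ⟨d, fun i => {x | (e x : ℤ → A) 0 = enum.symm i}, fun i => ?_, fun i j hij => ?_, ?_,
    fun x y hxy => ?_⟩
  · exact (isClopen_discrete {enum.symm i}).preimage hcont
  · rw [disjoint_left]
    intro x hx hx'
    exact hij (enum.symm.injective (hx.symm.trans hx'))
  · exact eq_univ_of_forall fun x => mem_iUnion.2 ⟨enum ((e x : ℤ → A) 0), by simp⟩
  · obtain ⟨n, hn⟩ : ∃ n, (e x : ℤ → A) n ≠ (e y : ℤ → A) n := by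
      by_contra! hall
      exact hxy (e.injective (Subtype.ext (funext hall)))
    have himg : ∀ (z : X) (a : A), z ∈ (φ ^ (-n) : X ≃ₜ X) '' {x | (e x : ℤ → A) 0 = a} ↔
        (e z : ℤ → A) n = a := by
      intro z a
      rw [← hiter]
      constructor
      · rintro ⟨w, hw, rfl⟩
        rw [← iter_add, add_neg_cancel]
        exact hw
      · intro hz
        refine ⟨(φ ^ n : X ≃ₜ X) z, hz, ?_⟩
        rw [← iter_add, neg_add_cancel]
        rfl
    -- A point lies in `φ⁻ⁿ(C i)` exactly when its `n`-th letter is the one numbered `i`, hence the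
    -- sign.
    refine ⟨-n, enum ((e x : ℤ → A) n), ?_, ?_⟩
    · rw [himg]; simp
    · rw [himg]; simpa using hn.symm

end StoneSystem

theorem mainTheorem2 {X : Type*} [TopologicalSpace X] [CompactSpace X] [T2Space X]
    [TotallyDisconnectedSpace X] [Nonempty X] (φ : X ≃ₜ X) :
    (StoneSystem.IsConjugateToSubshift φ → Group.FG (StoneSystem.groupT φ)) ∧
    ∀ (d : ℕ) (C : Fin d → Set X), StoneSystem.IsGeneratingPartition φ C →
      StoneSystem.localF φ univ StoneSystem.I₀ ⊔
          ⨆ i, StoneSystem.localF φ (C i) StoneSystem.I₁ = ⊤ ∧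
      ((∃ e : StoneSystem.dyadicPLGroup StoneSystem.I₀ ≃*
            StoneSystem.localF φ univ StoneSystem.I₀,
          ∀ f : StoneSystem.dyadicPLGroup StoneSystem.I₀,
            StoneSystem.IsTransport φ univ StoneSystem.I₀ f (e f).1.1) ∧
        Nonempty (StoneSystem.localF φ univ StoneSystem.I₀ ≃* StoneSystem.thompsonF)) ∧
      ∀ i, (C i).Nonempty →
        (∃ e : StoneSystem.dyadicPLGroup StoneSystem.I₁ ≃*
            StoneSystem.localF φ (C i) StoneSystem.I₁,
          ∀ f : StoneSystem.dyadicPLGroup StoneSystem.I₁,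
            StoneSystem.IsTransport φ (C i) StoneSystem.I₁ f (e f).1.1) ∧
        Nonempty (StoneSystem.localF φ (C i) StoneSystem.I₁ ≃* StoneSystem.thompsonF) := by
  have d0 : StoneSystem.IsDyadic 0 := by simpa using StoneSystem.IsDyadic.int 0
  have d1 : StoneSystem.IsDyadic 1 := by simpa using StoneSystem.IsDyadic.int 1
  refine ⟨fun h => ?_, fun d C hC => ⟨StoneSystem.localF_sup_iSup_localF_eq_top hC, ?_,
    fun i hi => ?_⟩⟩
  · obtain ⟨d, C, hC⟩ := h.exists_isGeneratingPartition
    exact StoneSystem.groupT_fg hC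
  · obtain ⟨e, he⟩ := StoneSystem.exists_transportEquiv (φ := φ) StoneSystem.isDyadic_neg_quarter
      isClopen_univ univ_nonempty StoneSystem.I₀_subset
    obtain ⟨j⟩ := StoneSystem.nonempty_mulEquiv StoneSystem.isDyadic_neg_quarter
      StoneSystem.isDyadic_half d0 d1 (by norm_num) one_pos
    exact ⟨⟨e, he⟩, ⟨e.symm.trans j⟩⟩
  · obtain ⟨e, he⟩ := StoneSystem.exists_transportEquiv (φ := φ) StoneSystem.isDyadic_quarter
      (hC.isClopen i) hi StoneSystem.I₁_subset
    obtain ⟨j⟩ := StoneSystem.nonempty_mulEquiv StoneSystem.isDyadic_quarter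
      StoneSystem.isDyadic_nine_eighths d0 d1 (by norm_num) one_pos
    exact ⟨⟨e, he⟩, ⟨e.symm.trans j⟩⟩
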